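/- Let $X$ be a finite $T_0$-space. For $Y\subseteq X$ let $\overline Y$ be its closure and $\widetilde Y$ the smallest open set containing $Y$. Write $x\le y$ if $\overline{\{x\}}\subseteq\overline{\{y\}}$, and $y\to x$ if $x<y$ and there is no $z$ with $x<z<y$; a path from $y$ to $x$ is a finite chain $y=z_n\to\cdots\to z_1=x$ with $n\ge 1$. A boundary pair is a pair $(U,C)$ with $U$ relatively open in some locally closed $Y\subseteq X$ and $C=Y\setminus U$. It is elementary if $U,C$ are connected (in particular non-empty), $U$ is open, $C$ is closed, $U\subseteq\widetilde C$ and $C\subseteq\overline U$. The space $X$ is an EBP space if there is at most one path between any two points (in a given direction) and every elementary boundary pair is of the form $(\widetilde{\{x\}},\overline{\{y\}})$ with $x\to y$. Maps are composed from left to right. Let $\mathcal{ST}$ be the universal pre-additive category with objects $(Y,j)$, where $Y\subseteq X$ is locally closed and $j\in\mathbb Z/2$, generated by $i_U^Y\colon(U,j)\to(Y,j)$ for $U$ open in $Y$, $r_Y^C\colon(Y,j)\to(C,j)$ for $C$ closed in $Y$, and $\delta_C^U\colon(C,j)\to(U,j+1)$ for boundary pairs $(U,C)$, subject to the following relations in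 each degree (all sets locally closed): 1. $i_Y^Y=r_Y^Y=\mathrm{id}$; 2. $r_{Y\cup Z}^Yi_Y^{Y\cup Z}+r_{Y\cup Z}^Zi_Z^{Y\cup Z}=\mathrm{id}$ if $\overline Y\cap Z=\emptyset=Y\cap\overline Z$; 3. $i_U^Vi_V^Y=i_U^Y$ for $U\subseteq V\subseteq Y$ open in $Y$; 4. $r_Y^Dr_D^C=r_Y^C$ for $C\subseteq D\subseteq Y$ closed in $Y$; 5. $i_U^Yr_Y^C=r_U^{U\cap C}i_{U\cap C}^C$ for $U$ open and $C$ closed in $Y$; 6. $i_{C'}^C\delta_C^U=\delta_{C'}^U$ for $(U,C)$ a boundary pair and $C'$ open in $C$; 7. $\delta_C^Ur_U^{U'}=\delta_C^{U'}$ for $(U,C)$ a boundary pair and $U'$ closed in $U$; 8. $\delta_Y^{W\setminus Y}i_{W\setminus Y}^Z=r_Y^{W\setminus Z}\delta_{W\setminus Z}^Z$ whenever $Y,W$ are closed in the locally closed set $Y\cup W$, $Z,W$ are open in the locally closed set $Z\cup W$, and $W\subseteq Y\cup Z$. An $\mathcal{ST}$-module is an additive functor $M$ from $\mathcal{ST}$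 to abelian groups; homomorphisms are natural transformations. It is exact if for all locally closed $Y$, all $U$ open in $Y$ and $C=Y\setminus U$, the cyclic six-term sequence $M(U,0)\to M(Y,0)\to M(C,0)\to M(U,1)\to M(Y,1)\to M(C,1)\to M(U,0)$ given by $i,r,\delta$ is exact, and real-rank-zero-like if $\delta\colon M(C,0)\to M(U,1)$ is always zero. Let $\mathcal R$ be the universal pre-additive category with three objects $x_1$, $\widetilde\partial x_0$, $\tilde x_0$ for each $x\in X$, generated by $\delta\colon x_1\to\widetilde\partial x_0$ and $i\colon\widetilde\partial x_0\to\tilde x_0$ for $x\in X$ and $i\colon\tilde y_0\to\widetilde\partial x_0$ for $y\to x$, subject to $\delta i=0$ and, for all $y>x$, to the equality of the composites $\tilde y_0\to\widetilde\partial x_0$ along any two paths from $y$ to $x$. There is a canonical additive functor $\mathcal R\to\mathcal{ST}$ with $x_1\mapsto(\{x\},1)$, $\widetilde\partial x_0\mapsto(\widetilde{\{x\}}\setminus\{x\},0)$, $\tilde x_0\mapsto(\widetilde{\{x\}},0)$; let $\mathfrak F_{\mathcal R}$ be the induced functor from $\mathcal{ST}$-modules to $\mathcal R$-modules, that is, additive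 functors from $\mathcal R$ to abelian groups. **Theorem.** Let $X$ be an EBP space and let $M,N$ be exact real-rank-zero-like $\mathcal{ST}$-modules such that $M(\{x\},1)$ and $N(\{x\},1)$ are free abelian groups for all points $x$ with $\{x\}$ not open. Then for every $\mathcal R$-module homomorphism $\phi\colon\mathfrak F_{\mathcal R}(M)\to\mathfrak F_{\mathcal R}(N)$ there is an $\mathcal{ST}$-module homomorphism $\Phi\colon M\to N$ with $\mathfrak F_{\mathcal R}(\Phi)=\phi$, and if $\phi$ is an isomorphism then so is $\Phi$. The lift $\Phi$ is not unique in general: there are such $X$, $M$, $N$ and two different homomorphisms $\Phi,\Psi\colon M\to N$ with $\mathfrak F_{\mathcal R}(\Phi)=\mathfrak F_{\mathcal R}(\Psi)$. -/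

import Mathlib

open CategoryTheory

universe u v w

-- Morphisms of a category are always read through its own `Quiver` structure.
attribute [-instance] catToReflQuiver

namespace FilteredK

/-! ### Pre-additive categories given by generators and relations -/

section Presentation

variable {V : Type u} (G : V → V → Type v)

/-- Formal expressions for the morphisms of the pre-additive category that is generated by the
objects `V` and the arrows `G`. Composition is written in diagrammatic order. -/
inductive Term : V → V → Type (max u v)
  | of {a b : V} (g : G a b) : Term a b
  | id (a : V) : Term a a
  | comp {a b c : V} (f : Term a b) (g : Term b c) : Term a c
  | zero (a b : V) : Term a b
  | add {a b : V} (f g : Term a b) : Term a b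
  | neg {a b : V} (f : Term a b) : Term a b

/-- A family of relations between formal expressions. -/
abbrev TermRel := ∀ ⦃a b : V⦄, Term G a b → Term G a b → Prop

variable {G}

/-- The smallest congruence that contains the relations `R` and the axioms of a pre-additive
category. -/
inductive TermEq (R : TermRel G) : ∀ {a b : V}, Term G a b → Term G a b → Prop
  | rel {a b : V} {f g : Term G a b} (h : R f g) : TermEq R f g
  | refl {a b : V} (f : Term G a b) : TermEq R f f
  | symm {a b : V} {f g : Term G a b} (h : TermEq R f g) : TermEq R g f
  | trans {a b : V} {f g h : Term G a b} (h₁ : TermEq R f g) (h₂ : TermEq R g h) : TermEq R f h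
  | comp_congr {a b c : V} {f f' : Term G a b} {g g' : Term G b c}
      (h₁ : TermEq R f f') (h₂ : TermEq R g g') : TermEq R (f.comp g) (f'.comp g')
  | add_congr {a b : V} {f f' g g' : Term G a b}
      (h₁ : TermEq R f f') (h₂ : TermEq R g g') : TermEq R (f.add g) (f'.add g')
  | neg_congr {a b : V} {f f' : Term G a b} (h : TermEq R f f') : TermEq R f.neg f'.neg
  | id_comp {a b : V} (f : Term G a b) : TermEq R ((Term.id a).comp f) f
  | comp_id {a b : V} (f : Term G a b) : TermEq R (f.comp (Term.id b)) f
  | assoc {a b c d : V} (f : Term G a b) (g : Term G b c) (h : Term G c d) :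
      TermEq R ((f.comp g).comp h) (f.comp (g.comp h))
  | add_assoc {a b : V} (f g h : Term G a b) :
      TermEq R ((f.add g).add h) (f.add (g.add h))
  | zero_add {a b : V} (f : Term G a b) : TermEq R ((Term.zero a b).add f) f
  | add_comm {a b : V} (f g : Term G a b) : TermEq R (f.add g) (g.add f)
  | neg_add {a b : V} (f : Term G a b) : TermEq R (f.neg.add f) (Term.zero a b)
  | add_comp {a b c : V} (f f' : Term G a b) (g : Term G b c) :
      TermEq R ((f.add f').comp g) ((f.comp g).add (f'.comp g))
  | comp_add {a b c : V} (f : Term G a b) (g g' : Term G b c) :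
      TermEq R (f.comp (g.add g')) ((f.comp g).add (f.comp g'))

/-- The universal pre-additive category with objects `V`, generated by the arrows `G` subject to
the relations `R`. -/
@[ext]
structure Presented (R : TermRel G) where
  /-- The underlying object. -/
  as : V

namespace Presented

variable (R : TermRel G)

/-- Morphisms: formal expressions modulo the congruence. -/
def Hom (a b : V) : Type (max u v) := Quot (fun f g : Term G a b => TermEq R f g)

variable {R}

/-- The class of a formal expression. -/
def cls {a b : V} (f : Term G a b) : Hom R a b := Quot.mk _ f

theorem cls_eq {a b : V} {f g : Term G a b} (h : TermEq R f g) :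
    (cls f : Hom R a b) = cls g := Quot.sound h

instance : Category (Presented R) where
  Hom a b := Hom R a.as b.as
  id a := cls (Term.id a.as)
  comp f g := Quot.map₂ Term.comp (fun _ _ _ h => .comp_congr (.refl _) h)
    (fun _ _ _ h => .comp_congr h (.refl _)) f g
  id_comp := by rintro _ _ ⟨f⟩; exact cls_eq (.id_comp f)
  comp_id := by rintro _ _ ⟨f⟩; exact cls_eq (.comp_id f)
  assoc := by rintro _ _ _ _ ⟨f⟩ ⟨g⟩ ⟨h⟩; exact cls_eq (.assoc f g h)

instance (a b : V) : Add (Hom R a b) where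
  add f g := Quot.map₂ Term.add (fun _ _ _ h => .add_congr (.refl _) h)
    (fun _ _ _ h => .add_congr h (.refl _)) f g

instance (a b : V) : Zero (Hom R a b) where
  zero := cls (Term.zero a b)

instance (a b : V) : Neg (Hom R a b) where
  neg f := Quot.map Term.neg (fun _ _ h => .neg_congr h) f

instance (a b : V) : AddCommGroup (Hom R a b) where
  add_assoc := by rintro ⟨f⟩ ⟨g⟩ ⟨h⟩; exact cls_eq (.add_assoc f g h)
  zero_add := by rintro ⟨f⟩; exact cls_eq (.zero_add f)
  add_zero := by rintro ⟨f⟩; exact cls_eq (.trans (.add_comm _ _) (.zero_add f))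
  add_comm := by rintro ⟨f⟩ ⟨g⟩; exact cls_eq (.add_comm f g)
  neg_add_cancel := by rintro ⟨f⟩; exact cls_eq (.neg_add f)
  nsmul := nsmulRec
  zsmul := zsmulRec

instance : Preadditive (Presented R) where
  homGroup a b := inferInstanceAs (AddCommGroup (Hom R a.as b.as))
  add_comp := by rintro _ _ _ ⟨f⟩ ⟨f'⟩ ⟨g⟩; exact cls_eq (.add_comp f f' g)
  comp_add := by rintro _ _ _ ⟨f⟩ ⟨g⟩ ⟨g'⟩; exact cls_eq (.comp_add f g g')

/-- The morphism of the presented category that a formal expression stands for. -/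
def hom {a b : V} (f : Term G a b) : (⟨a⟩ : Presented R) ⟶ ⟨b⟩ := cls f

theorem hom_eq {a b : V} {f g : Term G a b} (h : TermEq R f g) :
    (hom f : (⟨a⟩ : Presented R) ⟶ ⟨b⟩) = hom g := cls_eq h

end Presented

variable {D : Type*} [Category* D] [Preadditive D]

/-- The value of a formal expression in a pre-additive category. -/
def Term.eval {obj : V → D} (gen : ∀ ⦃a b : V⦄, G a b → (obj a ⟶ obj b)) :
    ∀ {a b : V}, Term G a b → (obj a ⟶ obj b)
  | _, _, .of g => gen g
  | _, _, .id _ => 𝟙 _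
  | _, _, .comp f g => f.eval gen ≫ g.eval gen
  | _, _, .zero _ _ => 0
  | _, _, .add f g => f.eval gen + g.eval gen
  | _, _, .neg f => - f.eval gen

theorem Term.eval_eq {obj : V → D} (gen : ∀ ⦃a b : V⦄, G a b → (obj a ⟶ obj b)) {R : TermRel G}
    (hR : ∀ ⦃a b : V⦄ (f g : Term G a b), R f g → f.eval gen = g.eval gen)
    {a b : V} {f g : Term G a b} (h : TermEq R f g) : f.eval gen = g.eval gen := by
  induction h with
  | rel h => exact hR _ _ h
  | refl => rfl
  | symm _ ih => exact ih.symm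
  | trans _ _ ih₁ ih₂ => exact ih₁.trans ih₂
  | comp_congr _ _ ih₁ ih₂ => simp only [Term.eval, ih₁, ih₂]
  | add_congr _ _ ih₁ ih₂ => simp only [Term.eval, ih₁, ih₂]
  | neg_congr _ ih => simp only [Term.eval, ih]
  | id_comp => simp only [Term.eval, Category.id_comp]
  | comp_id => simp only [Term.eval, Category.comp_id]
  | assoc => simp only [Term.eval, Category.assoc]
  | add_assoc => simp only [Term.eval, _root_.add_assoc]
  | zero_add => simp only [Term.eval, _root_.zero_add]
  | add_comm => simp only [Term.eval]; exact _root_.add_comm _ _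
  | neg_add => simp only [Term.eval, neg_add_cancel]
  | add_comp => simp only [Term.eval, Preadditive.add_comp]
  | comp_add => simp only [Term.eval, Preadditive.comp_add]

/-- The universal property: the functor that is given on objects and generators. -/
def Presented.lift {R : TermRel G} (obj : V → D) (gen : ∀ ⦃a b : V⦄, G a b → (obj a ⟶ obj b))
    (hR : ∀ ⦃a b : V⦄ (f g : Term G a b), R f g → f.eval gen = g.eval gen) :
    Presented R ⥤ D where
  obj a := obj a.as
  map {a b} f := Quot.lift (fun t : Term G a.as b.as => t.eval gen)
    (fun _ _ h => Term.eval_eq gen hR h) f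
  map_id _ := rfl
  map_comp := by rintro _ _ _ ⟨f⟩ ⟨g⟩; rfl

instance {R : TermRel G} (obj : V → D) (gen : ∀ ⦃a b : V⦄, G a b → (obj a ⟶ obj b))
    (hR : ∀ ⦃a b : V⦄ (f g : Term G a b), R f g → f.eval gen = g.eval gen) :
    (Presented.lift obj gen hR).Additive where
  map_add := by rintro _ _ ⟨f⟩ ⟨g⟩; rfl

end Presentation

/-! ### Finite spaces -/

section Space

variable {X : Type u} [TopologicalSpace X]

/-- `U` is a relatively open subset of `Y`. -/
def OpenIn (U Y : Set X) : Prop := ∃ O : Set X, IsOpen O ∧ U = O ∩ Y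

/-- `C` is a relatively closed subset of `Y`. -/
def ClosedIn (C Y : Set X) : Prop := ∃ F : Set X, IsClosed F ∧ C = F ∩ Y

/-- `(U, C)` is a boundary pair: `U` is relatively open in a locally closed set `Y`, and
`C = Y \ U`. -/
def BoundaryPair (U C : Set X) : Prop :=
  ∃ Y : Set X, IsLocallyClosed Y ∧ OpenIn U Y ∧ C = Y \ U

/-- `Arrow y x` is `y → x`: with `a ≤ b` meaning that `closure {a} ⊆ closure {b}`, we have
`x < y` and no element lies strictly between. -/
def Arrow (y x : X) : Prop :=
  closure {x} ⊆ closure {y} ∧ x ≠ y ∧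
    ∀ z : X, closure {x} ⊆ closure {z} → closure {z} ⊆ closure {y} → z = x ∨ z = y

/-- Directed paths along arrows, from the first to the second argument. -/
inductive DPath : X → X → Type u
  | nil (x : X) : DPath x x
  | cons {y z x : X} (h : Arrow y z) (p : DPath z x) : DPath y x

variable (X) in
/-- There is at most one path from any point to any other. -/
def UniquePathSpace : Prop := ∀ y x : X, Subsingleton (DPath y x)

/-- Elementary boundary pairs. `nhdsKer C` is the smallest open set that contains `C`; connected
sets are nonempty. -/
structure ElementaryBoundaryPair (U C : Set X) : Prop where
  boundaryPair : BoundaryPair U C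
  connected_left : IsConnected U
  connected_right : IsConnected C
  isOpen : IsOpen U
  isClosed : IsClosed C
  subset_nhdsKer : U ⊆ nhdsKer C
  subset_closure : C ⊆ closure U

variable (X) in
/-- EBP spaces (for finite T₀-spaces). -/
structure EBPSpace : Prop where
  uniquePath : UniquePathSpace X
  elementary : ∀ U C : Set X, ElementaryBoundaryPair U C →
    ∃ x y : X, Arrow x y ∧ U = nhdsKer {x} ∧ C = closure {y}

variable (X) in
/-- Locally closed subsets. -/
def LC : Type u := {Y : Set X // IsLocallyClosed Y}

theorem OpenIn.closedIn_diff {U Y : Set X} (h : OpenIn U Y) : ClosedIn (Y \ U) Y := by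
  obtain ⟨O, hO, rfl⟩ := h
  exact ⟨Oᶜ, hO.isClosed_compl, by ext; simp; tauto⟩

theorem openIn_of_isOpen {U Y : Set X} (hU : IsOpen U) (h : U ⊆ Y) : OpenIn U Y :=
  ⟨U, hU, (Set.inter_eq_left.2 h).symm⟩

/-- A locally closed `Y`, a relatively open subset `U` and its complement `C = Y \ U`: the data
of a six-term sequence. -/
structure Extension (U Y C : LC X) : Prop where
  openIn : OpenIn U.1 Y.1
  eq_diff : C.1 = Y.1 \ U.1

theorem Extension.closedIn {U Y C : LC X} (h : Extension U Y C) : ClosedIn C.1 Y.1 :=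
  h.eq_diff ▸ h.openIn.closedIn_diff

theorem Extension.boundaryPair {U Y C : LC X} (h : Extension U Y C) : BoundaryPair U.1 C.1 :=
  ⟨Y.1, Y.2, h.openIn, h.eq_diff⟩

end Space

/-! ### The category `ST` -/

section ST

variable (X : Type u) [TopologicalSpace X]

/-- Objects of `ST`: pairs of a locally closed subset and a degree in `ℤ/2`. -/
structure STObj : Type u where
  /-- The locally closed subset. -/
  set : LC X
  /-- The degree. -/
  deg : ZMod 2

variable {X}

/-- Generators of `ST`: `i` and `r` preserve the degree, `δ` changes it. -/
inductive STGen : STObj X → STObj X → Type u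
  | i (U Y : LC X) (h : OpenIn U.1 Y.1) (j : ZMod 2) : STGen ⟨U, j⟩ ⟨Y, j⟩
  | r (Y C : LC X) (h : ClosedIn C.1 Y.1) (j : ZMod 2) : STGen ⟨Y, j⟩ ⟨C, j⟩
  | δ (C U : LC X) (h : BoundaryPair U.1 C.1) (j k : ZMod 2) (hk : k = j + 1) :
      STGen ⟨C, j⟩ ⟨U, k⟩

/-- The generator `i_U^Y` in degree `j`. -/
def ti {U Y : LC X} (h : OpenIn U.1 Y.1) (j : ZMod 2) : Term STGen ⟨U, j⟩ ⟨Y, j⟩ :=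
  .of (.i U Y h j)

/-- The generator `r_Y^C` in degree `j`. -/
def tr {Y C : LC X} (h : ClosedIn C.1 Y.1) (j : ZMod 2) : Term STGen ⟨Y, j⟩ ⟨C, j⟩ :=
  .of (.r Y C h j)

/-- The generator `δ_C^U` from degree `j` to degree `k = j + 1`. -/
def tδ {C U : LC X} (h : BoundaryPair U.1 C.1) (j k : ZMod 2) (hk : k = j + 1) :
    Term STGen ⟨C, j⟩ ⟨U, k⟩ :=
  .of (.δ C U h j k hk)

/-- The relations of `ST`, in each degree. Besides the hypotheses of a relation, the arguments
include the side conditions (all of them consequences of these hypotheses) under which the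
generators that occur in it are defined. -/
inductive STRel : ∀ ⦃a b : STObj X⦄, Term STGen a b → Term STGen a b → Prop
  | i_self (Y : LC X) (h : OpenIn Y.1 Y.1) (j : ZMod 2) : STRel (ti h j) (.id _)
  | r_self (Y : LC X) (h : ClosedIn Y.1 Y.1) (j : ZMod 2) : STRel (tr h j) (.id _)
  | biproduct (Y Z W : LC X) (hYZ : Disjoint (closure Y.1) Z.1) (hZY : Disjoint Y.1 (closure Z.1))
      (hW : W.1 = Y.1 ∪ Z.1)
      (hYo : OpenIn Y.1 W.1) (hYc : ClosedIn Y.1 W.1)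
      (hZo : OpenIn Z.1 W.1) (hZc : ClosedIn Z.1 W.1) (j : ZMod 2) :
      STRel (.add (.comp (tr hYc j) (ti hYo j)) (.comp (tr hZc j) (ti hZo j))) (.id _)
  | i_i (U V Y : LC X) (hUV : OpenIn U.1 V.1) (hVY : OpenIn V.1 Y.1) (hUY : OpenIn U.1 Y.1)
      (j : ZMod 2) : STRel (.comp (ti hUV j) (ti hVY j)) (ti hUY j)
  | r_r (Y D C : LC X) (hDY : ClosedIn D.1 Y.1) (hCD : ClosedIn C.1 D.1) (hCY : ClosedIn C.1 Y.1)
      (j : ZMod 2) : STRel (.comp (tr hDY j) (tr hCD j)) (tr hCY j)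
  | i_r (Y U C E : LC X) (hU : OpenIn U.1 Y.1) (hC : ClosedIn C.1 Y.1) (hE : E.1 = U.1 ∩ C.1)
      (hEU : ClosedIn E.1 U.1) (hEC : OpenIn E.1 C.1) (j : ZMod 2) :
      STRel (.comp (ti hU j) (tr hC j)) (.comp (tr hEU j) (ti hEC j))
  | i_δ (U C C' : LC X) (h : BoundaryPair U.1 C.1) (hC' : OpenIn C'.1 C.1)
      (h' : BoundaryPair U.1 C'.1) (j k : ZMod 2) (hk : k = j + 1) :
      STRel (.comp (ti hC' j) (tδ h j k hk)) (tδ h' j k hk)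
  | δ_r (U C U' : LC X) (h : BoundaryPair U.1 C.1) (hU' : ClosedIn U'.1 U.1)
      (h' : BoundaryPair U'.1 C.1) (j k : ZMod 2) (hk : k = j + 1) :
      STRel (.comp (tδ h j k hk) (tr hU' k)) (tδ h' j k hk)
  | δ_i (Y Z W A B : LC X)
      (hYW : IsLocallyClosed (Y.1 ∪ W.1)) (hY : ClosedIn Y.1 (Y.1 ∪ W.1))
      (hW : ClosedIn W.1 (Y.1 ∪ W.1))
      (hZW : IsLocallyClosed (Z.1 ∪ W.1)) (hZ : OpenIn Z.1 (Z.1 ∪ W.1))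
      (hW' : OpenIn W.1 (Z.1 ∪ W.1))
      (hsub : W.1 ⊆ Y.1 ∪ Z.1) (hA : A.1 = W.1 \ Y.1) (hB : B.1 = W.1 \ Z.1)
      (hAY : BoundaryPair A.1 Y.1) (hAZ : OpenIn A.1 Z.1)
      (hBY : ClosedIn B.1 Y.1) (hBZ : BoundaryPair Z.1 B.1) (j k : ZMod 2) (hk : k = j + 1) :
      STRel (.comp (tδ hAY j k hk) (ti hAZ k)) (.comp (tr hBY j) (tδ hBZ j k hk))

variable (X) in
/-- The universal pre-additive category on the six-term sequence generators and relations. -/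
abbrev ST := Presented (STRel (X := X))

/-- The object `(Y, j)` of `ST`. -/
abbrev stObj (Y : LC X) (j : ZMod 2) : ST X := ⟨⟨Y, j⟩⟩

/-- `i_U^Y` as a morphism of `ST`. -/
def stI {U Y : LC X} (h : OpenIn U.1 Y.1) (j : ZMod 2) : stObj U j ⟶ stObj Y j :=
  Presented.hom (ti h j)

/-- `r_Y^C` as a morphism of `ST`. -/
def stR {Y C : LC X} (h : ClosedIn C.1 Y.1) (j : ZMod 2) : stObj Y j ⟶ stObj C j :=
  Presented.hom (tr h j)

/-- `δ_C^U` as a morphism of `ST`. -/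
def stδ {C U : LC X} (h : BoundaryPair U.1 C.1) (j k : ZMod 2) (hk : k = j + 1) :
    stObj C j ⟶ stObj U k :=
  Presented.hom (tδ h j k hk)

theorem stI_comp {U V Y : LC X} (hUV : OpenIn U.1 V.1) (hVY : OpenIn V.1 Y.1)
    (hUY : OpenIn U.1 Y.1) (j : ZMod 2) : stI hUV j ≫ stI hVY j = stI hUY j :=
  Presented.hom_eq (.rel (.i_i U V Y hUV hVY hUY j))

/-- In `ST`, the identity of the empty set vanishes. -/
theorem id_empty (j : ZMod 2) (E : LC X) (hE : E.1 = ∅) : 𝟙 (stObj E j) = 0 := by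
  have ho : OpenIn E.1 E.1 := openIn_of_isOpen (hE ▸ isOpen_empty) subset_rfl
  have hc : ClosedIn E.1 E.1 := ⟨E.1, hE ▸ isClosed_empty, (Set.inter_self _).symm⟩
  have h₁ : stI ho j = 𝟙 (stObj E j) := Presented.hom_eq (.rel (.i_self E ho j))
  have h₂ : stR hc j = 𝟙 (stObj E j) := Presented.hom_eq (.rel (.r_self E hc j))
  have h₃ : stR hc j ≫ stI ho j + stR hc j ≫ stI ho j = 𝟙 (stObj E j) :=
    Presented.hom_eq (.rel (.biproduct E E E (by rw [hE]; simp) (by rw [hE]; simp) (by simp)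
      ho hc ho hc j))
  rw [h₁, h₂, Category.comp_id] at h₃
  simpa using h₃

/-- An `ST`-module is exact if all its cyclic six-term sequences are exact. -/
structure IsExactST (M : ST X ⥤ AddCommGrpCat.{w}) : Prop where
  exact_i_r : ∀ {U Y C : LC X} (h : Extension U Y C) (j : ZMod 2),
    Function.Exact (M.map (stI h.openIn j)) (M.map (stR h.closedIn j))
  exact_r_δ : ∀ {U Y C : LC X} (h : Extension U Y C) (j k : ZMod 2) (hk : k = j + 1),
    Function.Exact (M.map (stR h.closedIn j)) (M.map (stδ h.boundaryPair j k hk))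
  exact_δ_i : ∀ {U Y C : LC X} (h : Extension U Y C) (j k : ZMod 2) (hk : k = j + 1),
    Function.Exact (M.map (stδ h.boundaryPair j k hk)) (M.map (stI h.openIn k))

/-- An `ST`-module is real-rank-zero-like if all boundary maps from degree `0` to degree `1`
vanish. -/
def IsRealRankZeroLike (M : ST X ⥤ AddCommGrpCat.{w}) : Prop :=
  ∀ {U Y C : LC X} (h : Extension U Y C), M.map (stδ h.boundaryPair 0 1 rfl) = 0

end ST

/-! ### The category `R` -/

section R

variable (X : Type u) [TopologicalSpace X]

/-- Objects of `R`: three for each point `x`, which stand for `({x}, 1)`, for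
`(nhdsKer {x} \ {x}, 0)` and for `(nhdsKer {x}, 0)`. -/
inductive RObj : Type u
  | pt (x : X)
  | bd (x : X)
  | op (x : X)

variable {X}

/-- Generators of `R`. -/
inductive RGen : RObj X → RObj X → Type u
  | δ (x : X) : RGen (.pt x) (.bd x)
  | i (x : X) : RGen (.bd x) (.op x)
  | j (y x : X) (h : Arrow y x) : RGen (RObj.op y) (.bd x)

/-- The composite of the generators along a path from `y` to `x`. -/
def DPath.term : ∀ {y x : X}, DPath y x → Term RGen (RObj.op y) (RObj.op x)
  | _, _, .nil x => .id (RObj.op x)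
  | _, _, .cons (y := y) (z := z) h p => .comp (.of (.j y z h)) (.comp (.of (.i z)) p.term)

/-- The relations of `R`. In the second one, `p` followed by `z → x` and `q` followed by `z' → x`
are two arbitrary paths from `y` to `x` with `y > x`. -/
inductive RRel : ∀ ⦃a b : RObj X⦄, Term RGen a b → Term RGen a b → Prop
  | δ_i (x : X) : RRel (.comp (.of (.δ x)) (.of (.i x))) (.zero _ _)
  | path {y z z' x : X} (p : DPath y z) (h : Arrow z x) (q : DPath y z') (h' : Arrow z' x) :
      RRel (.comp p.term (.of (.j z x h))) (.comp q.term (.of (.j z' x h')))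

variable (X) in
/-- The category `R` that defines reduced filtered K-theory. -/
abbrev RCat := Presented (RRel (X := X))

theorem singleton_eq [T0Space X] (x : X) : ({x} : Set X) = closure {x} ∩ nhdsKer {x} := by
  ext y
  simp only [Set.mem_singleton_iff, Set.mem_inter_iff, mem_nhdsKer_singleton,
    ← specializes_iff_mem_closure]
  exact ⟨fun h => h ▸ ⟨specializes_rfl, specializes_rfl⟩, fun h => (h.2.antisymm h.1).eq⟩

theorem bd_eq [T0Space X] (x : X) :
    nhdsKer {x} \ {x} = (closure {x})ᶜ ∩ nhdsKer ({x} : Set X) := by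
  have h := singleton_eq x
  ext y
  have hy : y ∈ ({x} : Set X) ↔ y ∈ closure {x} ∩ nhdsKer {x} := by rw [← h]
  rw [Set.mem_sdiff, hy, Set.mem_inter_iff, Set.mem_inter_iff, Set.mem_compl_iff]
  tauto

theorem Arrow.subset [T0Space X] {y x : X} (h : Arrow y x) :
    nhdsKer {y} ⊆ nhdsKer {x} \ ({x} : Set X) := by
  have hyx : y ⤳ x := specializes_iff_mem_closure.2 (h.1 (subset_closure rfl))
  intro z hz
  have hzy : z ⤳ y := mem_nhdsKer_singleton.1 hz
  refine ⟨mem_nhdsKer_singleton.2 (hzy.trans hyx), ?_⟩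
  rintro rfl
  exact h.2.1 (hzy.antisymm hyx).eq

theorem DPath.subset [T0Space X] {y x : X} (p : DPath y x) :
    nhdsKer {y} ⊆ nhdsKer ({x} : Set X) := by
  induction p with
  | nil => exact subset_rfl
  | cons h _ ih => exact (h.subset.trans Set.sdiff_subset).trans ih

variable [Finite X] [T0Space X]

/-- The smallest open set that contains `x`. -/
def lcOpen (x : X) : LC X := ⟨nhdsKer {x}, isOpen_nhdsKer.isLocallyClosed⟩

/-- The singleton `{x}`. -/
def lcPt (x : X) : LC X :=
  ⟨{x}, by
    rw [singleton_eq]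
    exact isClosed_closure.isLocallyClosed.inter isOpen_nhdsKer.isLocallyClosed⟩

/-- The complement of `x` in the smallest open set that contains `x`. -/
def lcBd (x : X) : LC X :=
  ⟨nhdsKer {x} \ {x}, by
    rw [bd_eq]
    exact (isClosed_closure.isOpen_compl.inter isOpen_nhdsKer).isLocallyClosed⟩

theorem extension_pt (x : X) : Extension (lcBd x) (lcOpen x) (lcPt x) :=
  ⟨⟨(closure {x})ᶜ, isClosed_closure.isOpen_compl, bd_eq x⟩, by
    change ({x} : Set X) = nhdsKer {x} \ (nhdsKer {x} \ {x})
    rw [Set.sdiff_sdiff_cancel_left]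
    exact subset_nhdsKer⟩

theorem Arrow.openIn {y x : X} (h : Arrow y x) : OpenIn (lcOpen y).1 (lcBd x).1 :=
  openIn_of_isOpen isOpen_nhdsKer h.subset

theorem DPath.openIn {y x : X} (p : DPath y x) : OpenIn (lcOpen y).1 (lcOpen x).1 :=
  openIn_of_isOpen isOpen_nhdsKer p.subset

variable (X) in
/-- The object map `R → ST`. -/
abbrev rObj : RObj X → ST X
  | .pt x => stObj (lcPt x) 1
  | .bd x => stObj (lcBd x) 0
  | .op x => stObj (lcOpen x) 0

variable (X) in
/-- The images in `ST` of the generators of `R`. -/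
def rGen : ∀ ⦃a b : RObj X⦄, RGen a b → (rObj X a ⟶ rObj X b)
  | _, _, .δ x => stδ (extension_pt x).boundaryPair 1 0 rfl
  | _, _, .i x => stI (extension_pt x).openIn 0
  | _, _, .j _ _ h => stI h.openIn 0

theorem eval_term {y x : X} (p : DPath y x) : p.term.eval (rGen X) = stI p.openIn 0 := by
  induction p with
  | nil x =>
    exact (Presented.hom_eq (.rel (STRel.i_self (lcOpen x) (DPath.nil x).openIn 0))).symm
  | @cons y z x h p ih =>
    have e : (DPath.cons h p).term.eval (rGen X) =
        stI h.openIn 0 ≫ stI (extension_pt z).openIn 0 ≫ p.term.eval (rGen X) := rfl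
    have hb : OpenIn (lcBd z).1 (lcOpen x).1 := by
      refine openIn_of_isOpen ?_ (Set.sdiff_subset.trans p.subset)
      change IsOpen (nhdsKer {z} \ {z})
      rw [bd_eq]
      exact isClosed_closure.isOpen_compl.inter isOpen_nhdsKer
    rw [e, ih, stI_comp _ _ hb, stI_comp]

theorem rGen_δ_i (x : X) :
    stδ (extension_pt x).boundaryPair 1 0 rfl ≫ stI (extension_pt x).openIn 0 = 0 := by
  let E : LC X := ⟨∅, isOpen_empty.isLocallyClosed⟩
  have hY : (lcPt x).1 ∪ (lcOpen x).1 = (lcOpen x).1 :=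
    Set.union_eq_right.2 (subset_nhdsKer (s := {x}))
  have hZ : (lcOpen x).1 ∪ (lcOpen x).1 = (lcOpen x).1 := Set.union_self _
  have hB : BoundaryPair (lcOpen x).1 E.1 :=
    ⟨(lcOpen x).1, (lcOpen x).2, openIn_of_isOpen isOpen_nhdsKer subset_rfl, by simp [E]⟩
  have hE : ClosedIn E.1 (lcPt x).1 := ⟨∅, isClosed_empty, by simp [E]⟩
  have h : stδ (extension_pt x).boundaryPair 1 0 rfl ≫ stI (extension_pt x).openIn 0 =
      stR hE 1 ≫ stδ hB 1 0 rfl :=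
    Presented.hom_eq (.rel (.δ_i (lcPt x) (lcOpen x) (lcOpen x) (lcBd x) E
      (by rw [hY]; exact (lcOpen x).2) (by rw [hY]; exact (extension_pt x).closedIn)
      (by rw [hY]; exact ⟨Set.univ, isClosed_univ, by simp⟩)
      (by rw [hZ]; exact (lcOpen x).2)
      (by rw [hZ]; exact openIn_of_isOpen isOpen_nhdsKer subset_rfl)
      (by rw [hZ]; exact openIn_of_isOpen isOpen_nhdsKer subset_rfl)
      Set.subset_union_right rfl (by simp [E]) _ _ _ _ 1 0 rfl))
  rw [h, ← Category.id_comp (stδ hB 1 0 rfl), id_empty 1 E rfl]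
  simp

theorem rGen_rel ⦃a b : RObj X⦄ (f g : Term RGen a b) (h : RRel f g) :
    f.eval (rGen X) = g.eval (rGen X) := by
  cases h with
  | δ_i x => exact rGen_δ_i x
  | @path y z z' x p h q h' =>
    have hy : OpenIn (lcOpen y).1 (lcBd x).1 :=
      openIn_of_isOpen isOpen_nhdsKer (p.subset.trans h.subset)
    have e₁ : stI p.openIn 0 ≫ stI h.openIn 0 = stI hy 0 := stI_comp _ _ _ _
    have e₂ : stI q.openIn 0 ≫ stI h'.openIn 0 = stI hy 0 := stI_comp _ _ _ _
    calc _ = p.term.eval (rGen X) ≫ stI h.openIn 0 := rfl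
      _ = q.term.eval (rGen X) ≫ stI h'.openIn 0 := by rw [eval_term, eval_term, e₁, e₂]
      _ = _ := rfl

variable (X) in
/-- The canonical additive functor `R → ST`. -/
def rToST : RCat X ⥤ ST X := Presented.lift (rObj X) (rGen X) rGen_rel

instance : (rToST X).Additive := inferInstanceAs (Presented.lift _ _ _).Additive

variable (X) in
/-- The functor from `ST`-modules to `R`-modules induced by `R → ST`. -/
abbrev reduced : (ST X ⥤ AddCommGrpCat.{w}) ⥤ (RCat X ⥤ AddCommGrpCat.{w}) :=
  (Functor.whiskeringLeft _ _ _).obj (rToST X)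

/-- `M({x}, 1)` is a free abelian group for every point `x` that is not open. -/
def FreeAtNonOpenPoints (M : ST X ⥤ AddCommGrpCat.{w}) : Prop :=
  ∀ x : X, ¬ IsOpen ({x} : Set X) → Module.Free ℤ (M.obj (stObj (lcPt x) 1))

end R

end FilteredK

open FilteredK

open FilteredK

/-! Since δ from degree 0 to degree 1 vanishes, all maps `i` are injective in degree 1 and all maps
`r` are surjective in degree 0. With exactness this makes both degrees local over the points. In
degree 1, Mayer–Vietoris for closed covers makes M(Y, 1) behave like a sheaf: elements are
determined by their images in the groups of the closures of points, and compatible maps on these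
closures glue (`IsExactST.germ_ext`, `ClCompat.exists_germ`). Dually, M(Y, 0) behaves like a
cosheaf: it is generated by the groups of the smallest neighbourhoods of points, and compatible maps
on these glue (`IsExactST.hom_ext_cogerm`, `OpCompat.exists_cogerm`).

Hence φ already determines the degree 0 part of Φ. In degree 1 it only gives maps at the points,
which must be extended to their closures. This is done one point x at a time, specializations first.
The map on M(closure {x}, 1) has to extend φ at x, to induce the map already glued on closure {x} \
{x}, and to commute with δ into nhdsKer {x} \ {x}. Such a map exists because N(closure {x}, 1) maps
onto the pullback of the data to be matched (`IsExactST.exists_mR_mD`), and because closure {x} \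
{x} has no open points, so that its group in degree 1 is projective and M(closure {x}, 1) splits
(`IsExactST.exists_cl_lift`).

The EBP condition serves to check naturality of δ on few boundary pairs. Every pair reduces, by
discarding irrelevant points and splitting into connected pieces, to restrictions of pairs (nhdsKer
{x}, closure {y}) with x → y (`EBPSpace.exists_arrow`, `EBPSpace.natural_mD`). Uniqueness of paths
makes intervals chains, which provides the boundary pairs at x used in the lifting step.
Isomorphisms lift to isomorphisms by the five lemma.

The lift of a map from a projective group is a choice, and so Φ is not unique: on the Sierpiński
space there is a nonzero map between skyscraper modules in degree 1 that is zero at both points. -/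

namespace FilteredK

/-! ### Subgroups of free abelian groups -/

section Projective

/-- A `ℤ`-module that embeds into a projective `ℤ`-module is projective. -/
theorem projective_int_of_injective {A F : Type*} [AddCommGroup A] [AddCommGroup F]
    [Module.Projective ℤ F] (f : A →ₗ[ℤ] F) (hf : Function.Injective f) :
    Module.Projective ℤ A := by
  -- Quotients of divisible groups are divisible, hence injective. The free cover of `A` lies in a
  -- rational vector space; dividing that space by the image of `ker p` embeds `A`, through `j`, in
  -- a divisible group.
  let ι : (A →₀ ℤ) →ₗ[ℤ] (A →₀ ℚ) := Finsupp.mapRange.linearMap (Int.castAddHom ℚ).toIntLinearMap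
  have hι : Function.Injective ι := Finsupp.mapRange_injective _ rfl Int.cast_injective
  let p : (A →₀ ℤ) →ₗ[ℤ] A := Finsupp.linearCombination ℤ id
  have hp : Function.Surjective p := fun a => ⟨Finsupp.single a 1, by simp [p]⟩
  let K : Submodule ℤ (A →₀ ℚ) := (LinearMap.ker p).map ι
  let : DivisibleBy (A →₀ ℚ) ℤ := AddCommGroup.divisibleByIntOfSMulTopEqTop _ fun {n} hn => by
    refine eq_top_iff.2 fun x _ => ⟨(n : ℚ)⁻¹ • x, trivial, ?_⟩
    have hn' : (n : ℚ) ≠ 0 := by exact_mod_cast hn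
    ext a
    simp [hn']
  let : DivisibleBy ((A →₀ ℚ) ⧸ K) ℤ :=
    (Submodule.mkQ_surjective K).divisibleBy _ fun x n => map_zsmul K.mkQ n x
  let j : A →ₗ[ℤ] ((A →₀ ℚ) ⧸ K) :=
    (Submodule.mapQ (LinearMap.ker p) K ι (Submodule.le_comap_map _ _)).comp
      (p.quotKerEquivOfSurjective hp).symm.toLinearMap
  have hj : ∀ x, j (p x) = K.mkQ (ι x) := fun x => by
    have : (p.quotKerEquivOfSurjective hp).symm (p x) = Submodule.Quotient.mk x := by
      rw [LinearEquiv.symm_apply_eq]; rfl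
    simp [j, this]
  -- Extend `j` to `F` by injectivity and lift the result to the rational vector space by
  -- projectivity. At `p x` the lift differs from `ι x` by an element of `ι (ker p)`, so on `A` it
  -- takes values in the free group and splits `p`.
  obtain ⟨g, hg⟩ := (Module.Baer.of_divisible ((A →₀ ℚ) ⧸ K)).extension_property f hf j
  obtain ⟨g', hg'⟩ := Module.projective_lifting_property K.mkQ g (Submodule.mkQ_surjective K)
  have key : ∀ a x, p x = a → ∃ y, ι y = g' (f a) ∧ p y = a := by
    rintro _ x rfl
    have h : K.mkQ (g' (f (p x))) = K.mkQ (ι x) := by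
      rw [← hj, ← hg]; exact LinearMap.congr_fun hg' _
    obtain ⟨k, hk, e⟩ := (Submodule.Quotient.eq K).1 h
    exact ⟨k + x, by rw [map_add, e]; abel, by rw [map_add, LinearMap.mem_ker.1 hk, zero_add]⟩
  have key' : ∀ a, ∃ y, ι y = g' (f a) ∧ p y = a := fun a => key a _ (hp a).choose_spec
  choose s hs hs' using key'
  refine Module.projective_def.2 ⟨⟨⟨s, fun a b => hι ?_⟩, fun n a => hι ?_⟩, hs'⟩
  · rw [map_add, hs, hs, hs, map_add, map_add]
  · rw [map_smul, hs, hs, map_smul, map_smul]; rfl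

/-- In a left exact sequence `0 → A → B → C` of abelian groups, `B` is projective if `A` and `C`
are. -/
theorem projective_int_of_exact {A B C : Type*} [AddCommGroup A] [AddCommGroup B] [AddCommGroup C]
    [Module.Projective ℤ A] [Module.Projective ℤ C] (f : A →+ B) (g : B →+ C)
    (hf : Function.Injective f) (hfg : ∀ b, g b = 0 → ∃ a, f a = b) : Module.Projective ℤ B := by
  -- With a section `s` of `B → range g`, the map `b ↦ (b - s (g b), g b)` embeds `B` in the
  -- projective group `A × C`.
  let g' := g.toIntLinearMap
  have : Module.Projective ℤ (LinearMap.range g') :=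
    projective_int_of_injective (LinearMap.range g').subtype Subtype.val_injective
  obtain ⟨s, hs⟩ := Module.projective_lifting_property g'.rangeRestrict LinearMap.id
    g'.surjective_rangeRestrict
  have hs' : ∀ b, g (s (g'.rangeRestrict b)) = g b := fun b =>
    congrArg Subtype.val (LinearMap.congr_fun hs (g'.rangeRestrict b))
  have key : ∀ b, ∃ a, f a = b - s (g'.rangeRestrict b) := fun b =>
    hfg _ (by rw [map_sub, hs', sub_self])
  choose t ht using key
  let T : B →ₗ[ℤ] A × C := AddMonoidHom.toIntLinearMap
    { toFun := fun b => (t b, g b)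
      map_zero' := by
        refine Prod.ext (hf ?_) (map_zero g)
        simp [ht]
      map_add' := fun a b => by
        refine Prod.ext (hf ?_) (map_add g a b)
        simp only [Prod.mk_add_mk, map_add, ht]; abel }
  refine projective_int_of_injective T fun a b h => ?_
  have h₁ : t a = t b := congrArg Prod.fst h
  have h₂ : g a = g b := congrArg Prod.snd h
  have h₃ : g'.rangeRestrict a = g'.rangeRestrict b := Subtype.ext h₂
  have := ht a
  rw [h₁, ht b, h₃] at this
  exact (sub_left_inj.1 this).symm

end Projective

/-! ### Finite spaces in terms of specialization -/

section Order

variable {X : Type u} [TopologicalSpace X]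

theorem openIn_iff [AlexandrovDiscrete X] {U Y : Set X} :
    OpenIn U Y ↔ U ⊆ Y ∧ ∀ u ∈ U, ∀ y ∈ Y, y ⤳ u → y ∈ U := by
  constructor
  · rintro ⟨O, hO, rfl⟩
    exact ⟨Set.inter_subset_right, fun u hu y hy h => ⟨h.mem_open hO hu.1, hy⟩⟩
  · rintro ⟨hU, h⟩
    refine ⟨nhdsKer U, isOpen_nhdsKer, Set.Subset.antisymm
      (fun u hu => ⟨subset_nhdsKer hu, hU hu⟩) ?_⟩
    rintro y ⟨hy, hyY⟩
    obtain ⟨u, hu, hyu⟩ := mem_nhdsKer_iff_specializes.1 hy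
    exact h u hu y hyY hyu

theorem mem_closure_iff_specializes [AlexandrovDiscrete X] {Y : Set X} {x : X} :
    x ∈ closure Y ↔ ∃ y ∈ Y, y ⤳ x := by
  constructor
  · intro h
    obtain ⟨y, hy, hyY⟩ := mem_closure_iff.1 h (nhdsKer {x}) isOpen_nhdsKer (subset_nhdsKer rfl)
    exact ⟨y, hyY, mem_nhdsKer_singleton.1 hy⟩
  · rintro ⟨y, hy, h⟩
    exact closure_mono (Set.singleton_subset_iff.2 hy) (specializes_iff_mem_closure.1 h)

theorem closedIn_iff [AlexandrovDiscrete X] {C Y : Set X} :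
    ClosedIn C Y ↔ C ⊆ Y ∧ ∀ c ∈ C, ∀ y ∈ Y, c ⤳ y → y ∈ C := by
  constructor
  · rintro ⟨F, hF, rfl⟩
    exact ⟨Set.inter_subset_right, fun c hc y hy h => ⟨h.mem_closed hF hc.1, hy⟩⟩
  · rintro ⟨hC, h⟩
    refine ⟨closure C, isClosed_closure, Set.Subset.antisymm
      (fun u hu => ⟨subset_closure hu, hC hu⟩) ?_⟩
    rintro y ⟨hy, hyY⟩
    obtain ⟨u, hu, huy⟩ := mem_closure_iff_specializes.1 hy
    exact h u hu y hyY huy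

/-- The intersection of `nhdsKer Y` and `closure Y` is the convex hull of `Y` in the specialization
order. -/
theorem isLocallyClosed_iff [AlexandrovDiscrete X] {Y : Set X} :
    IsLocallyClosed Y ↔ ∀ a ∈ Y, ∀ c ∈ Y, ∀ b, c ⤳ b → b ⤳ a → b ∈ Y := by
  constructor
  · rintro ⟨O, F, hO, hF, rfl⟩ a ha c hc b hcb hba
    exact ⟨hba.mem_open hO ha.1, hcb.mem_closed hF hc.2⟩
  · intro h
    refine ⟨nhdsKer Y, closure Y, isOpen_nhdsKer, isClosed_closure, Set.Subset.antisymm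
      (fun y hy => ⟨subset_nhdsKer hy, subset_closure hy⟩) ?_⟩
    rintro b ⟨h₁, h₂⟩
    obtain ⟨a, ha, hba⟩ := mem_nhdsKer_iff_specializes.1 h₁
    obtain ⟨c, hc, hcb⟩ := mem_closure_iff_specializes.1 h₂
    exact h a ha c hc b hcb hba

theorem boundaryPair_iff [AlexandrovDiscrete X] {U C : Set X} :
    BoundaryPair U C ↔ Disjoint U C ∧ IsLocallyClosed (U ∪ C) ∧
      ∀ u ∈ U, ∀ c ∈ C, ¬ c ⤳ u := by
  constructor
  · rintro ⟨Y, hY, hU, rfl⟩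
    obtain ⟨hUY, h⟩ := openIn_iff.1 hU
    refine ⟨Set.disjoint_sdiff_right, by rwa [Set.union_sdiff_cancel hUY], ?_⟩
    exact fun u hu c hc hcu => hc.2 (h u hu c hc.1 hcu)
  · rintro ⟨hd, hY, h⟩
    refine ⟨U ∪ C, hY, openIn_iff.2 ⟨Set.subset_union_left, ?_⟩, ?_⟩
    · rintro u hu y (hy | hy) hyu
      · exact hy
      · exact (h u hu y hy hyu).elim
    · rw [Set.union_sdiff_left, hd.symm.sdiff_eq_left]

theorem arrow_iff {y x : X} :
    Arrow y x ↔ y ⤳ x ∧ x ≠ y ∧ ∀ z, z ⤳ x → y ⤳ z → z = x ∨ z = y := by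
  simp only [Arrow, ← specializes_iff_closure_subset]

/-- The locally closed intersection. -/
def LC.inter (Y Z : LC X) : LC X := ⟨Y.1 ∩ Z.1, Y.2.inter Z.2⟩

/-- The closure of a point. -/
def lcCl (x : X) : LC X := ⟨closure {x}, isClosed_closure.isLocallyClosed⟩

theorem mem_lcCl {x y : X} : y ∈ (lcCl x).1 ↔ x ⤳ y := specializes_iff_mem_closure.symm

theorem LC.convex [AlexandrovDiscrete X] (Y : LC X) {a b c : X} (ha : a ∈ Y.1) (hc : c ∈ Y.1)
    (hcb : c ⤳ b) (hba : b ⤳ a) : b ∈ Y.1 :=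
  isLocallyClosed_iff.1 Y.2 a ha c hc b hcb hba

/-- A relatively open subset of a locally closed set. -/
theorem OpenIn.isLocallyClosed {U Y : Set X} (h : OpenIn U Y) (hY : IsLocallyClosed Y) :
    IsLocallyClosed U := by
  obtain ⟨O, hO, rfl⟩ := h
  exact hO.isLocallyClosed.inter hY

theorem ClosedIn.isLocallyClosed {C Y : Set X} (h : ClosedIn C Y) (hY : IsLocallyClosed Y) :
    IsLocallyClosed C := by
  obtain ⟨O, hO, rfl⟩ := h
  exact hO.isLocallyClosed.inter hY

theorem ClosedIn.openIn_diff {C Y : Set X} (h : ClosedIn C Y) : OpenIn (Y \ C) Y := by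
  obtain ⟨O, hO, rfl⟩ := h
  exact ⟨Oᶜ, hO.isOpen_compl, by ext; simp; tauto⟩

/-- The complement of a relatively open subset. -/
def LC.diffOpen (Y : LC X) {U : Set X} (h : OpenIn U Y.1) : LC X :=
  ⟨Y.1 \ U, h.closedIn_diff.isLocallyClosed Y.2⟩

/-- The complement of a relatively closed subset. -/
def LC.diffClosed (Y : LC X) {C : Set X} (h : ClosedIn C Y.1) : LC X :=
  ⟨Y.1 \ C, h.openIn_diff.isLocallyClosed Y.2⟩

/-- The empty set. -/
def lcEmpty : LC X := ⟨∅, isOpen_empty.isLocallyClosed⟩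

theorem exists_maximal_point [Finite X] [T0Space X] {Y : Set X} (hY : Y.Nonempty) :
    ∃ x ∈ Y, ∀ y ∈ Y, y ⤳ x → y = x := by
  let := specializationOrder X
  obtain ⟨x, hx⟩ := Y.toFinite.exists_maximal hY
  exact ⟨x, hx.1, fun y hy h => hx.eq_of_ge hy h⟩

theorem exists_minimal_point [Finite X] [T0Space X] {Y : Set X} (hY : Y.Nonempty) :
    ∃ x ∈ Y, ∀ y ∈ Y, x ⤳ y → y = x := by
  let := specializationOrder X
  obtain ⟨x, hx⟩ := Y.toFinite.exists_minimal hY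
  exact ⟨x, hx.1, fun y hy h => hx.eq_of_le hy h⟩

/-! ### Paths -/

theorem Arrow.specializes {y x : X} (h : Arrow y x) : y ⤳ x := (arrow_iff.1 h).1

theorem DPath.specializes {y x : X} (p : DPath y x) : y ⤳ x := by
  induction p with
  | nil => exact specializes_rfl
  | cons h _ ih => exact h.specializes.trans ih

theorem exists_arrow_of_specializes [Finite X] [T0Space X] {y x : X} (h : y ⤳ x) (hne : y ≠ x) :
    ∃ z, Arrow y z ∧ z ⤳ x := by
  obtain ⟨z, ⟨hyz, hzy, hzx⟩, hz⟩ := exists_maximal_point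
    (Y := {z : X | y ⤳ z ∧ z ≠ y ∧ z ⤳ x}) ⟨x, h, hne.symm, specializes_rfl⟩
  refine ⟨z, arrow_iff.2 ⟨hyz, hzy, fun w hw₁ hw₂ => ?_⟩, hzx⟩
  by_cases e : w = y
  · exact .inr e
  · exact .inl (hz w ⟨hw₂, e, hw₁.trans hzx⟩ hw₁)

theorem exists_arrow_of_specializes' [Finite X] [T0Space X] {y x : X} (h : y ⤳ x) (hne : y ≠ x) :
    ∃ z, Arrow z x ∧ y ⤳ z := by
  obtain ⟨z, ⟨hyz, hzx, hzx'⟩, hz⟩ := exists_minimal_point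
    (Y := {z : X | y ⤳ z ∧ z ≠ x ∧ z ⤳ x}) ⟨y, specializes_rfl, hne, h⟩
  refine ⟨z, arrow_iff.2 ⟨hzx', hzx.symm, fun w hw₁ hw₂ => ?_⟩, hyz⟩
  by_cases e : w = x
  · exact .inl e
  · exact .inr (hz w ⟨hyz.trans hw₂, e, hw₁⟩ hw₂)

theorem exists_dPath [Finite X] [T0Space X] {y x : X} (h : y ⤳ x) : Nonempty (DPath y x) := by
  let := specializationOrder X
  induction y using WellFoundedLT.induction with
  | ind y ih =>
    by_cases e : y = x
    · exact e ▸ ⟨.nil _⟩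
    · obtain ⟨z, hyz, hzx⟩ := exists_arrow_of_specializes h e
      obtain ⟨p⟩ := ih z (lt_of_le_of_ne hyz.specializes (arrow_iff.1 hyz).2.1) hzx
      exact ⟨.cons hyz p⟩

/-- The points on a path. -/
def DPath.support : ∀ {y x : X}, DPath y x → Set X
  | _, _, .nil x => {x}
  | y, _, .cons _ p => insert y p.support

/-- Concatenation of paths. -/
def DPath.append : ∀ {y z x : X}, DPath y z → DPath z x → DPath y x
  | _, _, _, .nil _, q => q
  | _, _, _, .cons h p, q => .cons h (p.append q)

theorem DPath.start_mem_support {y x : X} (p : DPath y x) : y ∈ p.support := by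
  cases p with
  | nil => rfl
  | cons h p => exact Set.mem_insert _ _

theorem DPath.mem_support_append {y z x : X} (p : DPath y z) (q : DPath z x) :
    z ∈ (p.append q).support := by
  induction p with
  | nil => exact q.start_mem_support
  | cons h p ih => exact Set.mem_insert_of_mem _ (ih q)

theorem DPath.specializes_of_mem_support {y x w : X} (p : DPath y x) (h : w ∈ p.support) : y ⤳ w := by
  induction p with
  | nil => exact h ▸ specializes_rfl
  | cons h' p ih =>
    rcases h with rfl | h
    · exact specializes_rfl
    · exact h'.specializes.trans (ih h)

theorem DPath.comparable {y z x w : X} (p : DPath y z) (q : DPath z x)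
    (h : w ∈ (p.append q).support) : w ⤳ z ∨ z ⤳ w := by
  induction p with
  | nil => exact .inr (q.specializes_of_mem_support h)
  | cons h' p ih =>
    rcases h with rfl | h
    · exact .inl (h'.specializes.trans p.specializes)
    · exact ih q h

/-- In a unique path space, two points of an interval are comparable. -/
theorem UniquePathSpace.comparable [Finite X] [T0Space X] (hX : UniquePathSpace X) {y x z w : X}
    (hyz : y ⤳ z) (hzx : z ⤳ x) (hyw : y ⤳ w) (hwx : w ⤳ x) : w ⤳ z ∨ z ⤳ w := by
  obtain ⟨p₁⟩ := exists_dPath hyz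
  obtain ⟨p₂⟩ := exists_dPath hzx
  obtain ⟨q₁⟩ := exists_dPath hyw
  obtain ⟨q₂⟩ := exists_dPath hwx
  -- Both concatenations are the unique path from `y` to `x`, so `w` lies on the path through `z`,
  -- all of whose points are comparable to `z`.
  have := hX y x
  have h := q₁.mem_support_append q₂
  rw [Subsingleton.elim (q₁.append q₂) (p₁.append p₂)] at h
  exact p₁.comparable p₂ h

/-- Two different covers of a point have no common generization. -/
theorem UniquePathSpace.arrow_eq [Finite X] [T0Space X] (hX : UniquePathSpace X) {y x z w : X}
    (hz : Arrow z x) (hw : Arrow w x) (hyz : y ⤳ z) (hyw : y ⤳ w) : z = w := by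
  obtain ⟨hz₁, hz₂, hz₃⟩ := arrow_iff.1 hz
  obtain ⟨hw₁, hw₂, hw₃⟩ := arrow_iff.1 hw
  rcases hX.comparable hyz hz₁ hyw hw₁ with h | h
  · exact (hw₃ z hz₁ h).resolve_left (Ne.symm hz₂)
  · exact ((hz₃ w hw₁ h).resolve_left (Ne.symm hw₂)).symm

end Order

/-! ### Elementwise calculus in `ST`-modules -/

section Calculus

variable {X : Type u} [TopologicalSpace X] (M : ST X ⥤ AddCommGrpCat.{w})

/-- The group `M(Y, j)`. -/
abbrev K (Y : LC X) (j : ZMod 2) : Type w := M.obj (stObj Y j)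

/-- The action of `i_U^Y`. -/
def mI {U Y : LC X} (h : OpenIn U.1 Y.1) (j : ZMod 2) : K M U j →+ K M Y j := (M.map (stI h j)).hom

/-- The action of `r_Y^C`. -/
def mR {Y C : LC X} (h : ClosedIn C.1 Y.1) (j : ZMod 2) : K M Y j →+ K M C j :=
  (M.map (stR h j)).hom

/-- The action of `δ_C^U` from degree `1` to degree `0`. -/
def mD {C U : LC X} (h : BoundaryPair U.1 C.1) : K M C 1 →+ K M U 0 :=
  (M.map (stδ h 1 0 rfl)).hom

theorem map_congr_apply {a b : ST X} {f g : a ⟶ b} (h : f = g) (m : M.obj a) :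
    M.map f m = M.map g m := by rw [h]

theorem map_comp_apply {a b c : ST X} (f : a ⟶ b) (g : b ⟶ c) (m : M.obj a) :
    M.map (f ≫ g) m = M.map g (M.map f m) := by
  rw [Functor.map_comp]; rfl

theorem mI_self {Y : LC X} (h : OpenIn Y.1 Y.1) (j : ZMod 2) (m : K M Y j) : mI M h j m = m := by
  refine (map_congr_apply M (Presented.hom_eq (.rel (.i_self Y h j))) m).trans ?_
  exact congrArg (fun f => f.hom m) (M.map_id (stObj Y j))

theorem mR_self {Y : LC X} (h : ClosedIn Y.1 Y.1) (j : ZMod 2) (m : K M Y j) : mR M h j m = m := by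
  refine (map_congr_apply M (Presented.hom_eq (.rel (.r_self Y h j))) m).trans ?_
  exact congrArg (fun f => f.hom m) (M.map_id (stObj Y j))

theorem mI_mI {U V Y : LC X} (hUV : OpenIn U.1 V.1) (hVY : OpenIn V.1 Y.1) (hUY : OpenIn U.1 Y.1)
    (j : ZMod 2) (m : K M U j) : mI M hVY j (mI M hUV j m) = mI M hUY j m :=
  (map_comp_apply M (stI hUV j) (stI hVY j) m).symm.trans
    (map_congr_apply M (Presented.hom_eq (.rel (.i_i U V Y hUV hVY hUY j))) m)

theorem mR_mR {Y D C : LC X} (hDY : ClosedIn D.1 Y.1) (hCD : ClosedIn C.1 D.1)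
    (hCY : ClosedIn C.1 Y.1) (j : ZMod 2) (m : K M Y j) :
    mR M hCD j (mR M hDY j m) = mR M hCY j m :=
  (map_comp_apply M (stR hDY j) (stR hCD j) m).symm.trans
    (map_congr_apply M (Presented.hom_eq (.rel (.r_r Y D C hDY hCD hCY j))) m)

theorem mR_mI {Y U C E : LC X} (hU : OpenIn U.1 Y.1) (hC : ClosedIn C.1 Y.1)
    (hE : E.1 = U.1 ∩ C.1) (hEU : ClosedIn E.1 U.1) (hEC : OpenIn E.1 C.1) (j : ZMod 2)
    (m : K M U j) : mR M hC j (mI M hU j m) = mI M hEC j (mR M hEU j m) :=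
  (map_comp_apply M (stI hU j) (stR hC j) m).symm.trans
    ((map_congr_apply M (Presented.hom_eq (.rel (.i_r Y U C E hU hC hE hEU hEC j))) m).trans
      (map_comp_apply M (stR hEU j) (stI hEC j) m))

theorem mD_mI {U C C' : LC X} (h : BoundaryPair U.1 C.1) (hC' : OpenIn C'.1 C.1)
    (h' : BoundaryPair U.1 C'.1) (m : K M C' 1) : mD M h (mI M hC' 1 m) = mD M h' m :=
  (map_comp_apply M (stI hC' 1) (stδ h 1 0 rfl) m).symm.trans
    (map_congr_apply M (Presented.hom_eq (.rel (.i_δ U C C' h hC' h' 1 0 rfl))) m)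

theorem mR_mD {U C U' : LC X} (h : BoundaryPair U.1 C.1) (hU' : ClosedIn U'.1 U.1)
    (h' : BoundaryPair U'.1 C.1) (m : K M C 1) : mR M hU' 0 (mD M h m) = mD M h' m :=
  (map_comp_apply M (stδ h 1 0 rfl) (stR hU' 0) m).symm.trans
    (map_congr_apply M (Presented.hom_eq (.rel (.δ_r U C U' h hU' h' 1 0 rfl))) m)

theorem mI_mD {Y Z W A B : LC X}
    (hYW : IsLocallyClosed (Y.1 ∪ W.1)) (hY : ClosedIn Y.1 (Y.1 ∪ W.1))
    (hW : ClosedIn W.1 (Y.1 ∪ W.1))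
    (hZW : IsLocallyClosed (Z.1 ∪ W.1)) (hZ : OpenIn Z.1 (Z.1 ∪ W.1))
    (hW' : OpenIn W.1 (Z.1 ∪ W.1))
    (hsub : W.1 ⊆ Y.1 ∪ Z.1) (hA : A.1 = W.1 \ Y.1) (hB : B.1 = W.1 \ Z.1)
    (hAY : BoundaryPair A.1 Y.1) (hAZ : OpenIn A.1 Z.1)
    (hBY : ClosedIn B.1 Y.1) (hBZ : BoundaryPair Z.1 B.1) (m : K M Y 1) :
    mI M hAZ 0 (mD M hAY m) = mD M hBZ (mR M hBY 1 m) :=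
  (map_comp_apply M (stδ hAY 1 0 rfl) (stI hAZ 0) m).symm.trans
    ((map_congr_apply M (Presented.hom_eq (.rel (.δ_i Y Z W A B hYW hY hW hZW hZ hW' hsub hA hB
      hAY hAZ hBY hBZ 1 0 rfl))) m).trans
      (map_comp_apply M (stR hBY 1) (stδ hBZ 1 0 rfl) m))

/-! ### Exactness and vanishing of δ in terms of elements -/

section Exact

variable {M}
variable (hM : IsExactST M)
include hM

theorem IsExactST.mR_mI_eq_zero {U Y C : LC X} (hU : OpenIn U.1 Y.1) (hC : ClosedIn C.1 Y.1)
    (e : C.1 = Y.1 \ U.1) {j : ZMod 2} (u : K M U j) : mR M hC j (mI M hU j u) = 0 :=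
  (hM.exact_i_r ⟨hU, e⟩ j).apply_apply_eq_zero u

theorem IsExactST.exists_mI {U Y C : LC X} (hU : OpenIn U.1 Y.1) (hC : ClosedIn C.1 Y.1)
    (e : C.1 = Y.1 \ U.1) {j : ZMod 2} {m : K M Y j} (h : mR M hC j m = 0) :
    ∃ u, mI M hU j u = m :=
  (hM.exact_i_r ⟨hU, e⟩ j m).1 h

theorem IsExactST.exists_mR {U Y C : LC X} (hU : OpenIn U.1 Y.1) (hC : ClosedIn C.1 Y.1)
    (e : C.1 = Y.1 \ U.1) (hB : BoundaryPair U.1 C.1) {m : K M C 1} (h : mD M hB m = 0) :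
    ∃ y, mR M hC 1 y = m :=
  (hM.exact_r_δ ⟨hU, e⟩ 1 0 rfl m).1 h

theorem IsExactST.mD_mR_eq_zero {U Y C : LC X} (hU : OpenIn U.1 Y.1) (hC : ClosedIn C.1 Y.1)
    (e : C.1 = Y.1 \ U.1) (hB : BoundaryPair U.1 C.1) (m : K M Y 1) : mD M hB (mR M hC 1 m) = 0 :=
  (hM.exact_r_δ ⟨hU, e⟩ 1 0 rfl).apply_apply_eq_zero m

theorem IsExactST.exists_mD {U Y C : LC X} (hU : OpenIn U.1 Y.1)
    (e : C.1 = Y.1 \ U.1) (hB : BoundaryPair U.1 C.1) {m : K M U 0} (h : mI M hU 0 m = 0) :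
    ∃ c, mD M hB c = m :=
  (hM.exact_δ_i ⟨hU, e⟩ 1 0 rfl m).1 h

theorem IsExactST.mI_mD_eq_zero {U Y C : LC X} (hU : OpenIn U.1 Y.1)
    (e : C.1 = Y.1 \ U.1) (hB : BoundaryPair U.1 C.1) (c : K M C 1) : mI M hU 0 (mD M hB c) = 0 :=
  (hM.exact_δ_i ⟨hU, e⟩ 1 0 rfl).apply_apply_eq_zero c

variable (hM₀ : IsRealRankZeroLike M)
include hM₀

/-- The kernel is the image of a δ that starts in degree 0. -/
theorem IsExactST.mI_injective {U Y : LC X} (hU : OpenIn U.1 Y.1) :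
    Function.Injective (mI M hU 1) := by
  have hE : Extension U Y (Y.diffOpen hU) := ⟨hU, rfl⟩
  refine (injective_iff_map_eq_zero _).2 fun u hu => ?_
  obtain ⟨c, hc⟩ := (hM.exact_δ_i hE 0 1 rfl u).1 hu
  rw [← hc, hM₀ hE]; rfl

/-- The image is the kernel of a δ that starts in degree 0. -/
theorem IsExactST.mR_surjective {Y C : LC X} (hC : ClosedIn C.1 Y.1) :
    Function.Surjective (mR M hC 0) := by
  have hE : Extension (Y.diffClosed hC) Y C := ⟨hC.openIn_diff, by
    obtain ⟨F, hF, e⟩ := hC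
    exact (Set.sdiff_sdiff_cancel_left (e ▸ Set.inter_subset_right)).symm⟩
  intro c
  refine (hM.exact_r_δ hE 0 1 rfl c).1 ?_
  rw [hM₀ hE]; rfl

end Exact

section Additive

variable [M.Additive]

theorem eq_zero_of_empty {E : LC X} (hE : E.1 = ∅) {j : ZMod 2} (m : K M E j) : m = 0 := by
  have h : M.map (𝟙 (stObj E j)) m = M.map 0 m := map_congr_apply M (id_empty j E hE) m
  rw [M.map_id, M.map_zero] at h
  exact h

theorem mI_mR_add {Y Z W : LC X} (hYZ : Disjoint (closure Y.1) Z.1)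
    (hZY : Disjoint Y.1 (closure Z.1)) (hW : W.1 = Y.1 ∪ Z.1)
    (hYo : OpenIn Y.1 W.1) (hYc : ClosedIn Y.1 W.1)
    (hZo : OpenIn Z.1 W.1) (hZc : ClosedIn Z.1 W.1) (j : ZMod 2) (m : K M W j) :
    mI M hYo j (mR M hYc j m) + mI M hZo j (mR M hZc j m) = m := by
  have h : stR hYc j ≫ stI hYo j + stR hZc j ≫ stI hZo j = 𝟙 (stObj W j) :=
    Presented.hom_eq (.rel (.biproduct Y Z W hYZ hZY hW hYo hYc hZo hZc j))
  have h' := map_congr_apply M h m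
  rw [M.map_add, M.map_id, M.map_comp, M.map_comp] at h'
  exact h'

end Additive

section Finite

variable [AlexandrovDiscrete X]

/-- Relation 8 with `Y = C`, `Z = U` and `W = U' ∪ C`. The condition on specializations says that
`W` is open in `U ∪ C`, so δ only sees the points of `U` that specialize into `C`. -/
theorem mI_mD_of_open {U U' C : LC X} (hB : BoundaryPair U.1 C.1) (hB' : BoundaryPair U'.1 C.1)
    (hU : OpenIn U'.1 U.1) (h : ∀ u ∈ U.1, ∀ c ∈ C.1, u ⤳ c → u ∈ U'.1) (m : K M C 1) :
    mI M hU 0 (mD M hB' m) = mD M hB m := by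
  obtain ⟨hd, hl, hn⟩ := boundaryPair_iff.1 hB
  obtain ⟨hd', hl', hn'⟩ := boundaryPair_iff.1 hB'
  obtain ⟨hUU, ho⟩ := openIn_iff.1 hU
  have hc : ClosedIn C.1 C.1 := ⟨Set.univ, isClosed_univ, by simp⟩
  rw [← mR_self M hc 1 m, mR_self M hc 1 m]
  rw [Set.disjoint_left] at hd
  have e₁ : C.1 ∪ (U'.1 ∪ C.1) = U'.1 ∪ C.1 := by grind
  have e₂ : U.1 ∪ (U'.1 ∪ C.1) = U.1 ∪ C.1 := by grind
  refine (mI_mD M (Y := C) (Z := U) (W := ⟨U'.1 ∪ C.1, hl'⟩) (A := U') (B := C)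
    (by rwa [e₁]) ?_ ?_ (by rwa [e₂]) ?_ ?_ ?_ ?_ ?_ hB' hU hc hB m).trans ?_
  · rw [e₁, closedIn_iff]; grind
  · rw [e₁, closedIn_iff]; grind
  · rw [e₂, openIn_iff]; grind
  · rw [e₂, openIn_iff]; grind
  · change U'.1 ∪ C.1 ⊆ _; grind
  · change _ = (U'.1 ∪ C.1) \ _; ext; grind
  · change _ = (U'.1 ∪ C.1) \ _; ext; grind
  · rw [mR_self]

/-- Relation 8 with `Y = C`, `Z = U` and `W = U ∪ C'`, which is closed in `U ∪ C`: δ only sees the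
points of `C` in the closure of `U`. -/
theorem mD_mR_of_closed {U C C' : LC X} (hB : BoundaryPair U.1 C.1) (hB' : BoundaryPair U.1 C'.1)
    (hC : ClosedIn C'.1 C.1) (h : ∀ u ∈ U.1, ∀ c ∈ C.1, u ⤳ c → c ∈ C'.1) (m : K M C 1) :
    mD M hB' (mR M hC 1 m) = mD M hB m := by
  obtain ⟨hd, hl, hn⟩ := boundaryPair_iff.1 hB
  obtain ⟨hd', hl', hn'⟩ := boundaryPair_iff.1 hB'
  obtain ⟨hUU, ho⟩ := closedIn_iff.1 hC
  have hc : OpenIn U.1 U.1 := ⟨Set.univ, isOpen_univ, by simp⟩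
  rw [Set.disjoint_left] at hd
  have e₁ : C.1 ∪ (U.1 ∪ C'.1) = U.1 ∪ C.1 := by grind
  have e₂ : U.1 ∪ (U.1 ∪ C'.1) = U.1 ∪ C'.1 := by grind
  refine (mI_mD M (Y := C) (Z := U) (W := ⟨U.1 ∪ C'.1, hl'⟩) (A := U) (B := C')
    (by rwa [e₁]) ?_ ?_ (by rwa [e₂]) ?_ ?_ ?_ ?_ ?_ hB hc hC hB' m).symm.trans ?_
  · rw [e₁, closedIn_iff]; grind
  · rw [e₁, closedIn_iff]; grind
  · rw [e₂, openIn_iff]; grind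
  · rw [e₂, openIn_iff]; grind
  · change U.1 ∪ C'.1 ⊆ _; grind
  · change _ = (U.1 ∪ C'.1) \ _; ext; grind
  · change _ = (U.1 ∪ C'.1) \ _; ext; grind
  · rw [mI_self]

end Finite

end Calculus

/-! ### Degree one: gluing over closures of points -/

theorem LC.induction {X : Type u} [TopologicalSpace X] [Finite X] {P : LC X → Prop}
    (h : ∀ Y, (∀ Z : LC X, Z.1 ⊂ Y.1 → P Z) → P Y) (Y : LC X) : P Y :=
  (InvImage.wf (fun Y : LC X => Y.1) (wellFounded_lt (α := Set X))).induction Y fun Y ih => h Y ih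

section Finite

variable {X : Type u} [TopologicalSpace X] [Finite X]

omit [Finite X] in
theorem closedIn_inter_cl (Y : LC X) (x : X) : ClosedIn (Y.inter (lcCl x)).1 Y.1 :=
  ⟨closure {x}, isClosed_closure, Set.inter_comm _ _⟩

theorem openIn_inter_cl {Y : LC X} {x : X} (hx : x ∈ Y.1) :
    OpenIn (Y.inter (lcCl x)).1 (lcCl x).1 :=
  openIn_iff.2 ⟨Set.inter_subset_right, fun _ hu _ hy h =>
    ⟨Y.convex hu.1 hx (mem_lcCl.1 hy) h, hy⟩⟩

omit [Finite X] in
theorem closedIn_cl {x y : X} (h : x ⤳ y) : ClosedIn (lcCl y).1 (lcCl x).1 :=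
  ⟨closure {y}, isClosed_closure, (Set.inter_eq_left.2 h.closure_subset).symm⟩

section Germ

variable (M : ST X ⥤ AddCommGrpCat.{w})

/-- The map `M(Y, 1) → M(closure {x}, 1)` for `x ∈ Y`. -/
def germ {Y : LC X} {x : X} (hx : x ∈ Y.1) : K M Y 1 →+ K M (lcCl x) 1 :=
  (mI M (openIn_inter_cl hx) 1).comp (mR M (closedIn_inter_cl Y x) 1)

theorem germ_eq {Y E : LC X} {x : X} (hx : x ∈ Y.1) (e : E.1 = Y.1 ∩ (lcCl x).1)
    (hE : ClosedIn E.1 Y.1) (hE' : OpenIn E.1 (lcCl x).1) (m : K M Y 1) :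
    germ M hx m = mI M hE' 1 (mR M hE 1 m) := by
  obtain rfl : E = Y.inter (lcCl x) := Subtype.ext e
  rfl

theorem germ_mR {Y C : LC X} (hC : ClosedIn C.1 Y.1) {x : X} (hx : x ∈ C.1) (hx' : x ∈ Y.1)
    (m : K M Y 1) : germ M hx (mR M hC 1 m) = germ M hx' m := by
  obtain ⟨hCY, hc⟩ := closedIn_iff.1 hC
  have e : (C.inter (lcCl x)).1 = Y.1 ∩ (lcCl x).1 := Set.Subset.antisymm
    (fun z hz => ⟨hCY hz.1, hz.2⟩) (fun z hz => ⟨hc x hx z hz.1 (mem_lcCl.1 hz.2), hz.2⟩)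
  have h : ClosedIn (C.inter (lcCl x)).1 Y.1 :=
    e ▸ ⟨(lcCl x).1, isClosed_closure, Set.inter_comm _ _⟩
  rw [germ_eq M hx' e h (openIn_inter_cl hx), ← mR_mR M hC (closedIn_inter_cl C x)]
  rfl

theorem germ_mI {Y U : LC X} (hU : OpenIn U.1 Y.1) {x : X} (hx : x ∈ U.1) (hx' : x ∈ Y.1)
    (m : K M U 1) : germ M hx' (mI M hU 1 m) = germ M hx m := by
  obtain ⟨hUY, hu⟩ := openIn_iff.1 hU
  have h : OpenIn (U.inter (lcCl x)).1 (Y.inter (lcCl x)).1 := by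
    refine openIn_iff.2 ⟨fun z hz => ⟨hUY hz.1, hz.2⟩, fun z hz y hy hyz => ?_⟩
    exact ⟨hu z hz.1 y hy.1 hyz, hy.2⟩
  have e : (U.inter (lcCl x)).1 = U.1 ∩ (Y.inter (lcCl x)).1 := Set.Subset.antisymm
    (fun z hz => ⟨hz.1, hUY hz.1, hz.2⟩) (fun z hz => ⟨hz.1, hz.2.2⟩)
  change mI M _ 1 (mR M _ 1 (mI M hU 1 m)) = _
  rw [mR_mI M hU _ e (closedIn_inter_cl U x) h, mI_mI M _ _ (openIn_inter_cl hx)]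
  rfl

theorem mR_germ {Y : LC X} {x y : X} (hx : x ∈ Y.1) (hy : y ∈ Y.1) (h : x ⤳ y) (m : K M Y 1) :
    mR M (closedIn_cl h) 1 (germ M hx m) = germ M hy m := by
  have e : (Y.inter (lcCl y)).1 = (Y.inter (lcCl x)).1 ∩ (lcCl y).1 := Set.Subset.antisymm
    (fun z hz => ⟨⟨hz.1, h.closure_subset hz.2⟩, hz.2⟩) (fun z hz => ⟨hz.1.1, hz.2⟩)
  have h' : ClosedIn (Y.inter (lcCl y)).1 (Y.inter (lcCl x)).1 :=
    e ▸ ⟨(lcCl y).1, isClosed_closure, Set.inter_comm _ _⟩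
  change mR M _ 1 (mI M _ 1 (mR M _ 1 m)) = _
  rw [mR_mI M _ _ e h' (openIn_inter_cl hy), mR_mR M _ _ (closedIn_inter_cl Y y)]
  rfl

theorem germ_cl {x y : X} (h : x ⤳ y) (hy : y ∈ (lcCl x).1) (m : K M (lcCl x) 1) :
    germ M hy m = mR M (closedIn_cl h) 1 m := by
  have ho : OpenIn (lcCl y).1 (lcCl y).1 := ⟨Set.univ, isOpen_univ, by simp⟩
  rw [germ_eq M hy (Set.inter_eq_right.2 h.closure_subset).symm (closedIn_cl h) ho, mI_self]

/-- By convexity, `Y ∩ closure {x}` does not meet `closure {y}`, so the composite factors through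
the empty set. -/
theorem mR_germ_eq_zero [M.Additive] {Y : LC X} {x y : X} (hx : x ∈ Y.1) (hy : y ∉ Y.1)
    (h : x ⤳ y) (m : K M Y 1) : mR M (closedIn_cl h) 1 (germ M hx m) = 0 := by
  have e : (lcEmpty : LC X).1 = (Y.inter (lcCl x)).1 ∩ (lcCl y).1 := by
    refine (Set.eq_empty_iff_forall_notMem.2 fun z hz => hy ?_).symm
    exact Y.convex hz.1.1 hx h (mem_lcCl.1 hz.2)
  change mR M _ 1 (mI M _ 1 (mR M _ 1 m)) = _
  rw [mR_mI M _ _ e ⟨∅, isClosed_empty, by simp [lcEmpty]⟩ ⟨∅, isOpen_empty, by simp [lcEmpty]⟩]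
  exact (congrArg _ (eq_zero_of_empty M rfl _)).trans (map_zero _)

theorem germ_mI_eq_zero [M.Additive] {Y U : LC X} (hU : OpenIn U.1 Y.1) {x : X} (hx : x ∉ U.1)
    (hx' : x ∈ Y.1) (m : K M U 1) : germ M hx' (mI M hU 1 m) = 0 := by
  obtain ⟨hUY, hu⟩ := openIn_iff.1 hU
  have e : (lcEmpty : LC X).1 = U.1 ∩ (Y.inter (lcCl x)).1 := by
    refine (Set.eq_empty_iff_forall_notMem.2 fun z hz => hx ?_).symm
    exact hu z hz.1 x hx' (mem_lcCl.1 hz.2.2)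
  change mI M _ 1 (mR M _ 1 (mI M hU 1 m)) = _
  rw [mR_mI M _ _ e ⟨∅, isClosed_empty, by simp [lcEmpty]⟩ ⟨∅, isOpen_empty, by simp [lcEmpty]⟩]
  refine (congrArg _ (congrArg _ (eq_zero_of_empty M rfl _))).trans ?_
  rw [map_zero, map_zero]

end Germ

/-- The Mayer–Vietoris property in degree one. -/
theorem IsExactST.exists_glue {N : ST X ⥤ AddCommGrpCat.{w}} (hN : IsExactST N)
    {Y A B C : LC X} (hA : ClosedIn A.1 Y.1) (hB : ClosedIn B.1 Y.1)
    (hCA : ClosedIn C.1 A.1) (hCB : ClosedIn C.1 B.1) (hAB : A.1 ∪ B.1 = Y.1)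
    (hC : C.1 = A.1 ∩ B.1) (a : K N A 1) (b : K N B 1)
    (h : mR N hCA 1 a = mR N hCB 1 b) : ∃ y, mR N hA 1 y = a ∧ mR N hB 1 y = b := by
  obtain ⟨hAY, hA'⟩ := closedIn_iff.1 hA
  obtain ⟨hBY, hB'⟩ := closedIn_iff.1 hB
  let U : LC X := Y.diffClosed hB
  have hUe : U.1 = Y.1 \ B.1 := rfl
  have hUY : OpenIn U.1 Y.1 := hB.openIn_diff
  have hUA : OpenIn U.1 A.1 := by
    rw [openIn_iff] at hUY ⊢; grind
  have eB : B.1 = Y.1 \ U.1 := by grind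
  have eC : C.1 = A.1 \ U.1 := by grind
  have pB : BoundaryPair U.1 B.1 := ⟨Y.1, Y.2, hUY, eB⟩
  have pC : BoundaryPair U.1 C.1 := ⟨A.1, A.2, hUA, eC⟩
  -- Points of `B` in the closure of `U` lie in `C`, so δ of `b` only depends on the restriction of
  -- `b` to `C`. This restriction extends to `A` by `a`, hence has zero boundary.
  have hb : mD N pB b = 0 := by
    rw [← mD_mR_of_closed N pB pC hCB (by grind), ← h]
    exact hN.mD_mR_eq_zero hUA hCA eC pC a
  obtain ⟨y, hy⟩ := hN.exists_mR hUY hB eB pB hb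
  -- The error on `A` vanishes on `C`, so it comes from `U = Y \ B`; adding it does not affect the
  -- restriction to `B`.
  obtain ⟨u, hu⟩ := hN.exists_mI hUA hCA eC (m := a - mR N hA 1 y) (by
    have hCY : ClosedIn C.1 Y.1 := by rw [closedIn_iff] at hCA ⊢; grind
    rw [map_sub, h, ← hy, mR_mR N hA hCA hCY, mR_mR N hB hCB hCY, sub_self])
  refine ⟨y + mI N hUY 1 u, ?_, ?_⟩
  · have hc : ClosedIn U.1 U.1 := ⟨Set.univ, isClosed_univ, by simp⟩
    rw [map_add, mR_mI N hUY hA (E := U) (by grind) hc hUA, mR_self, hu, add_sub_cancel]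
  · rw [map_add, hy, hN.mR_mI_eq_zero hUY hB eB, add_zero]

variable [T0Space X]

theorem openIn_pt_of_maximal {Y : LC X} {x : X} (hx : x ∈ Y.1)
    (h : ∀ y ∈ Y.1, y ⤳ x → y = x) : OpenIn (lcPt x).1 Y.1 := by
  refine openIn_iff.2 ⟨Set.singleton_subset_iff.2 hx, ?_⟩
  rintro _ rfl y hy hyx
  exact h y hy hyx

theorem openIn_pt_cl (x : X) : OpenIn (lcPt x).1 (lcCl x).1 :=
  openIn_pt_of_maximal (mem_lcCl.2 specializes_rfl)
    fun _ hy h => (h.antisymm (mem_lcCl.1 hy)).eq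

/-- Remove a maximal point `x`. By induction `m` vanishes on the rest, so it comes from `{x}`, and
the germ at `x` detects it because `i` from `{x}` to `closure {x}` is injective in degree 1. -/
theorem IsExactST.eq_zero_of_germ {M : ST X ⥤ AddCommGrpCat.{w}} [M.Additive] (hM : IsExactST M)
    (hM₀ : IsRealRankZeroLike M) {Y : LC X} {m : K M Y 1}
    (h : ∀ x (hx : x ∈ Y.1), germ M hx m = 0) : m = 0 := by
  induction Y using LC.induction with
  | h Y ih =>
    rcases Y.1.eq_empty_or_nonempty with hY | hY
    · exact eq_zero_of_empty M hY m
    obtain ⟨x, hx, hmax⟩ := exists_maximal_point hY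
    have hU : OpenIn (lcPt x).1 Y.1 := openIn_pt_of_maximal hx hmax
    have hC : ClosedIn (Y.diffOpen hU).1 Y.1 := hU.closedIn_diff
    have h₁ : mR M hC 1 m = 0 := by
      refine ih _ ?_ fun y hy => ?_
      · exact ⟨Set.sdiff_subset, fun hs => (hs hx).2 rfl⟩
      · rw [germ_mR M hC hy hy.1, h]
    obtain ⟨u, rfl⟩ := hM.exists_mI hU hC rfl h₁
    have h₂ := h x hx
    rw [germ_mI M hU (x := x) rfl hx] at h₂
    have hc : ClosedIn (lcPt x).1 (lcPt x).1 := ⟨Set.univ, isClosed_univ, by simp⟩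
    rw [germ_eq M (Y := lcPt x) (E := lcPt x) rfl
      (Set.inter_eq_left.2 (openIn_iff.1 (openIn_pt_cl x)).1).symm hc (openIn_pt_cl x),
      mR_self] at h₂
    rw [(injective_iff_map_eq_zero _).1 (hM.mI_injective hM₀ (openIn_pt_cl x)) u h₂, map_zero]

theorem IsExactST.germ_ext {M : ST X ⥤ AddCommGrpCat.{w}} [M.Additive] (hM : IsExactST M)
    (hM₀ : IsRealRankZeroLike M) {Y : LC X} {m m' : K M Y 1}
    (h : ∀ x (hx : x ∈ Y.1), germ M hx m = germ M hx m') : m = m' :=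
  sub_eq_zero.1 (hM.eq_zero_of_germ hM₀ fun x hx => by rw [map_sub, h, sub_self])

variable (M N : ST X ⥤ AddCommGrpCat.{w})

/-- Compatibility of a family of homomorphisms `M(closure {x}, 1) → N(closure {x}, 1)`
with the restriction maps, for the points `x` of `S`. -/
def ClCompat (φ : ∀ x : X, K M (lcCl x) 1 →+ K N (lcCl x) 1) (S : Set X) : Prop :=
  ∀ x ∈ S, ∀ y (h : x ⤳ y) (m : K M (lcCl x) 1),
    mR N (closedIn_cl h) 1 (φ x m) = φ y (mR M (closedIn_cl h) 1 m)

variable {M N}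

omit [Finite X] [T0Space X] in
theorem ClCompat.mono {φ : ∀ x : X, K M (lcCl x) 1 →+ K N (lcCl x) 1} {S T : Set X}
    (h : ClCompat M N φ S) (hT : T ⊆ S) : ClCompat M N φ T :=
  fun x hx => h x (hT hx)

variable [M.Additive] [N.Additive]

/-- For a maximal point `x`, the sets `Y ∩ closure {x}` and `Y \ {x}` form a closed cover. The first
piece is governed by `φ x`, the second by induction, and agreement on the overlap can be tested on
germs. -/
theorem ClCompat.exists_germ (hN : IsExactST N) (hN₀ : IsRealRankZeroLike N)
    {φ : ∀ x : X, K M (lcCl x) 1 →+ K N (lcCl x) 1} {Y : LC X} (hφ : ClCompat M N φ Y.1)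
    (m : K M Y 1) : ∃ n : K N Y 1, ∀ x (hx : x ∈ Y.1), germ N hx n = φ x (germ M hx m) := by
  induction Y using LC.induction with
  | h Y ih =>
    rcases Y.1.eq_empty_or_nonempty with hY | hY
    · exact ⟨0, fun x hx => (hY.subset hx).elim⟩
    obtain ⟨x, hx, hmax⟩ := exists_maximal_point hY
    have hU : OpenIn (lcPt x).1 Y.1 := openIn_pt_of_maximal hx hmax
    have hB : ClosedIn (Y.diffOpen hU).1 Y.1 := hU.closedIn_diff
    have hA := closedIn_inter_cl Y x
    have hA' := openIn_inter_cl hx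
    obtain ⟨b, hb⟩ := ih (Y.diffOpen hU) ⟨Set.sdiff_subset, fun hs => (hs hx).2 rfl⟩
      (hφ.mono Set.sdiff_subset) (mR M hB 1 m)
    have hC : ClosedIn ((lcCl x).diffOpen hA').1 (lcCl x).1 := hA'.closedIn_diff
    -- The germ of `m` at `x` restricts to zero at points outside `Y`, hence so does its image under
    -- `φ x`, which therefore comes from the open subset `Y ∩ closure {x}`.
    obtain ⟨a, ha⟩ := hN.exists_mI hA' hC (C := (lcCl x).diffOpen hA') rfl
      (m := φ x (germ M hx m)) (by
        refine hN.eq_zero_of_germ hN₀ fun y hy => ?_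
        have hxy : x ⤳ y := mem_lcCl.1 hy.1
        have hyY : y ∉ Y.1 := fun h => hy.2 ⟨h, hy.1⟩
        rw [germ_mR N hC hy hy.1, germ_cl N hxy, hφ x hx y hxy, mR_germ_eq_zero M hx hyY hxy,
          map_zero])
    have ha' : ∀ y (hy : y ∈ (Y.inter (lcCl x)).1),
        germ N hy a = φ y (germ M (Y := Y) hy.1 m) := fun y hy => by
      have hxy : x ⤳ y := mem_lcCl.1 hy.2
      rw [← germ_mI N hA' hy hy.2, ha, germ_cl N hxy, hφ x hx y hxy, mR_germ M hx hy.1 hxy]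
    have hb' : ∀ y (hy : y ∈ (Y.diffOpen hU).1), germ N hy b = φ y (germ M (Y := Y) hy.1 m) :=
      fun y hy => by rw [hb, germ_mR M hB hy hy.1]
    have hCA : ClosedIn ((Y.inter (lcCl x)).inter (Y.diffOpen hU)).1 (Y.inter (lcCl x)).1 := by
      obtain ⟨F, hF, e⟩ := hB
      refine ⟨F, hF, ?_⟩
      change _ ∩ (Y.diffOpen hU).1 = _
      rw [e]
      ext; simp [LC.inter]; tauto
    have hCB : ClosedIn ((Y.inter (lcCl x)).inter (Y.diffOpen hU)).1 (Y.diffOpen hU).1 :=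
      ⟨closure {x}, isClosed_closure, by
        ext; simp [LC.inter, LC.diffOpen, lcCl]; tauto⟩
    obtain ⟨n, hn₁, hn₂⟩ := hN.exists_glue hA hB hCA hCB (by
        ext z
        by_cases e : z = x
        · subst e; simp [LC.inter, LC.diffOpen, lcCl, hx, subset_closure (Set.mem_singleton z)]
        · simp [LC.inter, LC.diffOpen, lcPt, e]; tauto) rfl a b (by
      refine hN.germ_ext hN₀ fun y hy => ?_
      rw [germ_mR N hCA hy hy.1, germ_mR N hCB hy hy.2, ha', hb'])
    refine ⟨n, fun y hy => ?_⟩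
    by_cases e : y = x
    · subst e
      have hy' : y ∈ (Y.inter (lcCl y)).1 := ⟨hy, mem_lcCl.2 specializes_rfl⟩
      rw [← germ_mR N hA hy', hn₁, ha']
    · have hy' : y ∈ (Y.diffOpen hU).1 := ⟨hy, e⟩
      rw [← germ_mR N hB hy', hn₂, hb']

open Classical in
/-- The homomorphism `M(Y, 1) → N(Y, 1)` that is determined by homomorphisms for the closures of
points. -/
noncomputable def glueHom (hN : IsExactST N) (hN₀ : IsRealRankZeroLike N)
    (φ : ∀ x : X, K M (lcCl x) 1 →+ K N (lcCl x) 1) (Y : LC X) : K M Y 1 →+ K N Y 1 :=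
  if hφ : ClCompat M N φ Y.1 then
    AddMonoidHom.mk' (fun m => (hφ.exists_germ hN hN₀ m).choose) fun a b =>
      hN.germ_ext hN₀ fun x hx => by
        rw [map_add, (hφ.exists_germ hN hN₀ _).choose_spec, (hφ.exists_germ hN hN₀ _).choose_spec,
          (hφ.exists_germ hN hN₀ _).choose_spec, map_add, map_add]
  -- While the family `φ` is being constructed, it is compatible on a closed set only; the default
  -- still gives a map for every `Y`.
  else 0

section glueHom

variable {hN : IsExactST N} {hN₀ : IsRealRankZeroLike N}
  {φ : ∀ x : X, K M (lcCl x) 1 →+ K N (lcCl x) 1}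

theorem ClCompat.germ_glueHom {Y : LC X} (hφ : ClCompat M N φ Y.1) {x : X} (hx : x ∈ Y.1)
    (m : K M Y 1) : germ N hx (glueHom hN hN₀ φ Y m) = φ x (germ M hx m) := by
  unfold glueHom
  rw [dif_pos hφ]
  exact (hφ.exists_germ hN hN₀ m).choose_spec x hx

theorem ClCompat.glueHom_mR {Y C : LC X} (hφ : ClCompat M N φ Y.1) (hC : ClosedIn C.1 Y.1)
    (m : K M Y 1) : glueHom hN hN₀ φ C (mR M hC 1 m) = mR N hC 1 (glueHom hN hN₀ φ Y m) := by
  have hCY := (closedIn_iff.1 hC).1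
  refine hN.germ_ext hN₀ fun x hx => ?_
  rw [(hφ.mono hCY).germ_glueHom, germ_mR M hC hx (hCY hx), germ_mR N hC hx (hCY hx),
    hφ.germ_glueHom]

theorem ClCompat.glueHom_mI {Y U : LC X} (hφ : ClCompat M N φ Y.1) (hU : OpenIn U.1 Y.1)
    (m : K M U 1) : glueHom hN hN₀ φ Y (mI M hU 1 m) = mI N hU 1 (glueHom hN hN₀ φ U m) := by
  have hUY := (openIn_iff.1 hU).1
  refine hN.germ_ext hN₀ fun x hx => ?_
  rw [hφ.germ_glueHom]
  by_cases hxU : x ∈ U.1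
  · rw [germ_mI M hU hxU, germ_mI N hU hxU, (hφ.mono hUY).germ_glueHom]
  · rw [germ_mI_eq_zero M hU hxU, germ_mI_eq_zero N hU hxU, map_zero]

theorem ClCompat.glueHom_cl {x : X} (hφ : ClCompat M N φ (lcCl x).1) :
    glueHom hN hN₀ φ (lcCl x) = φ x := by
  ext m
  have hx : x ∈ (lcCl x).1 := mem_lcCl.2 specializes_rfl
  have hc : ClosedIn (lcCl x).1 (lcCl x).1 := closedIn_cl specializes_rfl
  have := hφ.germ_glueHom (hN := hN) (hN₀ := hN₀) hx m
  rwa [germ_cl N specializes_rfl, germ_cl M specializes_rfl, mR_self, mR_self] at this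

end glueHom

end Finite

/-! ### Degree zero: gluing over smallest neighbourhoods of points -/

section Finite

variable {X : Type u} [TopologicalSpace X] [Finite X]

theorem mem_lcOpen {x y : X} : y ∈ (lcOpen x).1 ↔ y ⤳ x := mem_nhdsKer_singleton

theorem openIn_inter_open (Y : LC X) (x : X) : OpenIn (Y.inter (lcOpen x)).1 Y.1 :=
  ⟨nhdsKer {x}, isOpen_nhdsKer, Set.inter_comm _ _⟩

theorem closedIn_inter_open {Y : LC X} {x : X} (hx : x ∈ Y.1) :
    ClosedIn (Y.inter (lcOpen x)).1 (lcOpen x).1 :=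
  closedIn_iff.2 ⟨Set.inter_subset_right, fun _ hu _ hy h =>
    ⟨Y.convex hx hu.1 h (mem_lcOpen.1 hy), hy⟩⟩

theorem openIn_open {x y : X} (h : y ⤳ x) : OpenIn (lcOpen y).1 (lcOpen x).1 :=
  openIn_of_isOpen isOpen_nhdsKer fun _ hz => mem_lcOpen.2 ((mem_lcOpen.1 hz).trans h)

section Cogerm

variable (M : ST X ⥤ AddCommGrpCat.{w})

/-- The map `M(nhdsKer {x}, 0) → M(Y, 0)` for `x ∈ Y`. -/
def cogerm {Y : LC X} {x : X} (hx : x ∈ Y.1) : K M (lcOpen x) 0 →+ K M Y 0 :=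
  (mI M (openIn_inter_open Y x) 0).comp (mR M (closedIn_inter_open hx) 0)

theorem cogerm_eq {Y E : LC X} {x : X} (hx : x ∈ Y.1) (e : E.1 = Y.1 ∩ (lcOpen x).1)
    (hE : OpenIn E.1 Y.1) (hE' : ClosedIn E.1 (lcOpen x).1) (m : K M (lcOpen x) 0) :
    cogerm M hx m = mI M hE 0 (mR M hE' 0 m) := by
  obtain rfl : E = Y.inter (lcOpen x) := Subtype.ext e
  rfl

theorem mI_cogerm {Y U : LC X} (hU : OpenIn U.1 Y.1) {x : X} (hx : x ∈ U.1) (hx' : x ∈ Y.1)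
    (m : K M (lcOpen x) 0) : mI M hU 0 (cogerm M hx m) = cogerm M hx' m := by
  obtain ⟨hUY, hu⟩ := openIn_iff.1 hU
  have e : (U.inter (lcOpen x)).1 = Y.1 ∩ (lcOpen x).1 := Set.Subset.antisymm
    (fun z hz => ⟨hUY hz.1, hz.2⟩) (fun z hz => ⟨hu x hx z hz.1 (mem_lcOpen.1 hz.2), hz.2⟩)
  have h : OpenIn (U.inter (lcOpen x)).1 Y.1 :=
    e ▸ ⟨(lcOpen x).1, isOpen_nhdsKer, Set.inter_comm _ _⟩
  rw [cogerm_eq M hx' e h (closedIn_inter_open hx), ← mI_mI M (openIn_inter_open U x) hU]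
  rfl

theorem mR_cogerm {Y C : LC X} (hC : ClosedIn C.1 Y.1) {x : X} (hx : x ∈ C.1) (hx' : x ∈ Y.1)
    (m : K M (lcOpen x) 0) : mR M hC 0 (cogerm M hx' m) = cogerm M hx m := by
  obtain ⟨hCY, hc⟩ := closedIn_iff.1 hC
  have h : ClosedIn (C.inter (lcOpen x)).1 (Y.inter (lcOpen x)).1 := by
    refine closedIn_iff.2 ⟨fun z hz => ⟨hCY hz.1, hz.2⟩, fun z hz y hy hyz => ?_⟩
    exact ⟨hc z hz.1 y hy.1 hyz, hy.2⟩
  have e : (C.inter (lcOpen x)).1 = (Y.inter (lcOpen x)).1 ∩ C.1 := Set.Subset.antisymm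
    (fun z hz => ⟨⟨hCY hz.1, hz.2⟩, hz.1⟩) (fun z hz => ⟨hz.2, hz.1.2⟩)
  change mR M hC 0 (mI M _ 0 (mR M _ 0 m)) = _
  rw [mR_mI M _ hC e h (openIn_inter_open C x), mR_mR M _ _ (closedIn_inter_open hx)]
  rfl

theorem cogerm_mI {Y : LC X} {x y : X} (hx : x ∈ Y.1) (hy : y ∈ Y.1) (h : y ⤳ x)
    (m : K M (lcOpen y) 0) : cogerm M hx (mI M (openIn_open h) 0 m) = cogerm M hy m := by
  have e : (Y.inter (lcOpen y)).1 = (lcOpen y).1 ∩ (Y.inter (lcOpen x)).1 := Set.Subset.antisymm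
    (fun z hz => ⟨hz.2, hz.1, (openIn_iff.1 (openIn_open h)).1 hz.2⟩)
    (fun z hz => ⟨hz.2.1, hz.1⟩)
  have h' : OpenIn (Y.inter (lcOpen y)).1 (Y.inter (lcOpen x)).1 :=
    e ▸ ⟨(lcOpen y).1, isOpen_nhdsKer, rfl⟩
  change mI M _ 0 (mR M _ 0 (mI M _ 0 m)) = _
  rw [mR_mI M _ _ e (closedIn_inter_open hy) h', mI_mI M _ _ (openIn_inter_open Y y)]
  rfl

theorem cogerm_open {x y : X} (h : y ⤳ x) (hy : y ∈ (lcOpen x).1) (m : K M (lcOpen y) 0) :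
    cogerm M hy m = mI M (openIn_open h) 0 m := by
  have ho : ClosedIn (lcOpen y).1 (lcOpen y).1 := ⟨Set.univ, isClosed_univ, by simp⟩
  rw [cogerm_eq M hy (Set.inter_eq_right.2 (openIn_iff.1 (openIn_open h)).1).symm
    (openIn_open h) ho, mR_self]

theorem cogerm_mI_eq_zero [M.Additive] {Y : LC X} {x y : X} (hx : x ∈ Y.1) (hy : y ∉ Y.1)
    (h : y ⤳ x) (m : K M (lcOpen y) 0) : cogerm M hx (mI M (openIn_open h) 0 m) = 0 := by
  have e : (lcEmpty : LC X).1 = (lcOpen y).1 ∩ (Y.inter (lcOpen x)).1 := by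
    refine (Set.eq_empty_iff_forall_notMem.2 fun z hz => hy ?_).symm
    exact Y.convex hx hz.2.1 (mem_lcOpen.1 hz.1) h
  change mI M _ 0 (mR M _ 0 (mI M _ 0 m)) = _
  rw [mR_mI M _ _ e ⟨∅, isClosed_empty, by simp [lcEmpty]⟩ ⟨∅, isOpen_empty, by simp [lcEmpty]⟩]
  refine (congrArg _ (congrArg _ (eq_zero_of_empty M rfl _))).trans ?_
  rw [map_zero, map_zero]

theorem mR_cogerm_eq_zero [M.Additive] {Y C : LC X} (hC : ClosedIn C.1 Y.1) {x : X}
    (hx : x ∉ C.1) (hx' : x ∈ Y.1) (m : K M (lcOpen x) 0) :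
    mR M hC 0 (cogerm M hx' m) = 0 := by
  obtain ⟨hCY, hc⟩ := closedIn_iff.1 hC
  have e : (lcEmpty : LC X).1 = (Y.inter (lcOpen x)).1 ∩ C.1 := by
    refine (Set.eq_empty_iff_forall_notMem.2 fun z hz => hx ?_).symm
    exact hc z hz.2 x hx' (mem_lcOpen.1 hz.1.2)
  change mR M hC 0 (mI M _ 0 (mR M _ 0 m)) = _
  rw [mR_mI M _ _ e ⟨∅, isClosed_empty, by simp [lcEmpty]⟩ ⟨∅, isOpen_empty, by simp [lcEmpty]⟩]
  exact (congrArg _ (eq_zero_of_empty M rfl _)).trans (map_zero _)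

end Cogerm

/-- The Mayer–Vietoris property in degree zero. -/
theorem IsExactST.exists_coglue {M : ST X ⥤ AddCommGrpCat.{w}} (hM : IsExactST M)
    (hM₀ : IsRealRankZeroLike M) {G : Type*} [AddCommGroup G]
    {Y A B C : LC X} (hA : OpenIn A.1 Y.1) (hB : OpenIn B.1 Y.1)
    (hCA : OpenIn C.1 A.1) (hCB : OpenIn C.1 B.1) (hAB : A.1 ∪ B.1 = Y.1)
    (hC : C.1 = A.1 ∩ B.1) (f : K M A 0 →+ G) (g : K M B 0 →+ G)
    (h : ∀ c, f (mI M hCA 0 c) = g (mI M hCB 0 c)) :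
    ∃ k : K M Y 0 →+ G, (∀ a, k (mI M hA 0 a) = f a) ∧ ∀ b, k (mI M hB 0 b) = g b := by
  obtain ⟨hAY, hA'⟩ := openIn_iff.1 hA
  obtain ⟨hBY, hB'⟩ := openIn_iff.1 hB
  let D : LC X := Y.diffOpen hB
  have eD : D.1 = Y.1 \ B.1 := rfl
  have hDY : ClosedIn D.1 Y.1 := hB.closedIn_diff
  have hDA : ClosedIn D.1 A.1 := by
    rw [closedIn_iff] at hDY ⊢; grind
  have eD' : D.1 = A.1 \ C.1 := by grind
  have pB : BoundaryPair B.1 D.1 := ⟨Y.1, Y.2, hB, eD⟩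
  have pC : BoundaryPair C.1 D.1 := ⟨A.1, A.2, hCA, eD'⟩
  have ho : OpenIn D.1 D.1 := ⟨Set.univ, isOpen_univ, by simp⟩
  have hr : ∀ a, mR M hDY 0 (mI M hA 0 a) = mR M hDA 0 a := fun a => by
    rw [mR_mI M hA hDY (E := D) (by grind) hDA ho, mI_self]
  let p : K M A 0 × K M B 0 →+ K M Y 0 := (mI M hA 0).coprod (mI M hB 0)
  -- The restriction to `D = Y \ B` lifts to `A`, as `r` is surjective in degree 0; the remainder
  -- comes from `B`.
  have hp : Function.Surjective p := fun y => by
    obtain ⟨a, ha⟩ := hM.mR_surjective hM₀ hDA (mR M hDY 0 y)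
    obtain ⟨b, hb⟩ := hM.exists_mI hB hDY eD (m := y - mI M hA 0 a)
      (by rw [map_sub, hr, ha, sub_self])
    exact ⟨(a, b), by simp [p, hb]⟩
  -- If `(a, b)` dies in `Y`, then `a` comes from some `c` over `C`, and `c + b` over `B` is the
  -- boundary of some `d` over `D`. That boundary already comes from `C`, where `g` may be replaced
  -- by `f`, and it dies in `A` by exactness.
  have hk : p.ker ≤ (f.coprod g).ker := by
    rintro ⟨a, b⟩ hab
    have hab' : mI M hA 0 a + mI M hB 0 b = 0 := hab
    have ha : mR M hDA 0 a = 0 := by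
      have := congrArg (mR M hDY 0) hab'
      rwa [map_add, hr, hM.mR_mI_eq_zero hB hDY eD, add_zero, map_zero] at this
    obtain ⟨c, rfl⟩ := hM.exists_mI hCA hDA eD' ha
    have hCY : OpenIn C.1 Y.1 := by rw [openIn_iff] at hCA ⊢; grind
    obtain ⟨d, hd⟩ := hM.exists_mD hB eD pB (m := mI M hCB 0 c + b) (by
      rwa [map_add, mI_mI M hCB hB hCY, ← mI_mI M hCA hA hCY])
    have : f (mI M hCA 0 c) + g b = 0 := by
      rw [h, ← map_add, ← hd, ← mI_mD_of_open M pB pC hCB (by grind), ← h,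
        hM.mI_mD_eq_zero hCA eD' pC, map_zero]
    exact this
  refine ⟨p.liftOfSurjective hp ⟨f.coprod g, hk⟩, fun a => ?_, fun b => ?_⟩
  · have := p.liftOfRightInverse_comp_apply _ (Function.rightInverse_surjInv hp)
      ⟨f.coprod g, hk⟩ (a, 0)
    simpa [p] using this
  · have := p.liftOfRightInverse_comp_apply _ (Function.rightInverse_surjInv hp)
      ⟨f.coprod g, hk⟩ (0, b)
    simpa [p] using this

variable [T0Space X]

theorem closedIn_pt_of_minimal {Y : LC X} {x : X} (hx : x ∈ Y.1)
    (h : ∀ y ∈ Y.1, x ⤳ y → y = x) : ClosedIn (lcPt x).1 Y.1 := by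
  refine closedIn_iff.2 ⟨Set.singleton_subset_iff.2 hx, ?_⟩
  rintro _ rfl y hy hyx
  exact h y hy hyx

/-- The cogerms generate: modulo `Y \ {x}` for a minimal point `x`, every element comes from
`nhdsKer {x}`, since `r` onto `{x}` is surjective in degree 0. Testing generation on homomorphisms
makes it an extensionality principle. -/
theorem IsExactST.hom_eq_zero_of_cogerm {M : ST X ⥤ AddCommGrpCat.{w}} [M.Additive]
    (hM : IsExactST M) (hM₀ : IsRealRankZeroLike M) {G : Type*} [AddCommGroup G] {Y : LC X}
    {f : K M Y 0 →+ G} (h : ∀ x (hx : x ∈ Y.1) m, f (cogerm M hx m) = 0) : f = 0 := by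
  induction Y using LC.induction with
  | h Y ih =>
    rcases Y.1.eq_empty_or_nonempty with hY | hY
    · ext m
      rw [eq_zero_of_empty M hY m, map_zero, map_zero]
    obtain ⟨x, hx, hmin⟩ := exists_minimal_point hY
    have hC : ClosedIn (lcPt x).1 Y.1 := closedIn_pt_of_minimal hx hmin
    have hU : OpenIn (Y.diffClosed hC).1 Y.1 := hC.openIn_diff
    have h₁ : f.comp (mI M hU 0) = 0 := by
      refine ih (Y.diffClosed hC) ⟨Set.sdiff_subset, fun hs => (hs hx).2 rfl⟩ fun y hy m => ?_
      rw [AddMonoidHom.comp_apply, mI_cogerm M hU hy hy.1, h]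
    ext m
    obtain ⟨t, ht⟩ := hM.mR_surjective hM₀ (extension_pt x).closedIn (mR M hC 0 m)
    have hx' : x ∈ (lcPt x).1 := rfl
    have hpt : ∀ t, cogerm M hx' t = mR M (extension_pt x).closedIn 0 t := fun t => by
      have ho : OpenIn (lcPt x).1 (lcPt x).1 := ⟨Set.univ, isOpen_univ, by simp⟩
      rw [cogerm_eq M hx' (E := lcPt x) (Set.inter_eq_left.2 (closedIn_iff.1
        (extension_pt x).closedIn).1).symm ho (extension_pt x).closedIn, mI_self]
    have e : (lcPt x).1 = Y.1 \ (Y.diffClosed hC).1 :=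
      (Set.sdiff_sdiff_cancel_left (closedIn_iff.1 hC).1).symm
    obtain ⟨v, hv⟩ := hM.exists_mI hU hC e (m := m - cogerm M hx t) (by
      rw [map_sub, mR_cogerm M hC hx', hpt, ht, sub_self])
    have := DFunLike.congr_fun h₁ v
    rw [AddMonoidHom.comp_apply, hv, map_sub, h, sub_zero] at this
    exact this

theorem IsExactST.hom_ext_cogerm {M : ST X ⥤ AddCommGrpCat.{w}} [M.Additive]
    (hM : IsExactST M) (hM₀ : IsRealRankZeroLike M) {G : Type*} [AddCommGroup G] {Y : LC X}
    {f g : K M Y 0 →+ G} (h : ∀ x (hx : x ∈ Y.1) m, f (cogerm M hx m) = g (cogerm M hx m)) :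
    f = g :=
  sub_eq_zero.1 (hM.hom_eq_zero_of_cogerm hM₀ fun x hx m => by
    rw [AddMonoidHom.sub_apply, h, sub_self])

variable (M N : ST X ⥤ AddCommGrpCat.{w})

/-- Compatibility of a family of homomorphisms `M(nhdsKer {x}, 0) → N(nhdsKer {x}, 0)`
with the extension maps. -/
def OpCompat (φ : ∀ x : X, K M (lcOpen x) 0 →+ K N (lcOpen x) 0) : Prop :=
  ∀ x y (h : y ⤳ x) (m : K M (lcOpen y) 0),
    mI N (openIn_open h) 0 (φ y m) = φ x (mI M (openIn_open h) 0 m)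

variable {M N} [M.Additive] [N.Additive]

/-- Dual to the gluing in degree 1: for a minimal point `x`, the sets `Y ∩ nhdsKer {x}` and `Y \
{x}` form an open cover, and maps out of their groups are glued. -/
theorem OpCompat.exists_cogerm (hM : IsExactST M) (hM₀ : IsRealRankZeroLike M)
    {φ : ∀ x : X, K M (lcOpen x) 0 →+ K N (lcOpen x) 0} (hφ : OpCompat M N φ) (Y : LC X) :
    ∃ k : K M Y 0 →+ K N Y 0, ∀ x (hx : x ∈ Y.1) m,
      k (cogerm M hx m) = cogerm N hx (φ x m) := by
  induction Y using LC.induction with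
  | h Y ih =>
    rcases Y.1.eq_empty_or_nonempty with hY | hY
    · exact ⟨0, fun x hx => (hY.subset hx).elim⟩
    obtain ⟨x, hx, hmin⟩ := exists_minimal_point hY
    have hpt : ClosedIn (lcPt x).1 Y.1 := closedIn_pt_of_minimal hx hmin
    have hB : OpenIn (Y.diffClosed hpt).1 Y.1 := hpt.openIn_diff
    have hA := openIn_inter_open Y x
    have hA' := closedIn_inter_open hx
    obtain ⟨b, hb⟩ := ih (Y.diffClosed hpt) ⟨Set.sdiff_subset, fun hs => (hs hx).2 rfl⟩
    have hxA : x ∈ (Y.inter (lcOpen x)).1 := ⟨hx, mem_lcOpen.2 specializes_rfl⟩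
    have hr := hM.mR_surjective hM₀ hA'
    -- The kernel of the restriction comes from `nhdsKer {x} \ Y`, hence is generated by cogerms at
    -- points outside `Y`. By compatibility these go to cogerms at the same points, which vanish
    -- over `Y`.
    have hk : (mR M hA' 0).ker ≤ ((cogerm N hx).comp (φ x)).ker := by
      intro t ht
      have hU : OpenIn ((lcOpen x).diffClosed hA').1 (lcOpen x).1 := hA'.openIn_diff
      obtain ⟨v, rfl⟩ := hM.exists_mI hU hA'
        (Set.sdiff_sdiff_cancel_left (closedIn_iff.1 hA').1).symm ht
      have h0 : ((cogerm N hx).comp (φ x)).comp (mI M hU 0) = 0 := by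
        refine hM.hom_eq_zero_of_cogerm hM₀ fun y hy m => ?_
        have hyx : y ⤳ x := mem_lcOpen.1 hy.1
        have hyY : y ∉ Y.1 := fun h => hy.2 ⟨h, hy.1⟩
        rw [AddMonoidHom.comp_apply, AddMonoidHom.comp_apply, mI_cogerm M hU hy hy.1,
          cogerm_open M hyx, ← hφ x y hyx, cogerm_mI_eq_zero N hx hyY hyx]
      exact DFunLike.congr_fun h0 v
    obtain ⟨a, ha⟩ : ∃ a : K M (Y.inter (lcOpen x)) 0 →+ K N Y 0,
        ∀ t, a (mR M hA' 0 t) = cogerm N hx (φ x t) :=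
      ⟨(mR M hA' 0).liftOfSurjective hr ⟨_, hk⟩,
        (mR M hA' 0).liftOfRightInverse_comp_apply _ (Function.rightInverse_surjInv hr) ⟨_, hk⟩⟩
    have ha' : ∀ y (hy : y ∈ (Y.inter (lcOpen x)).1) t,
        a (cogerm M hy t) = cogerm N (Y := Y) hy.1 (φ y t) := fun y hy t => by
      have hyx : y ⤳ x := mem_lcOpen.1 hy.2
      rw [← mR_cogerm M hA' hy hy.2, ha, cogerm_open M hyx, ← hφ x y hyx, cogerm_mI N hx hy.1 hyx]
    have hb' : ∀ y (hy : y ∈ (Y.diffClosed hpt).1) t,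
        ((mI N hB 0).comp b) (cogerm M hy t) = cogerm N (Y := Y) hy.1 (φ y t) := fun y hy t => by
      rw [AddMonoidHom.comp_apply, hb, mI_cogerm N hB hy hy.1]
    have hCA : OpenIn ((Y.inter (lcOpen x)).inter (Y.diffClosed hpt)).1
        (Y.inter (lcOpen x)).1 := by
      obtain ⟨F, hF, e⟩ := hB
      refine ⟨F, hF, ?_⟩
      change _ ∩ (Y.diffClosed hpt).1 = _
      rw [e]
      ext; simp [LC.inter]; tauto
    have hCB : OpenIn ((Y.inter (lcOpen x)).inter (Y.diffClosed hpt)).1 (Y.diffClosed hpt).1 :=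
      ⟨nhdsKer {x}, isOpen_nhdsKer, by
        ext; simp [LC.inter, LC.diffClosed, lcOpen]; tauto⟩
    obtain ⟨k, hk₁, hk₂⟩ := hM.exists_coglue hM₀ hA hB hCA hCB (by
        ext z
        by_cases e : z = x
        · subst e; simp [LC.inter, LC.diffClosed, hx, mem_lcOpen, specializes_rfl]
        · simp [LC.inter, LC.diffClosed, lcPt, e]; tauto) rfl a ((mI N hB 0).comp b) (by
      refine DFunLike.congr_fun (f := a.comp (mI M hCA 0))
        (g := ((mI N hB 0).comp b).comp (mI M hCB 0)) ?_
      refine hM.hom_ext_cogerm hM₀ fun y hy t => ?_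
      rw [AddMonoidHom.comp_apply, AddMonoidHom.comp_apply _ (mI M hCB 0),
        mI_cogerm M hCA hy hy.1, mI_cogerm M hCB hy hy.2, ha', hb'])
    refine ⟨k, fun y hy t => ?_⟩
    by_cases e : y = x
    · subst e
      have hy' : y ∈ (Y.inter (lcOpen y)).1 := ⟨hy, mem_lcOpen.2 specializes_rfl⟩
      rw [← mI_cogerm M hA hy', hk₁, ha']
    · have hy' : y ∈ (Y.diffClosed hpt).1 := ⟨hy, e⟩
      rw [← mI_cogerm M hB hy', hk₂, hb']

/-- The homomorphism `M(Y, 0) → N(Y, 0)` that is determined by homomorphisms for the smallest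
neighbourhoods of points. -/
noncomputable def coglueHom (hM : IsExactST M) (hM₀ : IsRealRankZeroLike M)
    {φ : ∀ x : X, K M (lcOpen x) 0 →+ K N (lcOpen x) 0} (hφ : OpCompat M N φ) (Y : LC X) :
    K M Y 0 →+ K N Y 0 :=
  (hφ.exists_cogerm hM hM₀ Y).choose

section coglueHom

variable {hM : IsExactST M} {hM₀ : IsRealRankZeroLike M}
  {φ : ∀ x : X, K M (lcOpen x) 0 →+ K N (lcOpen x) 0} {hφ : OpCompat M N φ}

theorem coglueHom_cogerm {Y : LC X} {x : X} (hx : x ∈ Y.1) (m : K M (lcOpen x) 0) :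
    coglueHom hM hM₀ hφ Y (cogerm M hx m) = cogerm N hx (φ x m) :=
  (hφ.exists_cogerm hM hM₀ Y).choose_spec x hx m

theorem coglueHom_mI {Y U : LC X} (hU : OpenIn U.1 Y.1) (m : K M U 0) :
    coglueHom hM hM₀ hφ Y (mI M hU 0 m) = mI N hU 0 (coglueHom hM hM₀ hφ U m) := by
  have hUY := (openIn_iff.1 hU).1
  refine DFunLike.congr_fun (f := (coglueHom hM hM₀ hφ Y).comp (mI M hU 0))
    (g := (mI N hU 0).comp (coglueHom hM hM₀ hφ U)) (hM.hom_ext_cogerm hM₀ fun x hx t => ?_) m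
  rw [AddMonoidHom.comp_apply, AddMonoidHom.comp_apply, mI_cogerm M hU hx (hUY hx),
    coglueHom_cogerm, coglueHom_cogerm, mI_cogerm N hU hx (hUY hx)]

theorem coglueHom_mR {Y C : LC X} (hC : ClosedIn C.1 Y.1) (m : K M Y 0) :
    coglueHom hM hM₀ hφ C (mR M hC 0 m) = mR N hC 0 (coglueHom hM hM₀ hφ Y m) := by
  refine DFunLike.congr_fun (f := (coglueHom hM hM₀ hφ C).comp (mR M hC 0))
    (g := (mR N hC 0).comp (coglueHom hM hM₀ hφ Y)) (hM.hom_ext_cogerm hM₀ fun x hx t => ?_) m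
  rw [AddMonoidHom.comp_apply, AddMonoidHom.comp_apply, coglueHom_cogerm]
  by_cases hxC : x ∈ C.1
  · rw [mR_cogerm M hC hxC, mR_cogerm N hC hxC, coglueHom_cogerm]
  · rw [mR_cogerm_eq_zero M hC hxC, mR_cogerm_eq_zero N hC hxC, map_zero]

theorem coglueHom_open (x : X) : coglueHom hM hM₀ hφ (lcOpen x) = φ x := by
  ext m
  have hx : x ∈ (lcOpen x).1 := mem_lcOpen.2 specializes_rfl
  have := coglueHom_cogerm (hM := hM) (hM₀ := hM₀) (hφ := hφ) hx m
  rwa [cogerm_open M specializes_rfl, cogerm_open N specializes_rfl, mI_self, mI_self] at this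

end coglueHom

end Finite

/-! ### Boundary maps -/

section Boundary

variable {X : Type u} [TopologicalSpace X] [Finite X]

theorem BoundaryPair.of_openIn_right {U C C' : Set X} (h : BoundaryPair U C) (hC : OpenIn C' C) :
    BoundaryPair U C' := by
  obtain ⟨hd, hl, hn⟩ := boundaryPair_iff.1 h
  obtain ⟨hCC, ho⟩ := openIn_iff.1 hC
  rw [isLocallyClosed_iff] at hl
  refine boundaryPair_iff.2 ⟨hd.mono_right hCC, isLocallyClosed_iff.2 ?_,
    fun u hu c hc => hn u hu c (hCC hc)⟩
  intro a ha c hc b hcb hba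
  have hb : b ∈ U ∪ C := hl a (by grind) c (by grind) b hcb hba
  grind

theorem BoundaryPair.of_closedIn_left {U U' C : Set X} (h : BoundaryPair U C)
    (hU : ClosedIn U' U) : BoundaryPair U' C := by
  obtain ⟨hd, hl, hn⟩ := boundaryPair_iff.1 h
  obtain ⟨hUU, ho⟩ := closedIn_iff.1 hU
  rw [isLocallyClosed_iff] at hl
  refine boundaryPair_iff.2 ⟨hd.mono_left hUU, isLocallyClosed_iff.2 ?_,
    fun u hu c hc => hn u (hUU hu) c hc⟩
  intro a ha c hc b hcb hba
  have hb : b ∈ U ∪ C := hl a (by grind) c (by grind) b hcb hba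
  grind

theorem BoundaryPair.inter_nhdsKer {U C : Set X} (h : BoundaryPair U C) :
    BoundaryPair (U ∩ nhdsKer C) C := by
  obtain ⟨hd, hl, hn⟩ := boundaryPair_iff.1 h
  refine boundaryPair_iff.2 ⟨hd.mono_left Set.inter_subset_left, ?_, fun u hu => hn u hu.1⟩
  have : U ∩ nhdsKer C ∪ C = (U ∪ C) ∩ nhdsKer C := by
    rw [Set.union_inter_distrib_right, Set.inter_eq_left.2 (subset_nhdsKer (s := C))]
  exact this ▸ hl.inter isOpen_nhdsKer.isLocallyClosed

theorem BoundaryPair.inter_closure {U C : Set X} (h : BoundaryPair U C) :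
    BoundaryPair U (C ∩ closure U) := by
  obtain ⟨hd, hl, hn⟩ := boundaryPair_iff.1 h
  refine boundaryPair_iff.2 ⟨hd.mono_right Set.inter_subset_left, ?_,
    fun u hu c hc => hn u hu c hc.1⟩
  have : U ∪ C ∩ closure U = (U ∪ C) ∩ closure U := by
    rw [Set.union_inter_distrib_right, Set.inter_eq_left.2 (subset_closure (s := U))]
  exact this ▸ hl.inter isClosed_closure.isLocallyClosed

omit [Finite X] in
theorem isPreconnected_nhdsKer {U : Set X} (h : IsPreconnected U) :
    IsPreconnected (nhdsKer U) := by
  rw [isPreconnected_iff_subset_of_disjoint] at h ⊢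
  intro u v hu hv huv hd
  have hU : U ⊆ nhdsKer U := subset_nhdsKer
  rcases h u v hu hv (hU.trans huv) (Set.subset_empty_iff.1 (hd ▸
    Set.inter_subset_inter_left _ hU)) with h | h
  · exact .inl (nhdsKer_minimal h hu)
  · exact .inr (nhdsKer_minimal h hv)

-- A point together with one of its specializations is a connected set.
omit [Finite X] in
theorem mem_connectedComponentIn_of_specializes {S : Set X} {c k z : X}
    (hk : k ∈ connectedComponentIn S c) (hz : z ∈ S) (h : z ⤳ k ∨ k ⤳ z) :
    z ∈ connectedComponentIn S c := by
  have hkS := connectedComponentIn_subset S c hk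
  have hc : IsPreconnected ({k, z} : Set X) := by
    rcases h with h | h
    · refine (isPreconnected_singleton (x := z)).subset_closure
        (Set.singleton_subset_iff.2 (by simp)) (Set.insert_subset h.mem_closure ?_)
      exact Set.singleton_subset_iff.2 (subset_closure rfl)
    · refine (isPreconnected_singleton (x := k)).subset_closure
        (Set.singleton_subset_iff.2 (by simp)) (Set.insert_subset (subset_closure rfl) ?_)
      exact Set.singleton_subset_iff.2 h.mem_closure
  rw [connectedComponentIn_eq hk]
  exact hc.subset_connectedComponentIn (by simp) (by
    rintro _ (rfl | rfl) <;> assumption) (by simp)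

theorem isClosed_of_specializes {S : Set X} (h : ∀ x ∈ S, ∀ y, x ⤳ y → y ∈ S) : IsClosed S := by
  rw [← isOpen_compl_iff, isOpen_iff_forall_specializes]
  exact fun x y hxy hy hx => hy (h x hx y hxy)

/-- In an EBP space, an irreducible boundary pair is a restriction of an elementary one. -/
theorem EBPSpace.exists_arrow [T0Space X] (hX : EBPSpace X) {U C : Set X} (h : BoundaryPair U C)
    (hU : IsConnected U) (hC : IsConnected C) (hUC : U ⊆ nhdsKer C) (hCU : C ⊆ closure U) :
    ∃ x y, Arrow x y ∧ x ∈ U ∧ y ∈ C ∧ U ⊆ nhdsKer {x} ∧ C ⊆ closure {y} ∧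
      BoundaryPair (nhdsKer {x}) (closure {y}) := by
  obtain ⟨hd, hl, hn⟩ := boundaryPair_iff.1 h
  rw [isLocallyClosed_iff] at hl
  obtain ⟨c, hc⟩ := hC.1
  have hUU : U ⊆ nhdsKer U := subset_nhdsKer
  -- The pair is enlarged to an elementary one: `U` to its smallest open neighbourhood, and `C` to
  -- the component containing it in the frontier of that neighbourhood.
  let S := closure (nhdsKer U) \ nhdsKer U
  have hCS : C ⊆ S := by
    refine fun z hz => ⟨closure_mono hUU (hCU hz), fun hz' => ?_⟩
    obtain ⟨u, hu, hzu⟩ := mem_nhdsKer_iff_specializes.1 hz'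
    exact hn u hu z hz hzu
  have hS : IsClosed S := isClosed_closure.sdiff isOpen_nhdsKer
  have hCK := hC.2.subset_connectedComponentIn hc hCS
  have hKS := connectedComponentIn_subset S c
  set L := connectedComponentIn S c with hL
  have hLc : IsClosed L := isClosed_of_specializes fun k hk z hkz =>
    mem_connectedComponentIn_of_specializes hk (hkz.mem_closed hS (hKS hk)) (.inr hkz)
  have hB : BoundaryPair (nhdsKer U) L := by
    refine boundaryPair_iff.2 ⟨Set.disjoint_left.2 fun z hz hz' => (hKS hz').2 hz,
      isLocallyClosed_iff.2 ?_, fun u hu k hk hku =>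
        (hKS hk).2 (hku.mem_open isOpen_nhdsKer hu)⟩
    intro a ha d hd b hdb hba
    by_cases hb : b ∈ nhdsKer U
    · exact .inl hb
    have haL : a ∈ L := ha.resolve_left fun ha => hb (hba.mem_open isOpen_nhdsKer ha)
    have hdc : d ∈ closure (nhdsKer U) := hd.elim (fun h => subset_closure h) fun h => (hKS h).1
    exact .inr (mem_connectedComponentIn_of_specializes haL
      ⟨hdb.mem_closed isClosed_closure hdc, hb⟩ (.inl hba))
  obtain ⟨x, y, hxy, ex, ey⟩ := hX.elementary (nhdsKer U) L
    { boundaryPair := hB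
      connected_left := ⟨hU.1.mono hUU, isPreconnected_nhdsKer hU.2⟩
      connected_right := isConnected_connectedComponentIn_iff.2 (hCS hc)
      isOpen := isOpen_nhdsKer
      isClosed := hLc
      subset_nhdsKer := nhdsKer_minimal (hUC.trans (nhdsKer_mono hCK)) isOpen_nhdsKer
      subset_closure := fun z hz => (hKS hz).1 }
  -- The point `x` specializes to some point of `U`, and every point of `U` specializes to `x`; the
  -- T₀ property identifies the two.
  have hxU : x ∈ U := by
    have : x ∈ nhdsKer U := ex ▸ subset_nhdsKer rfl
    obtain ⟨u, hu, hxu⟩ := mem_nhdsKer_iff_specializes.1 this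
    have hux : u ∈ nhdsKer {x} := ex ▸ hUU hu
    rwa [(hxu.antisymm (mem_nhdsKer_singleton.1 hux)).eq]
  -- There is `d ∈ C` with `x ⤳ y ⤳ d`, so `y ∈ U ∪ C` by convexity, while points of `L` are not in
  -- `U`.
  have hyC : y ∈ C := by
    obtain ⟨d, hd, hxd⟩ := mem_nhdsKer_iff_specializes.1 (hUC hxU)
    have hyd : y ⤳ d := specializes_iff_mem_closure.2 (ey ▸ hCK hd)
    refine (hl d (.inr hd) x (.inl hxU) y hxy.specializes hyd).resolve_left fun hyU => ?_
    have hyL : y ∈ L := ey ▸ subset_closure rfl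
    exact (hKS hyL).2 (hUU hyU)
  exact ⟨x, y, hxy, hxU, hyC, ex ▸ hUU, ey ▸ hCK, ex ▸ ey ▸ hB⟩

omit [Finite X] in
theorem exists_separation {Y : LC X} (h : ¬ IsPreconnected Y.1) :
    ∃ A B : LC X, A.1.Nonempty ∧ B.1.Nonempty ∧ Disjoint (closure A.1) B.1 ∧
      Disjoint A.1 (closure B.1) ∧ Y.1 = A.1 ∪ B.1 ∧ OpenIn A.1 Y.1 ∧ ClosedIn A.1 Y.1 ∧
      OpenIn B.1 Y.1 ∧ ClosedIn B.1 Y.1 := by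
  simp only [_root_.IsPreconnected, not_forall] at h
  obtain ⟨u, v, hu, hv, huv, hYu, hYv, hd⟩ := h
  rw [Set.not_nonempty_iff_eq_empty, Set.eq_empty_iff_forall_notMem] at hd
  have hA : OpenIn (Y.1 ∩ u) Y.1 := ⟨u, hu, Set.inter_comm _ _⟩
  have hB : OpenIn (Y.1 ∩ v) Y.1 := ⟨v, hv, Set.inter_comm _ _⟩
  have e₁ : Y.1 \ (Y.1 ∩ v) = Y.1 ∩ u := by ext z; have := @huv z; have := hd z; grind
  have e₂ : Y.1 \ (Y.1 ∩ u) = Y.1 ∩ v := by ext z; have := @huv z; have := hd z; grind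
  have hA' : ClosedIn (Y.1 ∩ u) Y.1 := by rw [← e₁]; exact hB.closedIn_diff
  have hB' : ClosedIn (Y.1 ∩ v) Y.1 := by rw [← e₂]; exact hA.closedIn_diff
  refine ⟨⟨_, hA.isLocallyClosed Y.2⟩, ⟨_, hB.isLocallyClosed Y.2⟩, hYu, hYv, ?_, ?_, ?_, hA,
    hA', hB, hB'⟩
  · refine ((Disjoint.closure_left (s := Y.1 ∩ u) (t := v) ?_ hv)).mono_right
      Set.inter_subset_right
    exact Set.disjoint_left.2 fun z hz hz' => hd z ⟨hz.1, hz.2, hz'⟩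
  · refine ((Disjoint.closure_right (s := u) (t := Y.1 ∩ v) ?_ hu)).mono_left
      Set.inter_subset_right
    exact Set.disjoint_left.2 fun z hz hz' => hd z ⟨hz'.1, hz, hz'.2⟩
  · ext z
    have := @huv z
    change _ ↔ z ∈ (Y.1 ∩ u) ∪ (Y.1 ∩ v)
    grind

/-- Naturality with respect to the boundary maps `δ` for the arrows `x → y` with `y ∈ D` implies
naturality with respect to all boundary maps defined on subsets of the closed set `D`. -/
theorem EBPSpace.natural_mD [T0Space X] (hX : EBPSpace X) {M N : ST X ⥤ AddCommGrpCat.{w}}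
    [M.Additive] [N.Additive]
    (f : ∀ Y : LC X, K M Y 0 →+ K N Y 0) (g : ∀ Y : LC X, K M Y 1 →+ K N Y 1)
    {D : Set X} (hD : IsClosed D)
    (hfI : ∀ {U Y : LC X} (h : OpenIn U.1 Y.1) m, f Y (mI M h 0 m) = mI N h 0 (f U m))
    (hfR : ∀ {Y C : LC X} (h : ClosedIn C.1 Y.1) m, f C (mR M h 0 m) = mR N h 0 (f Y m))
    (hgI : ∀ {U Y : LC X} (h : OpenIn U.1 Y.1), Y.1 ⊆ D → ∀ m,
      g Y (mI M h 1 m) = mI N h 1 (g U m))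
    (hgR : ∀ {Y C : LC X} (h : ClosedIn C.1 Y.1), Y.1 ⊆ D → ∀ m,
      g C (mR M h 1 m) = mR N h 1 (g Y m))
    (harrow : ∀ x y, Arrow x y → y ∈ D → ∀ (h : BoundaryPair (lcOpen x).1 (lcCl y).1) m,
      f _ (mD M h m) = mD N h (g _ m))
    {U C : LC X} (h : BoundaryPair U.1 C.1) (hCD : C.1 ⊆ D) (m : K M C 1) :
    f U (mD M h m) = mD N h (g C m) := by
  obtain ⟨Y, hY⟩ : ∃ Y : LC X, Y.1 = U.1 ∪ C.1 := ⟨⟨_, (boundaryPair_iff.1 h).2.1⟩, rfl⟩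
  induction Y using LC.induction generalizing U C with
  | h Y ih =>
    have hd := Set.disjoint_left.1 (boundaryPair_iff.1 h).1
    -- Otherwise the points of `U` that do not specialize into `C` can be discarded.
    by_cases hUC : U.1 ⊆ nhdsKer C.1
    swap
    · have hU' : OpenIn (U.1 ∩ nhdsKer C.1) U.1 := ⟨_, isOpen_nhdsKer, Set.inter_comm _ _⟩
      have hB := h.inter_nhdsKer
      let U' : LC X := ⟨U.1 ∩ nhdsKer C.1, hU'.isLocallyClosed U.2⟩
      have key : ∀ u ∈ U.1, ∀ c ∈ C.1, u ⤳ c → u ∈ U'.1 := fun u hu c hc huc =>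
        ⟨hu, mem_nhdsKer_iff_specializes.2 ⟨c, hc, huc⟩⟩
      rw [← mI_mD_of_open M (U' := U') h hB hU' key, ← mI_mD_of_open N (U' := U') h hB hU' key,
        hfI]
      refine congrArg _ (ih ⟨_, (boundaryPair_iff.1 hB).2.1⟩ ?_ hB hCD m rfl)
      obtain ⟨u, hu, hu'⟩ := Set.not_subset.1 hUC
      rw [hY]
      refine ⟨Set.union_subset_union_left _ Set.inter_subset_left, fun hs => ?_⟩
      rcases hs (.inl hu) with h' | h'
      · exact hu' h'.2
      · exact hd hu h'
    -- Otherwise the points of `C` outside the closure of `U` can be discarded.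
    by_cases hCU : C.1 ⊆ closure U.1
    swap
    · have hC' : ClosedIn (C.1 ∩ closure U.1) C.1 := ⟨_, isClosed_closure, Set.inter_comm _ _⟩
      have hB := h.inter_closure
      let C' : LC X := ⟨C.1 ∩ closure U.1, hC'.isLocallyClosed C.2⟩
      have key : ∀ u ∈ U.1, ∀ c ∈ C.1, u ⤳ c → c ∈ C'.1 := fun u hu c hc huc =>
        ⟨hc, mem_closure_iff_specializes.2 ⟨u, hu, huc⟩⟩
      rw [← mD_mR_of_closed M (C' := C') h hB hC' key, ← mD_mR_of_closed N (C' := C') h hB hC' key,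
        ← hgR _ hCD]
      refine ih ⟨_, (boundaryPair_iff.1 hB).2.1⟩ ?_ hB (Set.inter_subset_left.trans hCD) _ rfl
      obtain ⟨c, hc, hc'⟩ := Set.not_subset.1 hCU
      rw [hY]
      refine ⟨Set.union_subset_union_right _ Set.inter_subset_left, fun hs => ?_⟩
      rcases hs (.inr hc) with h' | h'
      · exact hd h' hc
      · exact hc' h'.2
    rcases U.1.eq_empty_or_nonempty with hU₀ | hU₀
    · rw [eq_zero_of_empty N hU₀ (f U _), eq_zero_of_empty N hU₀ (mD N h _)]
    rcases C.1.eq_empty_or_nonempty with hC₀ | hC₀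
    · rw [eq_zero_of_empty M hC₀ m, map_zero, map_zero, map_zero, map_zero]
    -- A separation of `U` decomposes the target of δ as a biproduct, with relation 7 giving the
    -- components.
    by_cases hUp : IsPreconnected U.1
    swap
    · obtain ⟨A, B, hA, hB, hAB, hBA, e, hAo, hAc, hBo, hBc⟩ := exists_separation hUp
      have hAB' := Set.disjoint_left.1 (hAB.mono_left subset_closure)
      have hA' := h.of_closedIn_left hAc
      have hB' := h.of_closedIn_left hBc
      have key : ∀ (Z Z' : LC X) (hZ : BoundaryPair Z.1 C.1), Z'.1.Nonempty →
          (∀ z ∈ Z.1, z ∉ Z'.1) → U.1 = Z.1 ∪ Z'.1 → f Z (mD M hZ m) = mD N hZ (g C m) := by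
        intro Z Z' hZ hZ' hd' e'
        refine ih ⟨_, (boundaryPair_iff.1 hZ).2.1⟩ ?_ hZ hCD m rfl
        obtain ⟨z, hz⟩ := hZ'
        rw [hY, e']
        refine ⟨Set.union_subset_union_left _ Set.subset_union_left, fun hs => ?_⟩
        rcases hs (.inl (.inr hz)) with h' | h'
        · exact hd' z h' hz
        · exact hd (e' ▸ .inr hz) h'
      rw [← mI_mR_add M hAB hBA e hAo hAc hBo hBc 0 (mD M h m),
        ← mI_mR_add N hAB hBA e hAo hAc hBo hBc 0 (mD N h _), mR_mD M h hAc hA', mR_mD M h hBc hB',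
        mR_mD N h hAc hA', mR_mD N h hBc hB', map_add, hfI, hfI,
        key A B hA' hB (fun z hz => hAB' hz) e, key B A hB' hA (fun z hz hz' => hAB' hz' hz)
          (e.trans (Set.union_comm _ _))]
    -- A separation of `C` decomposes the source of δ, with relation 6 giving the components.
    by_cases hCp : IsPreconnected C.1
    swap
    · obtain ⟨A, B, hA, hB, hAB, hBA, e, hAo, hAc, hBo, hBc⟩ := exists_separation hCp
      have hAB' := Set.disjoint_left.1 (hAB.mono_left subset_closure)
      have hA' := h.of_openIn_right hAo
      have hB' := h.of_openIn_right hBo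
      have key : ∀ (Z Z' : LC X) (hZ : BoundaryPair U.1 Z.1), Z'.1.Nonempty →
          (∀ z ∈ Z.1, z ∉ Z'.1) → C.1 = Z.1 ∪ Z'.1 → ∀ m,
          f U (mD M hZ m) = mD N hZ (g Z m) := by
        intro Z Z' hZ hZ' hd' e' m
        refine ih ⟨_, (boundaryPair_iff.1 hZ).2.1⟩ ?_ hZ
          (Set.Subset.trans (e' ▸ Set.subset_union_left) hCD) m rfl
        obtain ⟨z, hz⟩ := hZ'
        rw [hY, e']
        refine ⟨Set.union_subset_union_right _ Set.subset_union_left, fun hs => ?_⟩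
        rcases hs (.inr (.inr hz)) with h' | h'
        · exact hd h' (e' ▸ .inr hz)
        · exact hd' z h' hz
      have eM : mD M h m = mD M hA' (mR M hAc 1 m) + mD M hB' (mR M hBc 1 m) := by
        rw [← mD_mI M h hAo hA', ← mD_mI M h hBo hB', ← map_add,
          mI_mR_add M hAB hBA e hAo hAc hBo hBc]
      have eN : mD N h (g C m) = mD N hA' (mR N hAc 1 (g C m)) + mD N hB' (mR N hBc 1 (g C m)) := by
        rw [← mD_mI N h hAo hA', ← mD_mI N h hBo hB', ← map_add,
          mI_mR_add N hAB hBA e hAo hAc hBo hBc]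
      rw [eM, eN, map_add, ← hgR hAc hCD, ← hgR hBc hCD, key A B hA' hB (fun z hz => hAB' hz) e,
        key B A hB' hA (fun z hz hz' => hAB' hz' hz) (e.trans (Set.union_comm _ _))]
    -- Now δ is `i` from `C` to `closure {y}`, followed by δ into `nhdsKer {x}`, followed by `r`
    -- onto `U`, and each factor is natural.
    obtain ⟨x, y, hxy, hxU, hyC, hUx, hCy, hB⟩ :=
      hX.exists_arrow h ⟨hU₀, hUp⟩ ⟨hC₀, hCp⟩ hUC hCU
    have hyD : (lcCl y).1 ⊆ D :=
      closure_minimal (Set.singleton_subset_iff.2 (hCD hyC)) hD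
    have hCo : OpenIn C.1 (lcCl y).1 := openIn_iff.2 ⟨hCy, fun c hc z hz hzc =>
      C.convex hc hyC (mem_lcCl.1 hz) hzc⟩
    have hUc : ClosedIn U.1 (lcOpen x).1 := closedIn_iff.2 ⟨hUx, fun u hu z hz huz =>
      U.convex hxU hu huz (mem_lcOpen.1 hz)⟩
    have hB₁ : BoundaryPair (lcOpen x).1 (lcCl y).1 := hB
    have hB' : BoundaryPair (lcOpen x).1 C.1 := hB₁.of_openIn_right hCo
    rw [← mR_mD M hB' hUc h, ← mR_mD N hB' hUc h, ← mD_mI M hB₁ hCo hB', ← mD_mI N hB₁ hCo hB',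
      hfR, harrow x y hxy (hCD hyC), hgI hCo hyD]

end Boundary

/-! ### Lifting to closures of points -/

section Lift

variable {X : Type u} [TopologicalSpace X] [Finite X] [T0Space X]

/-- The complement of `x` in the closure of `x`. -/
def lcFr (x : X) : LC X := (lcCl x).diffOpen (openIn_pt_cl x)

theorem mem_lcFr {x y : X} : y ∈ (lcFr x).1 ↔ x ⤳ y ∧ y ≠ x :=
  and_congr_left' mem_lcCl

theorem mem_lcBd {x y : X} : y ∈ (lcBd x).1 ↔ y ⤳ x ∧ y ≠ x :=
  and_congr_left' mem_lcOpen

theorem closedIn_fr_cl (x : X) : ClosedIn (lcFr x).1 (lcCl x).1 := (openIn_pt_cl x).closedIn_diff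

/-- Convexity is only in doubt between a generization and a specialization of `x`; there the
interval is a chain through `x`, so all its points are comparable to `x`. -/
theorem UniquePathSpace.isLocallyClosed_open_union_cl (hX : UniquePathSpace X) (x : X) :
    IsLocallyClosed ((lcOpen x).1 ∪ (lcCl x).1) := by
  refine isLocallyClosed_iff.2 fun a ha c hc b hcb hba => ?_
  simp only [Set.mem_union, mem_lcOpen, mem_lcCl] at *
  rcases ha with ha | ha
  · exact .inl (hba.trans ha)
  rcases hc with hc | hc
  · exact hX.comparable hc ha hcb hba
  · exact .inr (hc.trans hcb)

theorem UniquePathSpace.boundaryPair_bd_cl (hX : UniquePathSpace X) (x : X) :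
    BoundaryPair (lcBd x).1 (lcCl x).1 := by
  refine boundaryPair_iff.2 ⟨Set.disjoint_left.2 fun z hz hz' => ?_, ?_, fun u hu c hc hcu => ?_⟩
  · exact (mem_lcBd.1 hz).2 ((mem_lcBd.1 hz).1.antisymm (mem_lcCl.1 hz')).eq
  · convert hX.isLocallyClosed_open_union_cl x using 1
    ext z
    simp only [Set.mem_union, mem_lcOpen, mem_lcBd, mem_lcCl]
    by_cases e : z = x
    · simp [e, specializes_rfl]
    · simp [e]
  · obtain ⟨hux, hne⟩ := mem_lcBd.1 hu
    exact hne (hux.antisymm ((mem_lcCl.1 hc).trans hcu)).eq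

theorem UniquePathSpace.boundaryPair_open_fr (hX : UniquePathSpace X) (x : X) :
    BoundaryPair (lcOpen x).1 (lcFr x).1 := by
  refine boundaryPair_iff.2 ⟨Set.disjoint_left.2 fun z hz hz' => ?_, ?_, fun u hu c hc hcu => ?_⟩
  · exact (mem_lcFr.1 hz').2 ((mem_lcOpen.1 hz).antisymm (mem_lcFr.1 hz').1).eq
  · convert hX.isLocallyClosed_open_union_cl x using 1
    ext z
    simp only [Set.mem_union, mem_lcOpen, mem_lcFr, mem_lcCl]
    by_cases e : z = x
    · simp [e, specializes_rfl]
    · simp [e]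
  · obtain ⟨hxc, hne⟩ := mem_lcFr.1 hc
    exact hne ((hcu.trans (mem_lcOpen.1 hu)).antisymm hxc).eq

/-- Relation 8 with `Y = closure {x}`, `Z = nhdsKer {x}` and `W` their union. This square is the
compatibility between the two kinds of data that a lift to `closure {x}` has to match. -/
theorem mI_mD_bd (M : ST X ⥤ AddCommGrpCat.{w}) (hX : UniquePathSpace X) (x : X)
    (m : K M (lcCl x) 1) :
    mI M (extension_pt x).openIn 0 (mD M (hX.boundaryPair_bd_cl x) m) =
      mD M (hX.boundaryPair_open_fr x) (mR M (closedIn_fr_cl x) 1 m) := by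
  have h := hX.isLocallyClosed_open_union_cl x
  have e₁ : (lcCl x).1 ∪ ((lcOpen x).1 ∪ (lcCl x).1) = (lcOpen x).1 ∪ (lcCl x).1 := by grind
  have e₂ : (lcOpen x).1 ∪ ((lcOpen x).1 ∪ (lcCl x).1) = (lcOpen x).1 ∪ (lcCl x).1 := by grind
  have hcl : ∀ z, z ⤳ x → x ⤳ z → z = x := fun z h h' => (h.antisymm h').eq
  refine mI_mD M (Y := lcCl x) (Z := lcOpen x) (W := ⟨(lcOpen x).1 ∪ (lcCl x).1, h⟩)
    (by rwa [e₁]) ?_ ?_ (by rwa [e₂]) ?_ ?_ ?_ ?_ ?_ _ _ _ _ m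
  · rw [e₁]; exact ⟨closure {x}, isClosed_closure, (Set.inter_eq_left.2 (by
      exact Set.subset_union_right)).symm⟩
  · rw [e₁]; exact ⟨Set.univ, isClosed_univ, (Set.univ_inter _).symm⟩
  · rw [e₂]; exact openIn_of_isOpen isOpen_nhdsKer Set.subset_union_left
  · rw [e₂]; exact ⟨Set.univ, isOpen_univ, (Set.univ_inter _).symm⟩
  · exact (Set.union_comm _ _).subset
  · ext z
    change _ ↔ z ∈ ((lcOpen x).1 ∪ (lcCl x).1) \ (lcCl x).1
    simp only [Set.mem_sdiff, Set.mem_union, mem_lcOpen, mem_lcBd, mem_lcCl]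
    have := hcl z
    have h' : z = x → x ⤳ z := fun e => e ▸ specializes_rfl
    tauto
  · ext z
    change _ ↔ z ∈ ((lcOpen x).1 ∪ (lcCl x).1) \ (lcOpen x).1
    simp only [Set.mem_sdiff, Set.mem_union, mem_lcOpen, mem_lcFr, mem_lcCl]
    have := hcl z
    have h' : z = x → z ⤳ x := fun e => e ▸ specializes_rfl
    tauto

theorem boundaryPair_pt_fr (x : X) : BoundaryPair (lcPt x).1 (lcFr x).1 :=
  ⟨(lcCl x).1, (lcCl x).2, openIn_pt_cl x, rfl⟩

/-- Elements of `N(closure {x}, 1)` with prescribed restriction and prescribed boundary. -/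
theorem IsExactST.exists_mR_mD {N : ST X ⥤ AddCommGrpCat.{w}} (hN : IsExactST N)
    (hX : UniquePathSpace X) (x : X) (n : K N (lcFr x) 1) (b : K N (lcBd x) 0)
    (h : mD N (hX.boundaryPair_open_fr x) n = mI N (extension_pt x).openIn 0 b) :
    ∃ y, mR N (closedIn_fr_cl x) 1 y = n ∧ mD N (hX.boundaryPair_bd_cl x) y = b := by
  have hE := extension_pt x
  -- The obstruction to extending `n` lies over `{x}` in degree 0. It is the restriction of an
  -- element that comes from `nhdsKer {x} \ {x}`, hence zero.
  obtain ⟨y, rfl⟩ := hN.exists_mR (openIn_pt_cl x) (closedIn_fr_cl x) rfl (boundaryPair_pt_fr x)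
    (m := n) (by
      rw [← mR_mD N (hX.boundaryPair_open_fr x) hE.closedIn, h,
        hN.mR_mI_eq_zero hE.openIn hE.closedIn hE.eq_diff])
  -- The error in the boundary dies in `nhdsKer {x}`, so it is the boundary of some `c` over `{x}`.
  -- Subtracting `i c` corrects it without changing the restriction.
  obtain ⟨c, hc⟩ := hN.exists_mD hE.openIn hE.eq_diff hE.boundaryPair
    (m := mD N (hX.boundaryPair_bd_cl x) y - b) (by rw [map_sub, mI_mD_bd N hX, h, sub_self])
  refine ⟨y - mI N (openIn_pt_cl x) 1 c, ?_, ?_⟩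
  · rw [map_sub, hN.mR_mI_eq_zero (openIn_pt_cl x) (closedIn_fr_cl x) rfl, sub_zero]
  · rw [map_sub, mD_mI N _ _ hE.boundaryPair, hc, sub_sub_cancel]

/-- Removing maximal points one by one filters the group; each step is a left exact sequence with a
free kernel and a projective third term. -/
theorem FreeAtNonOpenPoints.projective {M : ST X ⥤ AddCommGrpCat.{w}} [M.Additive]
    (hM : IsExactST M) (hM₀ : IsRealRankZeroLike M) (hMf : FreeAtNonOpenPoints M) (Y : LC X)
    (hY : ∀ x ∈ Y.1, ¬ IsOpen ({x} : Set X)) : Module.Projective ℤ (K M Y 1) := by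
  induction Y using LC.induction with
  | h Y ih =>
    rcases Y.1.eq_empty_or_nonempty with hY₀ | hY₀
    · have : Subsingleton (K M Y 1) := ⟨fun a b => by
        rw [eq_zero_of_empty M hY₀ a, eq_zero_of_empty M hY₀ b]⟩
      infer_instance
    obtain ⟨x, hx, hmax⟩ := exists_maximal_point hY₀
    have hU : OpenIn (lcPt x).1 Y.1 := openIn_pt_of_maximal hx hmax
    have hC : ClosedIn (Y.diffOpen hU).1 Y.1 := hU.closedIn_diff
    have h₁ : Module.Projective ℤ (K M (Y.diffOpen hU) 1) :=
      ih _ ⟨Set.sdiff_subset, fun hs => (hs hx).2 rfl⟩ fun y hy => hY y hy.1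
    have h₂ : Module.Free ℤ (K M (lcPt x) 1) := hMf x (hY x hx)
    exact projective_int_of_exact (mI M hU 1) (mR M hC 1) (hM.mI_injective hM₀ hU)
      fun b hb => hM.exists_mI hU hC rfl hb

variable {M N : ST X ⥤ AddCommGrpCat.{w}}

/-- The image of `r` in the projective group over `closure {x} \ {x}` is projective, so `M(closure
{x}, 1)` splits as `M({x}, 1)` plus this image. On the first summand the map is forced by `p`; on
the second, the prescribed restriction and boundary are lifted through the surjection of `N(closure
{x}, 1)` onto the pullback. -/
theorem IsExactST.exists_cl_lift (hM : IsExactST M) (hM₀ : IsRealRankZeroLike M)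
    (hN : IsExactST N) (hX : UniquePathSpace X) (x : X) [Module.Projective ℤ (K M (lcFr x) 1)]
    (p : K M (lcPt x) 1 →+ K N (lcPt x) 1) (b : K M (lcBd x) 0 →+ K N (lcBd x) 0)
    (o : K M (lcOpen x) 0 →+ K N (lcOpen x) 0) (d : K M (lcFr x) 1 →+ K N (lcFr x) 1)
    (hpb : ∀ m, b (mD M (extension_pt x).boundaryPair m) =
      mD N (extension_pt x).boundaryPair (p m))
    (hbo : ∀ m, o (mI M (extension_pt x).openIn 0 m) = mI N (extension_pt x).openIn 0 (b m))
    (hdo : ∀ m, o (mD M (hX.boundaryPair_open_fr x) m) =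
      mD N (hX.boundaryPair_open_fr x) (d m)) :
    ∃ f : K M (lcCl x) 1 →+ K N (lcCl x) 1,
      (∀ m, f (mI M (openIn_pt_cl x) 1 m) = mI N (openIn_pt_cl x) 1 (p m)) ∧
      (∀ m, mR N (closedIn_fr_cl x) 1 (f m) = d (mR M (closedIn_fr_cl x) 1 m)) ∧
      ∀ m, mD N (hX.boundaryPair_bd_cl x) (f m) = b (mD M (hX.boundaryPair_bd_cl x) m) := by
  have hE := extension_pt x
  let r := (mR M (closedIn_fr_cl x) 1).toIntLinearMap
  have : Module.Projective ℤ (LinearMap.range r) :=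
    projective_int_of_injective (LinearMap.range r).subtype Subtype.val_injective
  obtain ⟨s, hs⟩ := Module.projective_lifting_property r.rangeRestrict LinearMap.id
    r.surjective_rangeRestrict
  have hs' : ∀ j, mR M (closedIn_fr_cl x) 1 (s j) = j.1 := fun j =>
    congrArg Subtype.val (LinearMap.congr_fun hs j)
  -- The kernel of `q` is the pullback of pairs of a restriction and a boundary that agree over
  -- `nhdsKer {x}`.
  let q : K N (lcFr x) 1 × K N (lcBd x) 0 →ₗ[ℤ] K N (lcOpen x) 0 :=
    (mD N (hX.boundaryPair_open_fr x)).toIntLinearMap.coprod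
      (-(mI N hE.openIn 0)).toIntLinearMap
  have hq : ∀ n c, (n, c) ∈ LinearMap.ker q ↔
      mD N (hX.boundaryPair_open_fr x) n = mI N hE.openIn 0 c := fun n c => by
    rw [LinearMap.mem_ker]
    change mD N (hX.boundaryPair_open_fr x) n + -(mI N hE.openIn 0 c) = 0 ↔ _
    rw [← sub_eq_add_neg, sub_eq_zero]
  let T : K N (lcCl x) 1 →ₗ[ℤ] LinearMap.ker q :=
    ((mR N (closedIn_fr_cl x) 1).toIntLinearMap.prod
      (mD N (hX.boundaryPair_bd_cl x)).toIntLinearMap).codRestrict _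
      fun y => (hq _ _).2 (mI_mD_bd N hX x y).symm
  have hT : Function.Surjective T := by
    rintro ⟨⟨n, c⟩, h⟩
    obtain ⟨y, hy₁, hy₂⟩ := hN.exists_mR_mD hX x n c ((hq n c).1 h)
    exact ⟨y, Subtype.ext (Prod.ext hy₁ hy₂)⟩
  let g₀ : LinearMap.range r →ₗ[ℤ] LinearMap.ker q :=
    ((d.toIntLinearMap.comp (LinearMap.range r).subtype).prod
      ((b.comp (mD M (hX.boundaryPair_bd_cl x))).toIntLinearMap.comp s)).codRestrict _
      fun j => (hq _ _).2 (by
        change _ = mI N hE.openIn 0 (b (mD M (hX.boundaryPair_bd_cl x) (s j)))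
        rw [← hbo, mI_mD_bd M hX, hs', hdo]
        rfl)
  obtain ⟨g, hg⟩ := Module.projective_lifting_property T g₀ hT
  have hg₁ : ∀ j, mR N (closedIn_fr_cl x) 1 (g j) = d j.1 := fun j =>
    congrArg (fun z => z.1.1) (LinearMap.congr_fun hg j)
  have hg₂ : ∀ j, mD N (hX.boundaryPair_bd_cl x) (g j) =
      b (mD M (hX.boundaryPair_bd_cl x) (s j)) := fun j =>
    congrArg (fun z => z.1.2) (LinearMap.congr_fun hg j)
  have hinj := hM.mI_injective hM₀ (openIn_pt_cl x)
  have key : ∀ m, ∃ t, mI M (openIn_pt_cl x) 1 t = m - s (r.rangeRestrict m) := fun m =>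
    hM.exists_mI (openIn_pt_cl x) (closedIn_fr_cl x) rfl (by
      rw [map_sub, hs']
      exact sub_self _)
  -- The retraction onto `M({x}, 1)` complementary to the section `s`.
  choose t ht using key
  let t' : K M (lcCl x) 1 →+ K M (lcPt x) 1 := AddMonoidHom.mk' t fun a c => hinj (by
    rw [map_add, ht, ht, ht, map_add, map_add]; abel)
  have ht' : ∀ m, mI M (openIn_pt_cl x) 1 (t' m) = m - s (r.rangeRestrict m) := ht
  refine ⟨((mI N (openIn_pt_cl x) 1).comp p).comp t' +
    (g.comp r.rangeRestrict).toAddMonoidHom, fun m => ?_, fun m => ?_, fun m => ?_⟩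
  · have h₀ : r.rangeRestrict (mI M (openIn_pt_cl x) 1 m) = 0 :=
      Subtype.ext (hM.mR_mI_eq_zero (openIn_pt_cl x) (closedIn_fr_cl x) rfl m)
    have h₁ : t' (mI M (openIn_pt_cl x) 1 m) = m := hinj (by
      rw [ht', h₀, map_zero, sub_zero])
    change mI N _ 1 (p (t' (mI M (openIn_pt_cl x) 1 m))) +
      g (r.rangeRestrict (mI M (openIn_pt_cl x) 1 m)) = _
    rw [h₀, h₁, map_zero, add_zero]
  · change mR N _ 1 (mI N _ 1 (p (t' m)) + g (r.rangeRestrict m)) = _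
    rw [map_add, hN.mR_mI_eq_zero (openIn_pt_cl x) (closedIn_fr_cl x) rfl, zero_add, hg₁]
    rfl
  · change mD N _ (mI N _ 1 (p (t' m)) + g (r.rangeRestrict m)) = _
    rw [map_add, mD_mI N _ _ hE.boundaryPair, ← hpb, hg₂, ← map_add,
      ← mD_mI M (hX.boundaryPair_bd_cl x) (openIn_pt_cl x) hE.boundaryPair, ← map_add, ht',
      sub_add_cancel]

/-- Different covers of `y` have no common generization, so the smallest neighbourhoods of the
covers partition `nhdsKer {y} \ {y}` into open, and therefore also closed, pieces. -/
theorem closedIn_open_bd (hX : UniquePathSpace X) {x y : X} (h : Arrow x y) :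
    ClosedIn (lcOpen x).1 (lcBd y).1 := by
  refine closedIn_iff.2 ⟨h.subset, fun u hu z hz huz => ?_⟩
  obtain ⟨hzy, hne⟩ := mem_lcBd.1 hz
  obtain ⟨v, hv, hzv⟩ := exists_arrow_of_specializes' hzy hne
  rw [hX.arrow_eq h hv (mem_lcOpen.1 hu) (huz.trans hzv)]
  exact mem_lcOpen.2 hzv

variable [M.Additive] [N.Additive]

/-- Naturality of the glued maps with respect to `δ`. -/
theorem EBPSpace.natural_glueHom (hX : EBPSpace X) (hN : IsExactST N)
    (hN₀ : IsRealRankZeroLike N) (f : ∀ Y : LC X, K M Y 0 →+ K N Y 0)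
    (hfI : ∀ {U Y : LC X} (h : OpenIn U.1 Y.1) m, f Y (mI M h 0 m) = mI N h 0 (f U m))
    (hfR : ∀ {Y C : LC X} (h : ClosedIn C.1 Y.1) m, f C (mR M h 0 m) = mR N h 0 (f Y m))
    {φ : ∀ x : X, K M (lcCl x) 1 →+ K N (lcCl x) 1} {D : Set X} (hD : IsClosed D)
    (hφ : ClCompat M N φ D)
    (hφD : ∀ x ∈ D, ∀ m, mD N (hX.uniquePath.boundaryPair_bd_cl x) (φ x m) =
      f (lcBd x) (mD M (hX.uniquePath.boundaryPair_bd_cl x) m))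
    {U C : LC X} (h : BoundaryPair U.1 C.1) (hCD : C.1 ⊆ D) (m : K M C 1) :
    f U (mD M h m) = mD N h (glueHom hN hN₀ φ C m) := by
  refine hX.natural_mD f (glueHom hN hN₀ φ) hD hfI hfR (fun h hY => (hφ.mono hY).glueHom_mI h)
    (fun h hY => (hφ.mono hY).glueHom_mR h) (fun x y hxy hy h m => ?_) h hCD m
  -- For `x → y`, δ into `nhdsKer {x}` is δ into `nhdsKer {y} \ {y}` followed by a restriction, so
  -- one condition per point `y` suffices.
  have hc := closedIn_open_bd hX.uniquePath hxy
  have hB := hX.uniquePath.boundaryPair_bd_cl y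
  have hyD : (lcCl y).1 ⊆ D := closure_minimal (Set.singleton_subset_iff.2 hy) hD
  rw [← mR_mD M hB hc h, ← mR_mD N hB hc h, hfR, ← hφD y hy, (hφ.mono hyD).glueHom_cl]

/-- A compatible family of homomorphisms `M(closure {x}, 1) → N(closure {x}, 1)` that extends given
homomorphisms `M({x}, 1) → N({x}, 1)`. -/
theorem EBPSpace.exists_cl_family (hX : EBPSpace X) (hM : IsExactST M)
    (hM₀ : IsRealRankZeroLike M) (hN : IsExactST N) (hN₀ : IsRealRankZeroLike N)
    (hMf : FreeAtNonOpenPoints M) (f : ∀ Y : LC X, K M Y 0 →+ K N Y 0)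
    (hfI : ∀ {U Y : LC X} (h : OpenIn U.1 Y.1) m, f Y (mI M h 0 m) = mI N h 0 (f U m))
    (hfR : ∀ {Y C : LC X} (h : ClosedIn C.1 Y.1) m, f C (mR M h 0 m) = mR N h 0 (f Y m))
    (p : ∀ x : X, K M (lcPt x) 1 →+ K N (lcPt x) 1)
    (hp : ∀ x m, f _ (mD M (extension_pt x).boundaryPair m) =
      mD N (extension_pt x).boundaryPair (p x m)) {D : LC X} (hD : IsClosed D.1) :
    ∃ φ : ∀ x : X, K M (lcCl x) 1 →+ K N (lcCl x) 1, ClCompat M N φ D.1 ∧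
      (∀ x ∈ D.1, ∀ m, φ x (mI M (openIn_pt_cl x) 1 m) = mI N (openIn_pt_cl x) 1 (p x m)) ∧
      ∀ x ∈ D.1, ∀ m, mD N (hX.uniquePath.boundaryPair_bd_cl x) (φ x m) =
        f (lcBd x) (mD M (hX.uniquePath.boundaryPair_bd_cl x) m) := by
  classical
  induction D using LC.induction with
  | h D ih =>
    rcases D.1.eq_empty_or_nonempty with hD₀ | hD₀
    · exact ⟨fun _ => 0, fun x hx => (hD₀.subset hx).elim, fun x hx => (hD₀.subset hx).elim,
        fun x hx => (hD₀.subset hx).elim⟩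
    obtain ⟨x, hx, hmax⟩ := exists_maximal_point hD₀
    have hU : OpenIn (lcPt x).1 D.1 := openIn_pt_of_maximal hx hmax
    have hD' : IsClosed (D.diffOpen hU).1 := isClosed_of_specializes fun a ha y hay =>
      ⟨hay.mem_closed hD ha.1, fun (e : y = x) => ha.2 (hmax a ha.1 (e ▸ hay))⟩
    obtain ⟨φ, hφ₁, hφ₂, hφ₃⟩ := ih (D.diffOpen hU)
      ⟨Set.sdiff_subset, fun hs => (hs hx).2 rfl⟩ hD'
    have hFr : (lcFr x).1 ⊆ (D.diffOpen hU).1 := fun y hy =>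
      ⟨(mem_lcFr.1 hy).1.mem_closed hD hx, (mem_lcFr.1 hy).2⟩
    -- A proper specialization of `x` is not open, as an open set containing it contains `x`.
    have hproj : Module.Projective ℤ (K M (lcFr x) 1) :=
      hMf.projective hM hM₀ _ fun y hy ho => by
        obtain ⟨hxy, hne⟩ := mem_lcFr.1 hy
        exact hne (hxy.mem_open ho rfl).symm
    -- Naturality of δ on `closure {x} \ {x}` is what the lift at `x` requires; it follows from the
    -- boundary condition at the earlier points, which is why that condition is part of the
    -- induction.
    obtain ⟨k, hk₁, hk₂, hk₃⟩ := hM.exists_cl_lift hM₀ hN hX.uniquePath x (p x) (f _) (f _)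
      (glueHom hN hN₀ φ (lcFr x)) (hp x) (fun m => hfI _ m)
      fun m => hX.natural_glueHom hN hN₀ f hfI hfR hD' hφ₁ hφ₃ _ hFr m
    refine ⟨Function.update φ x k, fun a ha y hay m => ?_, fun a ha m => ?_, fun a ha m => ?_⟩
    · by_cases hax : a = x
      · subst hax
        rw [Function.update_self]
        by_cases hya : y = a
        · subst hya
          rw [Function.update_self, mR_self, mR_self]
        · have hyF : y ∈ (lcFr a).1 := mem_lcFr.2 ⟨hay, hya⟩
          have hc : ClosedIn (lcCl y).1 (lcFr a).1 := closedIn_iff.2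
            ⟨fun z hz => mem_lcFr.2 ⟨hay.trans (mem_lcCl.1 hz), fun e =>
              hya ((hay.antisymm (e ▸ mem_lcCl.1 hz)).eq).symm⟩,
              fun c hc z hz hcz => mem_lcCl.2 ((mem_lcCl.1 hc).trans hcz)⟩
          have hcl : (lcCl y).1 ⊆ (D.diffOpen hU).1 := (closedIn_iff.1 hc).1.trans hFr
          rw [Function.update_of_ne hya, ← mR_mR N (closedIn_fr_cl a) hc, hk₂,
            ← (hφ₁.mono hFr).glueHom_mR hc, (hφ₁.mono hcl).glueHom_cl, mR_mR]
      · have ha' : a ∈ (D.diffOpen hU).1 := ⟨ha, hax⟩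
        have hyx : y ≠ x := (hay.mem_closed hD' ha').2
        rw [Function.update_of_ne hax, Function.update_of_ne hyx, hφ₁ a ha' y hay]
    · by_cases hax : a = x
      · subst hax
        rw [Function.update_self, hk₁]
      · rw [Function.update_of_ne hax, hφ₂ a ⟨ha, hax⟩]
    · by_cases hax : a = x
      · subst hax
        rw [Function.update_self, hk₃]
      · rw [Function.update_of_ne hax, hφ₃ a ⟨ha, hax⟩]

end Lift

/-! ### Natural transformations of `ST`-modules -/

section NatTrans

variable {X : Type u} [TopologicalSpace X] {M N : ST X ⥤ AddCommGrpCat.{w}}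

/-- Compatibility of a family of homomorphisms `M(Y, j) → N(Y, j)` with the generators of `ST`. -/
structure IsNatural (η : ∀ (Y : LC X) (j : ZMod 2), K M Y j →+ K N Y j) : Prop where
  i : ∀ {U Y : LC X} (h : OpenIn U.1 Y.1) (j : ZMod 2) (m : K M U j),
    η Y j (mI M h j m) = mI N h j (η U j m)
  r : ∀ {Y C : LC X} (h : ClosedIn C.1 Y.1) (j : ZMod 2) (m : K M Y j),
    η C j (mR M h j m) = mR N h j (η Y j m)
  δ : ∀ {U C : LC X} (h : BoundaryPair U.1 C.1) (j k : ZMod 2) (hk : k = j + 1) (m : K M C j),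
    η U k ((M.map (stδ h j k hk)).hom m) = (N.map (stδ h j k hk)).hom (η C j m)

variable {η : ∀ (Y : LC X) (j : ZMod 2), K M Y j →+ K N Y j} [M.Additive] [N.Additive]

theorem IsNatural.term (hη : IsNatural η) {a b : STObj X} (t : Term STGen a b) :
    M.map (Presented.hom (R := STRel) t) ≫ AddCommGrpCat.ofHom (η b.set b.deg) =
      AddCommGrpCat.ofHom (η a.set a.deg) ≫ N.map (Presented.hom (R := STRel) t) := by
  induction t with
  | of g =>
    ext m
    cases g with
    | i U Y h j => exact hη.i h j m
    | r Y C h j => exact hη.r h j m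
    | δ C U h j k hk => exact hη.δ h j k hk m
  | id a =>
    change M.map (𝟙 (⟨a⟩ : ST X)) ≫ _ = _ ≫ N.map (𝟙 (⟨a⟩ : ST X))
    rw [M.map_id, N.map_id]
    exact (Category.id_comp _).trans (Category.comp_id _).symm
  | comp f g hf hg =>
    change M.map (Presented.hom f ≫ Presented.hom g) ≫ _ =
      _ ≫ N.map (Presented.hom f ≫ Presented.hom g)
    rw [M.map_comp, N.map_comp, Category.assoc, hg, ← Category.assoc, hf, Category.assoc]
  | zero a b =>
    change M.map (0 : (⟨a⟩ : ST X) ⟶ ⟨b⟩) ≫ _ = _ ≫ N.map (0 : (⟨a⟩ : ST X) ⟶ ⟨b⟩)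
    rw [M.map_zero, N.map_zero]
    exact Limits.zero_comp.trans Limits.comp_zero.symm
  | add f g hf hg =>
    change M.map (Presented.hom f + Presented.hom g) ≫ _ =
      _ ≫ N.map (Presented.hom f + Presented.hom g)
    rw [M.map_add, N.map_add, Preadditive.add_comp, Preadditive.comp_add, hf, hg]
  | neg f hf =>
    change M.map (-Presented.hom f) ≫ _ = _ ≫ N.map (-Presented.hom f)
    rw [M.map_neg, N.map_neg, Preadditive.neg_comp, Preadditive.comp_neg, hf]

/-- The homomorphism of `ST`-modules with given components. -/
def IsNatural.hom (hη : IsNatural η) : M ⟶ N where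
  app a := AddCommGrpCat.ofHom (η a.as.set a.as.deg)
  naturality := by
    rintro ⟨a⟩ ⟨b⟩ ⟨t⟩
    exact hη.term t

/-- Bijectivity follows from bijectivity for all points. -/
theorem IsNatural.bijective [Finite X] [T0Space X] (hη : IsNatural η)
    (hM : IsExactST M) (hN : IsExactST N)
    (h : ∀ x j, Function.Bijective (η (lcPt x) j)) (Y : LC X) (j : ZMod 2) :
    Function.Bijective (η Y j) := by
  induction Y using LC.induction generalizing j with
  | h Y ih =>
    rcases Y.1.eq_empty_or_nonempty with hY | hY
    · exact ⟨fun a b _ => by rw [eq_zero_of_empty M hY a, eq_zero_of_empty M hY b],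
        fun b => ⟨0, by rw [eq_zero_of_empty N hY b, map_zero]⟩⟩
    obtain ⟨x, hx, hmax⟩ := exists_maximal_point hY
    have hU : OpenIn (lcPt x).1 Y.1 := openIn_pt_of_maximal hx hmax
    have hE : Extension (lcPt x) Y (Y.diffOpen hU) := ⟨hU, rfl⟩
    have hC := ih (Y.diffOpen hU) ⟨Set.sdiff_subset, fun hs => (hs hx).2 rfl⟩
    -- The six-term sequence is cyclic, so five consecutive terms centred at `(Y, j)` exist in
    -- either degree, as the five lemma needs.
    have hj : j = j + 1 + 1 := by rw [add_assoc, show (1 : ZMod 2) + 1 = 0 from rfl, add_zero]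
    have hδ := hη.δ hE.boundaryPair
    exact AddMonoidHom.bijective_of_surjective_of_bijective_of_bijective_of_injective
      (M.map (stδ hE.boundaryPair (j + 1) j hj)).hom (mI M hU j) (mR M hE.closedIn j)
      (M.map (stδ hE.boundaryPair j (j + 1) rfl)).hom
      (N.map (stδ hE.boundaryPair (j + 1) j hj)).hom (mI N hU j) (mR N hE.closedIn j)
      (N.map (stδ hE.boundaryPair j (j + 1) rfl)).hom
      (η _ (j + 1)) (η _ j) (η Y j) (η _ j) (η _ (j + 1))
      (AddMonoidHom.ext fun m => (hδ _ _ _ m).symm) (AddMonoidHom.ext fun m => (hη.i hU j m).symm)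
      (AddMonoidHom.ext fun m => (hη.r hE.closedIn j m).symm)
      (AddMonoidHom.ext fun m => (hδ _ _ _ m).symm)
      (hM.exact_δ_i hE _ _ _) (hM.exact_i_r hE _) (hM.exact_r_δ hE _ _ _)
      (hN.exact_δ_i hE _ _ _) (hN.exact_i_r hE _) (hN.exact_r_δ hE _ _ _)
      (hC _).2 (h x j) (hC j) (h x _).1

/-- A family of homomorphisms from its parts of degree `0` and degree `1`. -/
def ofDegrees (f : ∀ Y : LC X, K M Y 0 →+ K N Y 0) (g : ∀ Y : LC X, K M Y 1 →+ K N Y 1)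
    (Y : LC X) (j : ZMod 2) : K M Y j →+ K N Y j :=
  match j with
  | ⟨0, _⟩ => f Y
  | ⟨1, _⟩ => g Y

omit [M.Additive] [N.Additive] in
theorem isNatural_ofDegrees (hM₀ : IsRealRankZeroLike M) (hN₀ : IsRealRankZeroLike N)
    {f : ∀ Y : LC X, K M Y 0 →+ K N Y 0} {g : ∀ Y : LC X, K M Y 1 →+ K N Y 1}
    (hfI : ∀ {U Y : LC X} (h : OpenIn U.1 Y.1) m, f Y (mI M h 0 m) = mI N h 0 (f U m))
    (hfR : ∀ {Y C : LC X} (h : ClosedIn C.1 Y.1) m, f C (mR M h 0 m) = mR N h 0 (f Y m))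
    (hgI : ∀ {U Y : LC X} (h : OpenIn U.1 Y.1) m, g Y (mI M h 1 m) = mI N h 1 (g U m))
    (hgR : ∀ {Y C : LC X} (h : ClosedIn C.1 Y.1) m, g C (mR M h 1 m) = mR N h 1 (g Y m))
    (hδ : ∀ {U C : LC X} (h : BoundaryPair U.1 C.1) m, f U (mD M h m) = mD N h (g C m)) :
    IsNatural (ofDegrees f g) where
  i := by
    intro U Y h j
    match j with
    | ⟨0, _⟩ => exact hfI h
    | ⟨1, _⟩ => exact hgI h
  r := by
    intro Y C h j
    match j with
    | ⟨0, _⟩ => exact hfR h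
    | ⟨1, _⟩ => exact hgR h
  δ := by
    intro U C h j k hk m
    subst hk
    match j with
    | ⟨0, _⟩ =>
      obtain ⟨Y, hY, hU, e⟩ := h
      have hE : Extension U ⟨Y, hY⟩ C := ⟨hU, e⟩
      have h₁ : M.map (stδ hE.boundaryPair 0 1 rfl) = 0 := hM₀ hE
      have h₂ : N.map (stδ hE.boundaryPair 0 1 rfl) = 0 := hN₀ hE
      change g U ((M.map (stδ hE.boundaryPair 0 1 rfl)).hom m) =
        (N.map (stδ hE.boundaryPair 0 1 rfl)).hom (f C m)
      rw [h₁, h₂]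
      exact map_zero (g U)
    | ⟨1, _⟩ => exact hδ h m

end NatTrans

/-! ### Lifting homomorphisms of `R`-modules -/

section Main

variable {X : Type u} [TopologicalSpace X] [Finite X] [T0Space X]
  {M N : ST X ⥤ AddCommGrpCat.{w}} (φ : (reduced X).obj M ⟶ (reduced X).obj N)

/-- The component at `({x}, 1)`. -/
def atPt (x : X) : K M (lcPt x) 1 →+ K N (lcPt x) 1 := (φ.app ⟨.pt x⟩).hom

/-- The component at `(nhdsKer {x} \ {x}, 0)`. -/
def atBd (x : X) : K M (lcBd x) 0 →+ K N (lcBd x) 0 := (φ.app ⟨.bd x⟩).hom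

/-- The component at `(nhdsKer {x}, 0)`. -/
def atOp (x : X) : K M (lcOpen x) 0 →+ K N (lcOpen x) 0 := (φ.app ⟨.op x⟩).hom

theorem reduced_naturality {a b : RObj X} (t : Term RGen a b)
    (m : M.obj (rObj X a)) :
    φ.app ⟨b⟩ (M.map (t.eval (rGen X)) m) = N.map (t.eval (rGen X)) (φ.app ⟨a⟩ m) :=
  congrArg (fun f => f.hom m) (φ.naturality (Presented.hom (R := RRel) t))

theorem atBd_mD (x : X) (m : K M (lcPt x) 1) :
    atBd φ x (mD M (extension_pt x).boundaryPair m) =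
      mD N (extension_pt x).boundaryPair (atPt φ x m) :=
  reduced_naturality φ (.of (.δ x)) m

theorem atBd_mI {z x : X} (h : Arrow z x) (m : K M (lcOpen z) 0) :
    atBd φ x (mI M h.openIn 0 m) = mI N h.openIn 0 (atOp φ z m) :=
  reduced_naturality φ (.of (.j z x h)) m

/-- A path from `y` to `x` gives a morphism of `RCat` whose image in `ST` is `i`. -/
theorem opCompat_atOp : OpCompat M N (atOp φ) := by
  intro x y h m
  obtain ⟨p⟩ := exists_dPath h
  have := reduced_naturality φ p.term m
  rw [eval_term] at this
  exact this.symm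

variable [M.Additive] [N.Additive]

/-- The gluing only uses φ on the smallest neighbourhoods. Each generator over `nhdsKer {x} \ {x}`
comes from the neighbourhood of a cover `z → x`, where naturality of φ applies. -/
theorem coglueHom_bd (hM : IsExactST M) (hM₀ : IsRealRankZeroLike M) (x : X) :
    coglueHom hM hM₀ (opCompat_atOp φ) (lcBd x) = atBd φ x := by
  refine hM.hom_ext_cogerm hM₀ fun y hy m => ?_
  rw [coglueHom_cogerm]
  obtain ⟨hyx, hne⟩ := mem_lcBd.1 hy
  obtain ⟨z, hz, hyz⟩ := exists_arrow_of_specializes' hyx hne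
  have hs : (lcOpen y).1 ⊆ (lcBd x).1 := (openIn_iff.1 (openIn_open hyz)).1.trans hz.subset
  have ho : OpenIn (lcOpen y).1 (lcBd x).1 := openIn_of_isOpen isOpen_nhdsKer hs
  have hc : ClosedIn (lcOpen y).1 (lcOpen y).1 := ⟨Set.univ, isClosed_univ, by simp⟩
  rw [cogerm_eq M hy (Set.inter_eq_right.2 hs).symm ho hc,
    cogerm_eq N hy (Set.inter_eq_right.2 hs).symm ho hc, mR_self, mR_self,
    ← mI_mI M (openIn_open hyz) hz.openIn ho, ← mI_mI N (openIn_open hyz) hz.openIn ho,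
    atBd_mI φ hz, ← opCompat_atOp φ z y hyz]

/-- Existence of lifts. -/
theorem EBPSpace.exists_lift (hX : EBPSpace X) (hM : IsExactST M) (hN : IsExactST N)
    (hM₀ : IsRealRankZeroLike M) (hN₀ : IsRealRankZeroLike N) (hMf : FreeAtNonOpenPoints M) :
    ∃ Φ : M ⟶ N, (reduced X).map Φ = φ ∧ (IsIso φ → IsIso Φ) := by
  let f := coglueHom hM hM₀ (opCompat_atOp φ)
  have hfb : ∀ x, f (lcBd x) = atBd φ x := coglueHom_bd φ hM hM₀
  have hfo : ∀ x, f (lcOpen x) = atOp φ x := coglueHom_open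
  obtain ⟨ψ, hψ, hψp, hψb⟩ := hX.exists_cl_family hM hM₀ hN hN₀ hMf f coglueHom_mI coglueHom_mR
    (atPt φ) (fun x m => by rw [hfb]; exact atBd_mD φ x m)
    (D := ⟨Set.univ, isClosed_univ.isLocallyClosed⟩) isClosed_univ
  let g := glueHom hN hN₀ ψ
  have hψ' : ∀ S, ClCompat M N ψ S := fun S => hψ.mono (Set.subset_univ S)
  have hgI : ∀ {U Y : LC X} (h : OpenIn U.1 Y.1) m, g Y (mI M h 1 m) = mI N h 1 (g U m) :=
    fun h m => (hψ' _).glueHom_mI h m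
  have hgR : ∀ {Y C : LC X} (h : ClosedIn C.1 Y.1) m, g C (mR M h 1 m) = mR N h 1 (g Y m) :=
    fun h m => (hψ' _).glueHom_mR h m
  have hgp : ∀ x, g (lcPt x) = atPt φ x := fun x => by
    ext m
    apply hN.mI_injective hN₀ (openIn_pt_cl x)
    rw [← hgI, ← hψp x trivial]
    exact DFunLike.congr_fun ((hψ' _).glueHom_cl) _
  have hη := isNatural_ofDegrees hM₀ hN₀ (f := f) (g := g) coglueHom_mI coglueHom_mR hgI hgR
    fun h m => hX.natural_glueHom hN hN₀ f coglueHom_mI coglueHom_mR isClosed_univ hψ hψb h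
      (Set.subset_univ _) m
  refine ⟨hη.hom, ?_, fun hφ => ?_⟩
  · refine NatTrans.ext (funext ?_)
    rintro ⟨x | x | x⟩
    · exact congrArg AddCommGrpCat.ofHom (hgp x)
    · exact congrArg AddCommGrpCat.ofHom (hfb x)
    · exact congrArg AddCommGrpCat.ofHom (hfo x)
  · have hb : ∀ a, Function.Bijective (φ.app a).hom := fun a =>
      (ConcreteCategory.isIso_iff_bijective (φ.app a)).1 inferInstance
    have h₁ : ∀ x, Function.Bijective (g (lcPt x)) := fun x => (hgp x).symm ▸ hb ⟨.pt x⟩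
    have h₂ : ∀ x, Function.Bijective (f (lcBd x)) := fun x => (hfb x).symm ▸ hb ⟨.bd x⟩
    have h₃ : ∀ x, Function.Bijective (f (lcOpen x)) := fun x => (hfo x).symm ▸ hb ⟨.op x⟩
    -- The group at `({x}, 0)` is the cokernel of `i` from `nhdsKer {x} \ {x}` to `nhdsKer {x}`, by
    -- surjectivity of `r` in degree 0.
    have h₄ : ∀ x, Function.Bijective (f (lcPt x)) := fun x => by
      have hE := extension_pt x
      have hr : ∀ m, f (lcPt x) (mR M hE.closedIn 0 m) = mR N hE.closedIn 0 (f _ m) :=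
        coglueHom_mR _
      refine ⟨AddMonoidHom.injective_of_surjective_of_injective_of_right_exact
        (mI M hE.openIn 0) (mR M hE.closedIn 0) (mI N hE.openIn 0) (mR N hE.closedIn 0)
        (f (lcBd x)) (f (lcOpen x)) (f (lcPt x))
        (AddMonoidHom.ext fun m => (coglueHom_mI hE.openIn m).symm)
        (AddMonoidHom.ext fun m => (hr m).symm) (hM.exact_i_r hE 0) (hN.exact_i_r hE 0)
        (h₂ x).2 (h₃ x).1 (hM.mR_surjective hM₀ hE.closedIn), fun n => ?_⟩
      obtain ⟨t, rfl⟩ := hN.mR_surjective hN₀ hE.closedIn n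
      obtain ⟨s, rfl⟩ := (h₃ x).2 t
      exact ⟨_, hr s⟩
    have h := hη.bijective hM hN fun x j => match j with
      | ⟨0, _⟩ => h₄ x
      | ⟨1, _⟩ => h₁ x
    exact (NatTrans.isIso_iff_isIso_app _).2 fun a =>
      (ConcreteCategory.isIso_iff_bijective _).2 (h a.as.set a.as.deg)

end Main

/-! ### Skyscraper modules -/

section Skyscraper

/-- The group `ℤ` if `P` holds, and `0` otherwise. -/
def intIf (P : Prop) : AddSubgroup ℤ where
  carrier := {n | ¬ P → n = 0}
  zero_mem' _ := rfl
  add_mem' {a b} ha hb h := by rw [ha h, hb h, add_zero]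
  neg_mem' {a} ha h := by rw [ha h, neg_zero]

open Classical in
/-- The identity of `ℤ` where it makes sense, and `0` otherwise. -/
noncomputable def transferHom (P Q : Prop) : intIf P →+ intIf Q :=
  AddMonoidHom.mk' (fun n => ⟨if Q then n.1 else 0, fun h => if_neg h⟩) fun a b => by
    ext; by_cases h : Q <;> simp [h]

/-- The homomorphism `transferHom` as a morphism. -/
noncomputable def transfer (P Q : Prop) : AddCommGrpCat.of (intIf P) ⟶ AddCommGrpCat.of (intIf Q) :=
  AddCommGrpCat.ofHom (transferHom P Q)

open Classical in
theorem coe_transfer (P Q : Prop) (n : intIf P) :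
    ((transfer P Q).hom n : intIf Q).1 = if Q then n.1 else 0 := rfl

theorem transfer_comp {P Q R : Prop} (h : P → R → Q) :
    transfer P Q ≫ transfer Q R = transfer P R := by
  ext n
  change ((transfer Q R).hom ((transfer P Q).hom n) : intIf R).1 = _
  have hn := n.2
  rw [coe_transfer, coe_transfer, coe_transfer]
  by_cases hP : P
  · by_cases hR : R
    · simp [hR, h hP hR]
    · simp [hR]
  · simp [hn hP]

theorem transfer_self (P : Prop) : transfer P P = 𝟙 _ := by
  ext n
  change _ = n.1
  rw [coe_transfer]
  by_cases hP : P
  · simp [hP]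
  · simp [hP, n.2 hP]

theorem transfer_eq_zero {P Q : Prop} (h : ¬ (P ∧ Q)) : transfer P Q = 0 := by
  ext n
  change _ = (0 : ℤ)
  rw [coe_transfer]
  by_cases hQ : Q
  · rw [n.2 fun hP => h ⟨hP, hQ⟩, ite_self]
  · rw [if_neg hQ]

theorem transfer_add_transfer {P Q R : Prop} (h : P ↔ Q ∨ R) (h' : ¬ (Q ∧ R)) :
    transfer P Q ≫ transfer Q P + transfer P R ≫ transfer R P = 𝟙 _ := by
  by_cases hQ : Q
  · have hR : ¬ R := fun hR => h' ⟨hQ, hR⟩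
    rw [transfer_eq_zero (P := P) (Q := R) (by tauto), Limits.zero_comp, add_zero,
      transfer_comp (by tauto), transfer_self]
  · rw [transfer_eq_zero (P := P) (Q := Q) (by tauto), Limits.zero_comp, zero_add,
      transfer_comp (by tauto), transfer_self]

variable {X : Type u} [TopologicalSpace X]

/-- The condition for the skyscraper module at `p` in degree `1` to be non-zero. -/
def skyCond (p : X) (a : STObj X) : Prop := p ∈ a.set.1 ∧ a.deg = 1

/-- The action of the generators on the skyscraper module. -/
noncomputable def skyGen (p : X) : ∀ ⦃a b : STObj X⦄, STGen a b →
    (AddCommGrpCat.of (intIf (skyCond p a)) ⟶ AddCommGrpCat.of (intIf (skyCond p b)))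
  | _, _, .i _ _ _ _ => transfer _ _
  | _, _, .r _ _ _ _ => transfer _ _
  | _, _, .δ _ _ _ _ _ _ => 0

theorem skyGen_rel (p : X) ⦃a b : STObj X⦄ (f g : Term STGen a b) (h : STRel f g) :
    f.eval (skyGen p) = g.eval (skyGen p) := by
  cases h with
  | i_self Y h j => exact transfer_self _
  | r_self Y h j => exact transfer_self _
  | biproduct Y Z W hYZ hZY hW hYo hYc hZo hZc j =>
    refine transfer_add_transfer ?_ ?_
    · simp only [skyCond, hW, Set.mem_union]; tauto
    · rintro ⟨h₁, h₂⟩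
      exact Set.disjoint_left.1 hYZ (subset_closure h₁.1) h₂.1
  | i_i U V Y hUV hVY hUY j =>
    obtain ⟨O, hO, e⟩ := hUV
    exact transfer_comp fun h₁ h₂ => ⟨(e ▸ h₁.1 : p ∈ O ∩ V.1).2, h₁.2⟩
  | r_r Y D C hDY hCD hCY j =>
    obtain ⟨O, hO, e⟩ := hCD
    exact transfer_comp fun h₁ h₂ => ⟨(e ▸ h₂.1 : p ∈ O ∩ D.1).2, h₁.2⟩
  | i_r Y U C E hU hC hE hEU hEC j =>
    obtain ⟨O, hO, e⟩ := hU
    change transfer _ _ ≫ transfer _ _ = transfer _ _ ≫ transfer _ _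
    rw [transfer_comp fun h₁ h₂ => ⟨(e ▸ h₁.1 : p ∈ O ∩ Y.1).2, h₁.2⟩,
      transfer_comp fun h₁ h₂ => ⟨hE ▸ ⟨h₁.1, h₂.1⟩, h₁.2⟩]
  | i_δ => exact Limits.comp_zero
  | δ_r => exact Limits.zero_comp
  | δ_i => exact Limits.zero_comp.trans Limits.comp_zero.symm

/-- The `ST`-module with value `ℤ` at `(Y, 1)` for `p ∈ Y` and `0` at all other objects. -/
noncomputable def skyscraper (p : X) : ST X ⥤ AddCommGrpCat.{0} :=
  Presented.lift _ (skyGen p) (skyGen_rel p)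

instance (p : X) : (skyscraper p).Additive := inferInstanceAs (Presented.lift _ _ _).Additive

theorem skyscraper_stI (p : X) {U Y : LC X} (h : OpenIn U.1 Y.1) (j : ZMod 2) :
    (skyscraper p).map (stI h j) = transfer (skyCond p ⟨U, j⟩) (skyCond p ⟨Y, j⟩) := rfl

theorem skyscraper_stR (p : X) {Y C : LC X} (h : ClosedIn C.1 Y.1) (j : ZMod 2) :
    (skyscraper p).map (stR h j) = transfer (skyCond p ⟨Y, j⟩) (skyCond p ⟨C, j⟩) := rfl

theorem skyscraper_stδ (p : X) {U C : LC X} (h : BoundaryPair U.1 C.1) (j k : ZMod 2)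
    (hk : k = j + 1) : (skyscraper p).map (stδ h j k hk) = 0 := rfl

theorem exact_transfer {P Q R : Prop} (h : Q ↔ P ∨ R) (h' : ¬ (P ∧ R)) :
    Function.Exact (transfer P Q) (transfer Q R) := by
  intro m
  constructor
  · intro hm
    have hm' := congrArg (fun z : intIf R => z.1) hm
    change ((transfer Q R).hom m : intIf R).1 = 0 at hm'
    rw [coe_transfer] at hm'
    have hP : ¬ P → m.1 = 0 := fun hP => by
      by_cases hR : R
      · rwa [if_pos hR] at hm'
      · exact m.2 (by tauto)
    refine ⟨(⟨m.1, hP⟩ : intIf P), Subtype.ext ?_⟩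
    refine (coe_transfer P Q _).trans ?_
    by_cases hQ : Q
    · rw [if_pos hQ]
    · rw [if_neg hQ, m.2 hQ]
  · rintro ⟨n, rfl⟩
    have e : transfer P Q ≫ transfer Q R = 0 := by
      rw [transfer_comp (by tauto), transfer_eq_zero h']
    exact congrArg (fun f => f.hom n) e

/-- As δ is zero, exactness means short exactness for `U`, `Y`, `C`, which holds since a point of
`Y` lies in exactly one of `U` and `C`. -/
theorem skyscraper_exact (p : X) : IsExactST (skyscraper p) where
  exact_i_r := by
    intro U Y C h j
    rw [skyscraper_stI, skyscraper_stR]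
    have h₁ : p ∈ U.1 → p ∈ Y.1 := by
      obtain ⟨O, hO, e⟩ := h.openIn
      exact fun hp => (e ▸ hp : p ∈ O ∩ Y.1).2
    have h₂ : p ∈ C.1 ↔ p ∈ Y.1 ∧ p ∉ U.1 := by rw [h.eq_diff]; rfl
    refine exact_transfer ?_ ?_ <;> simp only [skyCond] <;> tauto
  exact_r_δ := by
    intro U Y C h j k hk
    rw [skyscraper_stδ, skyscraper_stR]
    intro m
    refine ⟨fun _ => ⟨(transfer _ _).hom m, ?_⟩, fun _ => rfl⟩
    have hC : p ∈ C.1 → p ∈ Y.1 := by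
      rw [h.eq_diff]; exact fun h => h.1
    have e : transfer (skyCond p ⟨C, j⟩) (skyCond p ⟨Y, j⟩) ≫
        transfer _ (skyCond p ⟨C, j⟩) = 𝟙 _ := by
      rw [transfer_comp fun h₁ h₂ => ⟨hC h₁.1, h₁.2⟩, transfer_self]
    exact congrArg (fun f => f.hom m) e
  exact_δ_i := by
    intro U Y C h j k hk
    rw [skyscraper_stδ, skyscraper_stI]
    have hU : p ∈ U.1 → p ∈ Y.1 := by
      obtain ⟨O, hO, e⟩ := h.openIn
      exact fun hp => (e ▸ hp : p ∈ O ∩ Y.1).2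
    have e : transfer (skyCond p ⟨U, k⟩) (skyCond p ⟨Y, k⟩) ≫
        transfer _ (skyCond p ⟨U, k⟩) = 𝟙 _ := by
      rw [transfer_comp fun h₁ h₂ => ⟨hU h₁.1, h₁.2⟩, transfer_self]
    intro m
    constructor
    · intro hm
      refine ⟨0, ?_⟩
      have e' := congrArg (fun f => f.hom m) e
      change (transfer _ _).hom ((transfer _ _).hom m) = m at e'
      have hm' : (transfer (skyCond p ⟨U, k⟩) (skyCond p ⟨Y, k⟩)).hom m = 0 := hm
      rw [← e', hm']
      exact (map_zero _).symm
    · rintro ⟨n, rfl⟩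
      exact map_zero (transfer (skyCond p ⟨U, k⟩) (skyCond p ⟨Y, k⟩)).hom

theorem skyscraper_realRankZeroLike (p : X) : IsRealRankZeroLike (skyscraper p) := fun _ => rfl

theorem skyscraper_free [Finite X] [T0Space X] (p : X) : FreeAtNonOpenPoints (skyscraper p) :=
  fun _ _ => inferInstanceAs (Module.Free ℤ (AddSubgroup.toIntSubmodule (intIf _)))

/-- The map is the identity of ℤ where `p` and `q` both lie in `Y`, in degree 1. An open subset
containing `p` contains `q`, and a closed subset containing `q` contains `p`, whenever both lie in
`Y`. -/
theorem isNatural_skyscraper [Finite X] {p q : X} (h : q ⤳ p) :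
    IsNatural (M := skyscraper p) (N := skyscraper q)
      (fun Y j => transferHom (skyCond p ⟨Y, j⟩) (skyCond q ⟨Y, j⟩)) where
  i := by
    intro U Y hU j m
    obtain ⟨hUY, hu⟩ := openIn_iff.1 hU
    have e : transfer (skyCond p ⟨U, j⟩) (skyCond p ⟨Y, j⟩) ≫ transfer _ (skyCond q ⟨Y, j⟩) =
        transfer _ (skyCond q ⟨U, j⟩) ≫ transfer _ _ := by
      rw [transfer_comp fun h₁ h₂ => ⟨hUY h₁.1, h₁.2⟩,
        transfer_comp fun h₁ h₂ => ⟨hu p h₁.1 q h₂.1 h, h₁.2⟩]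
    exact congrArg (fun f => f.hom m) e
  r := by
    intro Y C hC j m
    obtain ⟨hCY, hc⟩ := closedIn_iff.1 hC
    have e : transfer (skyCond p ⟨Y, j⟩) (skyCond p ⟨C, j⟩) ≫ transfer _ (skyCond q ⟨C, j⟩) =
        transfer _ (skyCond q ⟨Y, j⟩) ≫ transfer _ _ := by
      rw [transfer_comp fun h₁ h₂ => ⟨hc q h₂.1 p h₁.1 h, h₁.2⟩,
        transfer_comp fun h₁ h₂ => ⟨hCY h₂.1, h₁.2⟩]
    exact congrArg (fun f => f.hom m) e
  δ := by
    intro U C hB j k hk m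
    rw [skyscraper_stδ, skyscraper_stδ]
    exact map_zero (transferHom (skyCond p ⟨U, k⟩) (skyCond q ⟨U, k⟩))

/-- Two homomorphisms between skyscraper modules with the same reduction. -/
theorem exists_ne_reduced_eq [Finite X] [T0Space X] {p q : X} (h : q ⤳ p) (hne : q ≠ p) :
    ∃ Φ Ψ : skyscraper p ⟶ skyscraper q, Φ ≠ Ψ ∧ (reduced X).map Φ = (reduced X).map Ψ := by
  classical
  refine ⟨(isNatural_skyscraper h).hom, 0, fun e => ?_, ?_⟩
  · let Y : LC X := ⟨Set.univ, isClosed_univ.isLocallyClosed⟩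
    have e₁ := congrArg (fun f => f.app (stObj Y 1)) e
    have e₂ : transferHom (skyCond p ⟨Y, 1⟩) (skyCond q ⟨Y, 1⟩) = 0 :=
      congrArg AddCommGrpCat.Hom.hom e₁
    have e₃ := congrArg Subtype.val (DFunLike.congr_fun e₂ ⟨1, fun h => (h ⟨trivial, rfl⟩).elim⟩)
    have e₄ : (if skyCond q ⟨Y, 1⟩ then (1 : ℤ) else 0) = 0 := e₃
    rw [if_pos ⟨trivial, rfl⟩] at e₄
    exact one_ne_zero e₄
  · refine NatTrans.ext (funext ?_)
    have h01 : (0 : ZMod 2) ≠ 1 := by decide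
    rintro ⟨x | x | x⟩
    -- A singleton cannot contain both `p` and `q`; the remaining objects have degree 0.
    · exact transfer_eq_zero fun hx => hne (hx.2.1.trans hx.1.1.symm)
    · exact transfer_eq_zero fun hx => h01 hx.1.2
    · exact transfer_eq_zero fun hx => h01 hx.1.2

end Skyscraper

/-! ### The Sierpiński space -/

section Sierpinski

theorem specializes_prop {y x : Prop} : y ⤳ x ↔ (x → y) :=
  Topology.IsUpperSet.specializes_iff_le

theorem Arrow.prop {y x : Prop} (h : Arrow y x) : y = True ∧ x = False := by
  obtain ⟨h₁, h₂, -⟩ := arrow_iff.1 h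
  rw [specializes_prop] at h₁
  by_cases hx : x <;> by_cases hy : y <;> simp_all

theorem arrow_true_false : Arrow True False := by
  refine arrow_iff.2 ⟨specializes_prop.2 False.elim, by simp, fun z _ _ => ?_⟩
  by_cases hz : z <;> simp [hz]

theorem uniquePathSpace_prop : UniquePathSpace Prop := by
  refine fun y x => ⟨fun p q => ?_⟩
  induction p with
  | nil x =>
    cases q with
    | nil => rfl
    | cons h p =>
      have h' := p.specializes
      rw [h.prop.1, h.prop.2, specializes_prop] at h'
      exact (h' trivial).elim
  | cons h p ih =>
    cases q with
    | nil =>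
      have h' := p.specializes
      rw [h.prop.1, h.prop.2, specializes_prop] at h'
      exact (h' trivial).elim
    | cons h' q =>
      obtain rfl := h.prop.2.trans h'.prop.2.symm
      rw [ih q]

/-- Nonempty open sets contain `True` and nonempty closed sets contain `False`, so the two
singletons form the only possible elementary pair. -/
theorem ebpSpace_prop : EBPSpace Prop where
  uniquePath := uniquePathSpace_prop
  elementary U C h := by
    obtain ⟨u, hu⟩ := h.connected_left.1
    obtain ⟨c, hc⟩ := h.connected_right.1
    have hU : True ∈ U := (specializes_prop.2 fun _ => trivial).mem_open h.isOpen hu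
    have hC : False ∈ C := (specializes_prop.2 False.elim).mem_closed h.isClosed hc
    have hd := Set.disjoint_left.1 (boundaryPair_iff.1 h.boundaryPair).1
    refine ⟨True, False, arrow_true_false, Set.ext fun z => ?_, Set.ext fun z => ?_⟩
    · rw [mem_nhdsKer_singleton, specializes_prop]
      by_cases hz : z
      · simp [hz, hU]
      · simpa [hz] using fun hF => hd hF hC
    · rw [← specializes_iff_mem_closure, specializes_prop]
      by_cases hz : z
      · simpa [hz] using hd hU
      · simp [hz, hC]

end Sierpinski

end FilteredK

theorem mainTheorem6 :
    (∀ (X : Type u) [TopologicalSpace X] [Finite X] [T0Space X], EBPSpace X →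
      ∀ (M N : FilteredK.ST X ⥤ AddCommGrpCat.{w}) [M.Additive] [N.Additive],
        IsExactST M → IsExactST N →
        IsRealRankZeroLike M → IsRealRankZeroLike N →
        FreeAtNonOpenPoints M → FreeAtNonOpenPoints N →
        ∀ φ : (reduced X).obj M ⟶ (reduced X).obj N,
          ∃ Φ : M ⟶ N, (reduced X).map Φ = φ ∧ (IsIso φ → IsIso Φ)) ∧
    (∃ (X : Type) (_ : TopologicalSpace X) (_ : Finite X) (_ : T0Space X), EBPSpace X ∧
      ∃ M N : FilteredK.ST X ⥤ AddCommGrpCat.{0}, M.Additive ∧ N.Additive ∧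
        IsExactST M ∧ IsExactST N ∧
        IsRealRankZeroLike M ∧ IsRealRankZeroLike N ∧
        FreeAtNonOpenPoints M ∧ FreeAtNonOpenPoints N ∧
        ∃ Φ Ψ : M ⟶ N, Φ ≠ Ψ ∧ (reduced X).map Φ = (reduced X).map Ψ) := by
  refine ⟨fun X _ _ _ hX M N _ _ hM hN hM₀ hN₀ hMf _ φ =>
    hX.exists_lift φ hM hN hM₀ hN₀ hMf, ?_⟩
  exact ⟨Prop, inferInstance, inferInstance, inferInstance, ebpSpace_prop, skyscraper False,
    skyscraper True, inferInstance, inferInstance, skyscraper_exact _, skyscraper_exact _,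
    skyscraper_realRankZeroLike _, skyscraper_realRankZeroLike _, skyscraper_free _,
    skyscraper_free _, exists_ne_reduced_eq (specializes_prop.2 False.elim) (by simp)⟩
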